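/- **Generalised subgraph freeness.** Graphs are finite and simple; $N_1^G(v)$ is the set consisting of $v$ and its neighbours in $G$. A marked graph is a graph $F$ with every vertex marked "full", "semifull" or "partial". An embedding of $F$ into a graph $G$ is an injective map $f:V(F)\to V(G)$ such that for every $v\in V(F)$: if $v$ is full, then $N_1^G(f(v))=f(N_1^F(v))$; if $v$ is semifull, then $N_1^G(f(v))\cap f(V(F))=f(N_1^F(v))$; if $v$ is partial, then $N_1^G(f(v))\supseteq f(N_1^F(v))$. $G$ is $F$-free if there is no embedding of $F$ into $G$. A graph property $\mathcal P$ (a class of graphs closed under isomorphism) is *GSF-local* if there are an integer $s$ and a sequence $(\mathcal F_n)_{n\in\mathbb N}$ of sets of marked graphs, each marked graph having at most $s$ vertices, such that for every $n$ and every $n$-vertex graph $G$: $G\in\mathcal P$ if and only if $G$ is $F$-free for all $F\in\mathcal F_n$. **The structures.** Let $D\ge 2$ and $d\in\mathbb N$, write $[D]^2$ for the set of pairs over $[D]=\{1,\dots,D\}$, let $K=([D]^2)^2$, and let $H$ be a $D$-regular graph on the vertex set $K$ given by a rotation map, that is, an involution $\mathrm{ROT}_H$ of $K\times[D]$. Put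 $\mathrm{ROT}_{H^2}(k,(i,j))=(l,(j',i'))$ where $\mathrm{ROT}_H(k,i)=(k',i')$ and $\mathrm{ROT}_H(k',j)=(l,j')$. Let $\sigma$ consist of the binary relation symbols $E_{i,j}$ $(i,j\in[D]^2)$, $F_k$ $(k\in K)$, $R$, and $L_k$ $(k\in K)$; let $\ell$ be the number of these symbols and number them $1,\dots,\ell$ in any fixed way. Write $F(x,y)$ for "$F_k(x,y)$ for some $k$", and call $x$ a root if there is no $y$ with $F(y,x)$. Let $\mathbf P'_{zigzag}$ be the class of finite $\sigma$-structures $\mathcal A$ (with the empty structure allowed) in which every element is contained in at most $d$ tuples and which satisfy: 1. (tree) There is at most one root. Every $x$ either is a root with $R(x,x)$, or has exactly one $y$ with $F(y,x)$ and lies in no tuple of $R$. Every $x$ satisfies one of the following. (a) There is no $y$ with $F(x,y)$, $L_k(x,x)$ holds for all $k$, and $L_k(x,y)$, $L_k(y,x)$ fail for all $k$ and all $y\ne x$. (b) $x$ lies in no tuple of any $L_k$, and for each $k$ there is $y_k\neq x$ with $F_k(x,y_k)$, with $F_{k'}(x,y_k)$ false for all $k'\ne k$, and with $F_k(x,y)$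 false for all $y\neq y_k$. 2. (rotation map) $E_{i,j}(x,y)$ implies $E_{j,i}(y,x)$. For all $x$ and $i$ there is $j$ such that exactly one $y$ satisfies $E_{i,j}(x,y)$ and, for $j'\neq j$, no $y$ satisfies $E_{i,j'}(x,y)$. 3. (base) If $x$ is a root, then $E_{i,i}(x,x)$ holds for all $i$; $E_{i,j}(x,y)$ and $E_{i,j}(y,x)$ fail for all $i,j$ and all $y\neq x$; and whenever $\mathrm{ROT}_{H^2}(k,i)=(k',i')$ there are $y,y'$ with $F_k(x,y)$, $F_{k'}(x,y')$ and $E_{i,i'}(y,y')$. 4. (recursion) For all $x,z$ such that $x$ is not a root and at least one of $x,z$ has an outgoing $F$-edge, and all $k_1,k_2,l_1,l_2\in[D]^2$: if $E_{k_1,l_1}(x,y)$ and $E_{k_2,l_2}(y,z)$ for some $y$, then for all $i,j,i',j'\in[D]$, $k,l\in K$ with $\mathrm{ROT}_H(k,i)=((k_1,k_2),i')$ and $\mathrm{ROT}_H((l_2,l_1),j)=(l,j')$ there are $x',z'$ with $F_k(x,x')$, $F_l(z,z')$ and $E_{(i,j),(j',i')}(x',z')$. **The graphs.** For a $\sigma$-structure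 $\mathcal A$ with universe $A$ in which every element lies in at most $d$ tuples, list the tuples at each element: $\mathrm{ans}(a,i)$, for $a\in A$ and $1\le i\le d$, is a tuple containing $a$ (together with the number of its relation) or $\bot$, and each tuple containing $a$ is $\mathrm{ans}(a,i)$ for exactly one $i$. Let $f(\mathcal A)$ be the graph with vertices $a$, $v^k_{a,i}$, $w_{a,i}$ ($a\in A$, $1\le i\le d$, $1\le k\le \ell$) and the following edges: - $\{a,v^\ell_{a,i}\}$, and $\{v^k_{a,i},v^{k+1}_{a,i}\}$ for $1\le k<\ell$; - $\{v^1_{a,i},v^1_{b,j}\}$, $\{v^k_{b,j},w_{b,j}\}$ and $\{v^k_{b,j},w_{a,i}\}$ whenever $a\ne b$ and $\mathrm{ans}(a,i)=\mathrm{ans}(b,j)$ is the tuple $(a,b)$ of the $k$-th relation; - $\{v^k_{a,i},w_{a,i}\}$ whenever $\mathrm{ans}(a,i)$ is the tuple $(a,a)$ of the $k$-th relation; - $\{v^1_{a,i},w_{a,i}\}$ and $\{v^2_{a,i},w_{a,i}\}$ whenever $\mathrm{ans}(a,i)=\bot$. Up to isomorphism $f(\mathcal A)$ does not depend on the listing.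 Let $\mathcal P_{graph}$ be the class of graphs isomorphic to $f(\mathcal A)$ for some $\mathcal A\in\mathbf P'_{zigzag}$. **Lemma.** The graph property $\mathcal P_{graph}$ is GSF-local. -/

import Mathlib

/-! Generalised subgraph freeness -/

/-- A property of graphs: a class of graphs that is closed under isomorphism. -/
structure GraphProperty where
  holds : ∀ {V : Type}, SimpleGraph V → Prop
  iso_closed : ∀ {V W : Type} (G : SimpleGraph V) (H : SimpleGraph W),
    Nonempty (G ≃g H) → holds G → holds H

inductive Mark where
  | full
  | semifull
  | partial_

/-- A finite graph, each of whose vertices carries a mark. -/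
structure MarkedGraph where
  V : Type
  [fin : Finite V]
  graph : SimpleGraph V
  mark : V → Mark

/-- The `1`-neighbourhood of a vertex (the vertex itself and its neighbours). -/
def closedNbhd {V : Type} (G : SimpleGraph V) (v : V) : Set V :=
  {u | u = v ∨ G.Adj v u}

/-- Embeddings of a marked graph into a graph. -/
structure MarkedGraph.IsEmbedding (F : MarkedGraph) {V : Type} (G : SimpleGraph V)
    (f : F.V → V) : Prop where
  injective : Function.Injective f
  full : ∀ v, F.mark v = Mark.full →
    closedNbhd G (f v) = f '' closedNbhd F.graph v
  semifull : ∀ v, F.mark v = Mark.semifull →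
    closedNbhd G (f v) ∩ Set.range f = f '' closedNbhd F.graph v
  partial_ : ∀ v, F.mark v = Mark.partial_ →
    f '' closedNbhd F.graph v ⊆ closedNbhd G (f v)

/-- `G` is `F`-free. -/
def MarkedGraph.Free (F : MarkedGraph) {V : Type} (G : SimpleGraph V) : Prop :=
  ¬ ∃ f : F.V → V, F.IsEmbedding G f

/-- `P` is local with respect to the sequence `Fs` of sets of marked graphs. -/
def GraphProperty.IsLocalFor (P : GraphProperty) (Fs : ℕ → Set MarkedGraph) : Prop :=
  ∃ s : ℕ, ∀ n : ℕ,
    (∀ F ∈ Fs n, Nat.card F.V ≤ s) ∧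
    ∀ (V : Type) [Finite V] (G : SimpleGraph V), Nat.card V = n →
      (P.holds G ↔ ∀ F ∈ Fs n, F.Free G)

def GraphProperty.GSFLocal (P : GraphProperty) : Prop :=
  ∃ Fs : ℕ → Set MarkedGraph, P.IsLocalFor Fs

/-! Finite structures over a signature of binary relation symbols -/

/-- A finite structure over the set `S` of binary relation symbols. -/
structure FinStr (S : Type) where
  carrier : Type
  [fin : Finite carrier]
  rel : S → carrier → carrier → Prop

namespace FinStr

variable {S : Type}

/-- The tuples of `A` that contain `a`; `(R, b, c)` stands for the tuple `(b, c)` of the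
relation `R`. -/
def tuplesAt (A : FinStr S) (a : A.carrier) : Set (S × A.carrier × A.carrier) :=
  {t | A.rel t.1 t.2.1 t.2.2 ∧ (t.2.1 = a ∨ t.2.2 = a)}

/-- The degree of an element: the number of tuples that contain it. -/
noncomputable def degree (A : FinStr S) (a : A.carrier) : ℕ := (A.tuplesAt a).ncard

/-- `ans` lists the tuples at each element, as the query oracle of the bounded-degree model
does: `ans a i` is the tuple in the `i`-th slot of `a`, or `none` for an unused slot, and every
tuple that contains `a` is in exactly one slot of `a`. -/
structure IsListing (A : FinStr S) (d : ℕ)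
    (ans : A.carrier → Fin d → Option (S × A.carrier × A.carrier)) : Prop where
  sound : ∀ a i t, ans a i = some t → t ∈ A.tuplesAt a
  complete : ∀ a, ∀ t ∈ A.tuplesAt a, ∃! i, ans a i = some t

end FinStr

/-! The property of relational structures -/

/-- The index set `[D]²`. -/
abbrev Idx (D : ℕ) : Type := Fin D × Fin D

/-- The index set `([D]²)²`, which is also the vertex set of the base graph. -/
abbrev Idx2 (D : ℕ) : Type := Idx D × Idx D

/-- The binary relation symbols `E_{i,j}`, `F_k`, `R`, `L_k`. -/
inductive ZSym (D : ℕ) : Type where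
  | E (i j : Idx D) : ZSym D
  | F (k : Idx2 D) : ZSym D
  | R : ZSym D
  | L (k : Idx2 D) : ZSym D

/-- The rotation map of the square of the graph with rotation map `rot`: walk along the edge
labelled `i.1`, then along the edge labelled `i.2`. -/
def rotSq {D : ℕ} (rot : Idx2 D × Fin D → Idx2 D × Fin D) (p : Idx2 D × Idx D) :
    Idx2 D × Idx D :=
  let q := rot (p.1, p.2.1)
  let r := rot (q.1, p.2.2)
  (r.1, (r.2, q.2))

namespace ZigZag

variable {D : ℕ}

/-- `F(x, y)`, the union of the relations `F_k`. -/
def Fany (A : FinStr (ZSym D)) (x y : A.carrier) : Prop := ∃ k, A.rel (ZSym.F k) x y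

/-- `x` has no incoming `F`-edge. -/
def Root (A : FinStr (ZSym D)) (x : A.carrier) : Prop := ∀ y, ¬ Fany A y x

/-- The tree formula, with "at most one root" in place of "exactly one root". -/
def TreeRelaxed (A : FinStr (ZSym D)) : Prop :=
  (∀ x y, Root A x → Root A y → x = y) ∧
  (∀ x, (Root A x ∧ A.rel ZSym.R x x) ∨
    ((∃! y, Fany A y x) ∧ (¬ ∃ y, A.rel ZSym.R x y) ∧ ¬ ∃ y, A.rel ZSym.R y x)) ∧
  (∀ x,
    ((¬ ∃ y, Fany A x y) ∧ (∀ k, A.rel (ZSym.L k) x x) ∧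
      ∀ y, y ≠ x → (∀ k, ¬ A.rel (ZSym.L k) x y) ∧ ∀ k, ¬ A.rel (ZSym.L k) y x) ∨
    ((¬ ∃ y, ∃ k, A.rel (ZSym.L k) x y ∨ A.rel (ZSym.L k) y x) ∧
      ∀ k, ∃ y, x ≠ y ∧ A.rel (ZSym.F k) x y ∧
        (∀ k', k' ≠ k → ¬ A.rel (ZSym.F k') x y) ∧
        ∀ y', y' ≠ y → ¬ A.rel (ZSym.F k) x y'))

/-- The relations `E_{i,j}` encode a rotation map. -/
def RotationMap (A : FinStr (ZSym D)) : Prop :=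
  (∀ x y, ∀ i j : Idx D, A.rel (ZSym.E i j) x y → A.rel (ZSym.E j i) y x) ∧
  (∀ x, ∀ i : Idx D, ∃ j : Idx D,
    (∃! y, A.rel (ZSym.E i j) x y) ∧ ∀ j', j' ≠ j → ¬ ∃ y, A.rel (ZSym.E i j') x y)

/-- The root carries one `E`-loop for each label and no other `E`-edge, and its children carry
the square of the base graph. -/
def Base (rot : Idx2 D × Fin D → Idx2 D × Fin D) (A : FinStr (ZSym D)) : Prop :=
  ∀ x, Root A x →
    ((∀ i : Idx D, A.rel (ZSym.E i i) x x) ∧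
      ∀ i j : Idx D, ∀ y, x ≠ y → ¬ A.rel (ZSym.E i j) x y ∧ ¬ A.rel (ZSym.E i j) y x) ∧
    ∀ (k k' : Idx2 D) (i i' : Idx D), rotSq rot (k, i) = (k', i') →
      ∃ y y', A.rel (ZSym.F k) x y ∧ A.rel (ZSym.F k') x y' ∧ A.rel (ZSym.E i i') y y'

/-- Below the root, the children of a level carry the zig-zag product of the square of the
graph on that level with the base graph. -/
def Recursion (rot : Idx2 D × Fin D → Idx2 D × Fin D) (A : FinStr (ZSym D)) : Prop :=
  ∀ x z, Root A x ∨ ((¬ ∃ y, Fany A x y) ∧ ¬ ∃ y, Fany A z y) ∨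
    ∀ k₁ k₂ l₁ l₂ : Idx D,
      (∃ y, A.rel (ZSym.E k₁ l₁) x y ∧ A.rel (ZSym.E k₂ l₂) y z) →
      ∀ (i j i' j' : Fin D) (k l : Idx2 D),
        rot (k, i) = ((k₁, k₂), i') → rot ((l₂, l₁), j) = (l, j') →
        ∃ x' z', A.rel (ZSym.F k) x x' ∧ A.rel (ZSym.F l) z z' ∧
          A.rel (ZSym.E (i, j) (j', i')) x' z'

/-- The class of structures of degree at most `d` that satisfy the relaxed formula. -/
def PZigZag' (d : ℕ) (rot : Idx2 D × Fin D → Idx2 D × Fin D) : Set (FinStr (ZSym D)) :=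
  {A | (∀ a, A.degree a ≤ d) ∧
    TreeRelaxed A ∧ RotationMap A ∧ Base rot A ∧ Recursion rot A}

end ZigZag

/-! The encoding of structures by graphs -/

/-- The vertices of the encoding: the elements `a`, the path vertices `v_{a,i}^k` and the
vertices `w_{a,i}`.  The indices `i` and `k`, counted from `1` in the usual notation, are
counted from `0` here. -/
inductive ArrowVert (A : Type) (d ℓ : ℕ) : Type where
  | el (a : A) : ArrowVert A d ℓ
  | v (a : A) (i : Fin d) (k : Fin ℓ) : ArrowVert A d ℓ
  | w (a : A) (i : Fin d) : ArrowVert A d ℓ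

open ArrowVert in
/-- The edges of the encoding (each listed in one direction), where `e` numbers the relation
symbols. -/
inductive ArrowEdge {S : Type} {d ℓ : ℕ} (e : S ≃ Fin ℓ) (A : FinStr S)
    (ans : A.carrier → Fin d → Option (S × A.carrier × A.carrier)) :
    ArrowVert A.carrier d ℓ → ArrowVert A.carrier d ℓ → Prop where
  | attach (a : A.carrier) (i : Fin d) (k : Fin ℓ) (hk : k.val + 1 = ℓ) :
      ArrowEdge e A ans (el a) (v a i k)
  | path (a : A.carrier) (i : Fin d) (k k' : Fin ℓ) (hk : k.val + 1 = k'.val) :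
      ArrowEdge e A ans (v a i k) (v a i k')
  | arrow_head (a b : A.carrier) (i j : Fin d) (R : S) (hab : a ≠ b)
      (ha : ans a i = some (R, a, b)) (hb : ans b j = some (R, a, b)) :
      ArrowEdge e A ans (v b j (e R)) (w b j)
  | arrow_head' (a b : A.carrier) (i j : Fin d) (R : S) (hab : a ≠ b)
      (ha : ans a i = some (R, a, b)) (hb : ans b j = some (R, a, b)) :
      ArrowEdge e A ans (v b j (e R)) (w a i)
  | arrow_mid (a b : A.carrier) (i j : Fin d) (R : S) (hab : a ≠ b)
      (ha : ans a i = some (R, a, b)) (hb : ans b j = some (R, a, b))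
      (k : Fin ℓ) (hk : k.val = 0) :
      ArrowEdge e A ans (v a i k) (v b j k)
  | loop (a : A.carrier) (i : Fin d) (R : S) (ha : ans a i = some (R, a, a)) :
      ArrowEdge e A ans (v a i (e R)) (w a i)
  | non_arrow (a : A.carrier) (i : Fin d) (ha : ans a i = none)
      (k : Fin ℓ) (hk : k.val ≤ 1) :
      ArrowEdge e A ans (v a i k) (w a i)

/-- The graph that encodes the structure `A`, listed by `ans`. -/
def arrowGraph {S : Type} {d ℓ : ℕ} (e : S ≃ Fin ℓ) (A : FinStr S)
    (ans : A.carrier → Fin d → Option (S × A.carrier × A.carrier)) :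
    SimpleGraph (ArrowVert A.carrier d ℓ) :=
  SimpleGraph.fromRel (ArrowEdge e A ans)

/-- The graphs isomorphic to the encoding of some structure in `PZigZag'`. -/
def PGraph {D ℓ : ℕ} (d : ℕ) (rot : Idx2 D × Fin D → Idx2 D × Fin D) (e : ZSym D ≃ Fin ℓ) :
    GraphProperty where
  holds G := ∃ A ∈ ZigZag.PZigZag' d rot,
    ∃ ans : A.carrier → Fin d → Option (ZSym D × A.carrier × A.carrier),
      A.IsListing d ans ∧ Nonempty (G ≃g arrowGraph e A ans)
  iso_closed := by
    rintro V W G H ⟨φ⟩ ⟨A, hA, ans, hans, ⟨ψ⟩⟩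
    exact ⟨A, hA, ans, hans, ⟨φ.symm.trans ψ⟩⟩

/-! Neighbourhoods and local embeddings -/

/-! For every n, forbid all marked graphs with at most s vertices that embed in no graph of the
property. Graphs in the property avoid them by choice. Conversely, let G avoid them, and let S be a
nonempty set of at most s vertices. The subgraph on S, with a vertex marked full exactly when all
its neighbours lie in S, embeds in G. So it is not forbidden and also embeds in the encoding of some
model. Thus every small piece of G is a piece of an encoding, and the pieces have to be assembled
(`PGraph_holds_of_local`).

Encodings have degrees at most d + 7. Testing stars carries this bound over to G, so that balls of a
fixed radius r about two vertices have at most s vertices. If G is nonempty, the model behind a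
piece has an element, which lies in at least |K| ≥ 16 tuples. Hence d ≥ 16, while all vertices of an
encoding other than the elements have degree at most 7. So the elements are recognised in G as the
vertices of degree d.

Every edge from such a vertex x to a vertex u starts a gadget: an unused slot, a loop or an arrow.
The pair (x, u) determines the content of the gadget and, for an arrow, its other end. Indeed, once
pendant vertices are ignored, the walk from x through u can be continued in only one way. The place
of the pendant vertices and the way the walk ends (`IsSpine`, `IsFork`, `IsDeadEnd`) reveal the
content. So G defines a structure, `decode`. Gluing gadgets gives a covering map from the encoding
of this structure to G. Its fibres over elements are trivial because degrees are preserved, and this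
makes it an isomorphism (`IsDecodable.nonempty_iso`).

It remains to see that `decode` satisfies the axioms. All of them but one speak about elements that
are at most three tuples away from a given one, and they transfer along local similarities
(`FinStr.IsLocalSim`). The exception, that there is at most one root, compares two arbitrary
elements. It is covered by taking balls about pairs of vertices. No existence of a root has to be
detected, since only uniqueness is demanded. -/

namespace SimpleGraph

variable {V W X : Type*}

/-- The vertices at distance at most `n` from the set `T`. -/
def nhd (G : SimpleGraph V) (T : Set V) : ℕ → Set V
  | 0 => T
  | n + 1 => {u | u ∈ nhd G T n ∨ ∃ v ∈ nhd G T n, G.Adj v u}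

theorem nhd_mono {G : SimpleGraph V} {T : Set V} {m n : ℕ} (h : m ≤ n) :
    G.nhd T m ⊆ G.nhd T n := by
  induction h with
  | refl => exact subset_rfl
  | step _ ih => exact fun u hu => Or.inl (ih hu)

theorem nhd_step {G : SimpleGraph V} {T : Set V} {n : ℕ} {u v : V} (hv : v ∈ G.nhd T n)
    (h : G.Adj v u) : u ∈ G.nhd T (n + 1) := Or.inr ⟨v, hv, h⟩

theorem nhd_nhd {G : SimpleGraph V} {S T : Set V} {m : ℕ} (hS : S ⊆ G.nhd T m) (n : ℕ) :
    G.nhd S n ⊆ G.nhd T (m + n) := by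
  induction n with
  | zero => exact hS
  | succ n ih =>
    rintro u (hu | ⟨v, hv, h⟩)
    · exact Or.inl (ih hu)
    · exact Or.inr ⟨v, ih hv, h⟩

theorem mem_nhd_comm {G : SimpleGraph V} {u v : V} {n : ℕ} (h : v ∈ G.nhd {u} n) :
    u ∈ G.nhd {v} n := by
  induction n generalizing v with
  | zero => exact Eq.symm h
  | succ n ih =>
    rcases h with h | ⟨x, hx, h⟩
    · exact Or.inl (ih h)
    · have h1 : ({x} : Set V) ⊆ G.nhd {v} 1 := by
        rintro _ rfl; exact nhd_step (n := 0) rfl h.symm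
      exact Nat.add_comm 1 n ▸ nhd_nhd h1 n (ih hx)

theorem nhd_map {G : SimpleGraph V} {H : SimpleGraph W} {g : V → W}
    (hg : ∀ u v, G.Adj u v → H.Adj (g u) (g v)) (T : Set V) (n : ℕ) {v : V}
    (hv : v ∈ G.nhd T n) : g v ∈ H.nhd (g '' T) n := by
  induction n generalizing v with
  | zero => exact ⟨v, hv, rfl⟩
  | succ n ih =>
    rcases hv with hv | ⟨u, hu, h⟩
    · exact Or.inl (ih hv)
    · exact Or.inr ⟨g u, ih hu, hg _ _ h⟩

theorem ncard_nhd_le [Finite V] {G : SimpleGraph V} {Δ : ℕ}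
    (hΔ : ∀ v, (G.neighborSet v).ncard ≤ Δ) (T : Set V) (n : ℕ) :
    (G.nhd T n).ncard ≤ T.ncard * (Δ + 1) ^ n := by
  classical
  have := Fintype.ofFinite V
  induction n with
  | zero => simp [nhd]
  | succ n ih =>
    have h1 : G.nhd T (n + 1) =
        ((G.nhd T n).toFinset.biUnion fun v => insert v (G.neighborFinset v) : Finset V) := by
      ext u
      simp only [nhd, Set.mem_ofPred_eq, Finset.coe_biUnion, Set.mem_toFinset, Finset.coe_insert,
        Set.mem_iUnion, Set.mem_insert_iff, SetLike.mem_coe, mem_neighborFinset, exists_prop]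
      constructor
      · rintro (h | ⟨v, hv, h⟩)
        · exact ⟨u, h, Or.inl rfl⟩
        · exact ⟨v, hv, Or.inr h⟩
      · rintro ⟨v, hv, rfl | h⟩
        · exact Or.inl hv
        · exact Or.inr ⟨v, hv, h⟩
    rw [h1, Set.ncard_coe_finset]
    refine (Finset.card_biUnion_le_card_mul _ _ (Δ + 1) fun v _ => ?_).trans ?_
    · refine (Finset.card_insert_le _ _).trans ?_
      have := hΔ v
      rw [Set.ncard_eq_toFinset_card'] at this
      simpa [neighborFinset] using this
    · rw [pow_succ, ← mul_assoc, ← Set.ncard_eq_toFinset_card']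
      exact Nat.mul_le_mul_right _ ih

/-- `f` embeds the subgraph of `G` on `S` into `H`, and preserves the neighbourhoods of the
vertices that have all their neighbours in `S`. -/
structure IsLocalEmb (G : SimpleGraph V) (H : SimpleGraph W) (S : Set V) (f : V → W) : Prop where
  injOn : Set.InjOn f S
  adj : ∀ u ∈ S, ∀ v ∈ S, G.Adj u v → H.Adj (f u) (f v)
  nbr : ∀ v ∈ S, G.neighborSet v ⊆ S → H.neighborSet (f v) = f '' G.neighborSet v

/-- `g` is injective and preserves the neighbourhoods of the vertices in `I`. -/
structure IsExact (Γ : SimpleGraph X) (G : SimpleGraph V) (I : Set X) (g : X → V) : Prop where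
  inj : Function.Injective g
  nbr : ∀ h ∈ I, G.neighborSet (g h) = g '' Γ.neighborSet h

theorem IsExact.adj_iff {Γ : SimpleGraph X} {G : SimpleGraph V} {I : Set X} {g : X → V}
    (hg : IsExact Γ G I g) {h : X} (hh : h ∈ I) (z : V) :
    G.Adj (g h) z ↔ ∃ h', Γ.Adj h h' ∧ g h' = z := by
  have := Set.ext_iff.1 (hg.nbr h hh) z
  simpa using this

theorem IsExact.adj_map {Γ : SimpleGraph X} {G : SimpleGraph V} {I : Set X} {g : X → V}
    (hg : IsExact Γ G I g) (hI : ∀ h h', Γ.Adj h h' → h ∈ I ∨ h' ∈ I) (h h' : X)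
    (a : Γ.Adj h h') : G.Adj (g h) (g h') := by
  rcases hI h h' a with i | i
  · exact (hg.adj_iff i _).2 ⟨h', a, rfl⟩
  · exact ((hg.adj_iff i _).2 ⟨h, a.symm, rfl⟩).symm

/-! ### Transfer between a ball and its image -/

section Local

variable {G : SimpleGraph V} {H : SimpleGraph W} {T : Set V} {r : ℕ} {f : V → W}

/-- Below depth r all neighbours are still in the ball, so the exactness clause applies; this is why
every radius condition is strict. -/
theorem IsLocalEmb.nbr_nhd (hf : IsLocalEmb G H (G.nhd T r) f) {n : ℕ} (hn : n < r) {v : V}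
    (hv : v ∈ G.nhd T n) : H.neighborSet (f v) = f '' G.neighborSet v :=
  hf.nbr v (nhd_mono hn.le hv) fun _ hu => nhd_mono hn (nhd_step hv hu)

theorem IsLocalEmb.ncard_nhd (hf : IsLocalEmb G H (G.nhd T r) f) {n : ℕ} (hn : n < r) {v : V}
    (hv : v ∈ G.nhd T n) : (H.neighborSet (f v)).ncard = (G.neighborSet v).ncard := by
  rw [hf.nbr_nhd hn hv]
  exact Set.InjOn.ncard_image
    (hf.injOn.mono fun _ hu => nhd_mono hn (nhd_step hv hu))

/-- Exact neighbourhoods allow paths that start at f x to be lifted edge by edge. -/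
theorem IsLocalEmb.nhd_subset (hf : IsLocalEmb G H (G.nhd T r) f) {m n : ℕ} (hn : m + n ≤ r)
    {x : V} (hx : x ∈ G.nhd T m) : H.nhd {f x} n ⊆ f '' G.nhd {x} n := by
  have hx' : ({x} : Set V) ⊆ G.nhd T m := by simpa using hx
  induction n with
  | zero => rintro _ rfl; exact ⟨x, rfl, rfl⟩
  | succ n ih =>
    rintro w (hw | ⟨w', hw', h⟩)
    · obtain ⟨v, hv, rfl⟩ := ih (by omega) hw
      exact ⟨v, Or.inl hv, rfl⟩
    · obtain ⟨v, hv, rfl⟩ := ih (by omega) hw'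
      have : w ∈ H.neighborSet (f v) := h
      rw [hf.nbr_nhd (n := m + n) (by omega) (nhd_nhd hx' n hv)] at this
      obtain ⟨u, hu, rfl⟩ := this
      exact ⟨u, nhd_step hv hu, rfl⟩

theorem IsLocalEmb.comp_exact (hf : IsLocalEmb G H (G.nhd T r) f) {Γ : SimpleGraph X} {I : Set X}
    {g : X → V} (hg : IsExact Γ G I g) {n : ℕ} (hn : n < r) (hb : ∀ h, g h ∈ G.nhd T n) :
    IsExact Γ H I (f ∘ g) where
  inj h h' e := hg.inj (hf.injOn (nhd_mono hn.le (hb h)) (nhd_mono hn.le (hb h')) e)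
  nbr h hh := by
    rw [Function.comp_apply, hf.nbr_nhd hn (hb h), hg.nbr h hh, Set.image_image]
    rfl

/-- A configuration of H close to f x consists of images of vertices close to x. Injectivity of f on
the ball turns the equality of image neighbourhoods into one in G. -/
theorem IsLocalEmb.lift_exact (hf : IsLocalEmb G H (G.nhd T r) f) {Γ : SimpleGraph X} {I : Set X}
    {g' : X → W} (hg : IsExact Γ H I g') {m n : ℕ} (hn : m + n < r) {x : V}
    (hx : x ∈ G.nhd T m) (hb : ∀ h, g' h ∈ H.nhd {f x} n) :
    ∃ g : X → V, IsExact Γ G I g ∧ (∀ h, f (g h) = g' h) ∧ ∀ h, g h ∈ G.nhd T (m + n) := by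
  have hx' : ({x} : Set V) ⊆ G.nhd T m := by simpa using hx
  have : ∀ h, ∃ v ∈ G.nhd {x} n, f v = g' h := fun h => hf.nhd_subset hn.le hx (hb h)
  choose g hgx hgf using this
  have hgT : ∀ h, g h ∈ G.nhd T (m + n) := fun h => nhd_nhd hx' n (hgx h)
  refine ⟨g, ⟨fun h h' e => hg.inj ?_, fun h hh => ?_⟩, hgf, hgT⟩
  · rw [← hgf, ← hgf, e]
  · have h1 := hf.nbr_nhd hn (hgT h)
    rw [hgf, hg.nbr h hh] at h1
    refine (hf.injOn.image_eq_image_iff ?_ ?_).1 ?_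
    · exact fun u hu => nhd_mono hn (nhd_step (hgT h) hu)
    · rintro _ ⟨h', -, rfl⟩
      exact nhd_mono hn.le (hgT h')
    · rw [← h1, Set.image_image]
      simp [hgf]

end Local

end SimpleGraph

/-! Adjacency in the encoding of a structure -/

namespace ArrowVert

/-- Renames the slots. -/
def relabel {ι A : Type} {d ℓ : ℕ} (α : ι → A) (β : ι → Fin d) :
    ArrowVert ι 1 ℓ → ArrowVert A d ℓ
  | el s => el (α s)
  | v s _ k => v (α s) (β s) k
  | w s _ => w (α s) (β s)

/-- The vertices of the encoding that are not elements of the structure. -/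
def slotVerts (A : Type) (d ℓ : ℕ) : Set (ArrowVert A d ℓ) := {h | ∀ a, h ≠ el a}

end ArrowVert

/-- The properties of a listing that do not mention the relations of the structure. -/
structure IsMatched {S A : Type} {d : ℕ} (ans : A → Fin d → Option (S × A × A)) : Prop where
  mem : ∀ a i R b c, ans a i = some (R, b, c) → a = b ∨ a = c
  left : ∀ a i R b c, ans a i = some (R, b, c) → ∃ j, ans b j = some (R, b, c)
  right : ∀ a i R b c, ans a i = some (R, b, c) → ∃ j, ans c j = some (R, b, c)
  inj : ∀ a i j t, ans a i = some t → ans a j = some t → i = j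

theorem FinStr.IsListing.isMatched {S : Type} {A : FinStr S} {d : ℕ}
    {ans : A.carrier → Fin d → Option (S × A.carrier × A.carrier)} (h : A.IsListing d ans) :
    IsMatched ans where
  mem a i R b c e := by
    rcases (h.sound a i _ e).2 with e | e
    · exact Or.inl e.symm
    · exact Or.inr e.symm
  left a i R b c e := (h.complete b _ ⟨(h.sound a i _ e).1, Or.inl rfl⟩).exists
  right a i R b c e := (h.complete c _ ⟨(h.sound a i _ e).1, Or.inr rfl⟩).exists
  inj a i j t e e' := (h.complete a t (h.sound a i t e)).unique e e'

section Adj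

open ArrowVert

variable {S : Type} {d ℓ : ℕ} {e : S ≃ Fin ℓ} {A : FinStr S}
  {ans : A.carrier → Fin d → Option (S × A.carrier × A.carrier)}

theorem ArrowEdge.ne {x y : ArrowVert A.carrier d ℓ} (h : ArrowEdge e A ans x y) : x ≠ y := by
  cases h <;> simp_all
  omega

theorem arrowGraph_adj {x y : ArrowVert A.carrier d ℓ} :
    (arrowGraph e A ans).Adj x y ↔ ArrowEdge e A ans x y ∨ ArrowEdge e A ans y x := by
  simp only [arrowGraph, SimpleGraph.fromRel_adj, and_iff_right_iff_imp]
  rintro (h | h)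
  · exact h.ne
  · exact h.ne.symm

theorem adj_el_el (a b : A.carrier) : ¬ (arrowGraph e A ans).Adj (el a) (el b) := by
  rw [arrowGraph_adj]
  rintro (h | h) <;> cases h

theorem adj_el_w (a b : A.carrier) (i : Fin d) : ¬ (arrowGraph e A ans).Adj (el a) (w b i) := by
  rw [arrowGraph_adj]
  rintro (h | h) <;> cases h

theorem adj_w_w (a b : A.carrier) (i j : Fin d) : ¬ (arrowGraph e A ans).Adj (w a i) (w b j) := by
  rw [arrowGraph_adj]
  rintro (h | h) <;> cases h

theorem adj_el_v (a b : A.carrier) (i : Fin d) (k : Fin ℓ) :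
    (arrowGraph e A ans).Adj (el a) (v b i k) ↔ a = b ∧ k.val + 1 = ℓ := by
  rw [arrowGraph_adj]
  constructor
  · rintro (h | h)
    · cases h; simp_all
    · cases h
  · rintro ⟨rfl, h⟩
    exact Or.inl (.attach _ _ _ h)

theorem adj_v_v (a b : A.carrier) (i j : Fin d) (k m : Fin ℓ) :
    (arrowGraph e A ans).Adj (v a i k) (v b j m) ↔
      (a = b ∧ i = j ∧ (k.val + 1 = m.val ∨ m.val + 1 = k.val)) ∨
      (k.val = 0 ∧ m.val = 0 ∧ a ≠ b ∧ ∃ R, ans a i = ans b j ∧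
        (ans a i = some (R, a, b) ∨ ans a i = some (R, b, a))) := by
  rw [arrowGraph_adj]
  constructor
  · rintro (h | h)
    · cases h with
      | path _ _ _ _ hk => exact Or.inl ⟨rfl, rfl, Or.inl hk⟩
      | arrow_mid _ _ _ _ R hab ha hb _ hk =>
        exact Or.inr ⟨hk, hk, hab, R, ha.trans hb.symm, Or.inl ha⟩
    · cases h with
      | path _ _ _ _ hk => exact Or.inl ⟨rfl, rfl, Or.inr hk⟩
      | arrow_mid _ _ _ _ R hab ha hb _ hk =>
        exact Or.inr ⟨hk, hk, hab.symm, R, hb.trans ha.symm, Or.inr hb⟩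
  · rintro (⟨rfl, rfl, h | h⟩ | ⟨hk, hm, hab, R, h, h' | h'⟩)
    · exact Or.inl (.path _ _ _ _ h)
    · exact Or.inr (.path _ _ _ _ h)
    · obtain rfl : k = m := Fin.ext (hk.trans hm.symm)
      exact Or.inl (.arrow_mid _ _ _ _ R hab h' (h ▸ h') _ hk)
    · obtain rfl : k = m := Fin.ext (hk.trans hm.symm)
      exact Or.inr (.arrow_mid _ _ _ _ R hab.symm (h ▸ h') h' _ hk)

/-- Only `IsMatched` is assumed, because the same description is applied to gadgets, whose
underlying structure has empty relations. The loop edges and the two kinds of head edges merge into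
one formula. -/
theorem adj_v_w (hm : IsMatched ans) (a b : A.carrier) (i j : Fin d) (k : Fin ℓ) :
    (arrowGraph e A ans).Adj (v b j k) (w a i) ↔
      (a = b ∧ i = j ∧ ans b j = none ∧ k.val ≤ 1) ∨
      ∃ R c, k = e R ∧ ans b j = some (R, c, b) ∧
        ((a = b ∧ i = j) ∨ (a = c ∧ ans a i = some (R, c, b))) := by
  rw [arrowGraph_adj]
  constructor
  · rintro (h | h)
    · cases h with
      | arrow_head c _ i' _ R hab ha hb => exact Or.inr ⟨R, c, rfl, hb, Or.inl ⟨rfl, rfl⟩⟩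
      | arrow_head' _ _ _ _ R hab ha hb => exact Or.inr ⟨R, a, rfl, hb, Or.inr ⟨rfl, ha⟩⟩
      | loop _ _ R ha => exact Or.inr ⟨R, _, rfl, ha, Or.inl ⟨rfl, rfl⟩⟩
      | non_arrow _ _ ha _ hk => exact Or.inl ⟨rfl, rfl, ha, hk⟩
    · cases h
  · rintro (⟨rfl, rfl, h, hk⟩ | ⟨R, c, rfl, h, h'⟩)
    · exact Or.inl (.non_arrow _ _ h _ hk)
    -- For a tuple (b, b) both alternatives describe the same slot, since no content is repeated at
    -- an element.
    · by_cases hc : c = b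
      · subst hc
        have : a = c ∧ i = j := by
          rcases h' with h' | ⟨rfl, h'⟩
          · exact h'
          · exact ⟨rfl, hm.inj _ _ _ _ h' h⟩
        obtain ⟨rfl, rfl⟩ := this
        exact Or.inl (.loop _ _ _ h)
      · rcases h' with ⟨rfl, rfl⟩ | ⟨rfl, h'⟩
        · obtain ⟨i', h''⟩ := hm.left _ _ _ _ _ h
          exact Or.inl (.arrow_head _ _ _ _ _ hc h'' h)
        · exact Or.inl (.arrow_head' _ _ _ _ _ hc h' h)

end Adj

/-! Gadgets: the encodings of single slots and of single tuples -/

open ArrowVert SimpleGraph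

/-- The encoding of a structure with one slot at each element, all of them holding `o`. -/
def gadget {S ι : Type} [Finite ι] {ℓ : ℕ} (e : S ≃ Fin ℓ) (o : Option (S × ι × ι)) :
    SimpleGraph (ArrowVert ι 1 ℓ) :=
  arrowGraph (d := 1) e ⟨ι, fun _ _ _ => False⟩ (fun _ _ => o)

/-- The contents for which `gadget` is a single unused slot or a single tuple. -/
def IsShape {S ι : Type} (o : Option (S × ι × ι)) : Prop :=
  (o = none ∧ ∀ s t : ι, s = t) ∨ ∃ R s t, o = some (R, s, t) ∧ ∀ x, x = s ∨ x = t

theorem IsShape.isMatched {S ι : Type} {o : Option (S × ι × ι)} (h : IsShape o) :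
    IsMatched (d := 1) (fun (_ : ι) _ => o) := by
  rcases h with ⟨rfl, -⟩ | ⟨R, s, t, rfl, h⟩
  · constructor <;> simp
  · refine ⟨?_, ?_, ?_, ?_⟩
    · intro a _ R' b c h'
      simp only [Option.some.injEq, Prod.mk.injEq] at h'
      obtain ⟨-, rfl, rfl⟩ := h'
      exact h a
    · intro a i R' b c h'; exact ⟨i, h'⟩
    · intro a i R' b c h'; exact ⟨i, h'⟩
    · intros; exact Subsingleton.elim _ _

/-- `g` is a copy of a gadget in `G`, attached to vertices of degree `d`. -/
structure IsGadget {S ι V : Type} [Finite ι] {ℓ : ℕ} (e : S ≃ Fin ℓ) (d : ℕ)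
    (o : Option (S × ι × ι)) (G : SimpleGraph V) (g : ArrowVert ι 1 ℓ → V) : Prop
    extends IsExact (gadget e o) G (slotVerts ι 1 ℓ) g where
  deg : ∀ s, (G.neighborSet (g (el s))).ncard = d

section Gadget

variable {S ι V W : Type} [Finite ι] {d ℓ : ℕ} {e : S ≃ Fin ℓ} {o : Option (S × ι × ι)}
  {G : SimpleGraph V} {H : SimpleGraph W}

theorem inner_of_adj_el {A : FinStr S} {ans : A.carrier → Fin d → Option (S × A.carrier × A.carrier)}
    {a : A.carrier} {h : ArrowVert A.carrier d ℓ} (hh : (arrowGraph e A ans).Adj (el a) h) :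
    h ∈ slotVerts A.carrier d ℓ := by
  rintro b rfl
  exact adj_el_el _ _ hh

theorem gadget_inner (h h' : ArrowVert ι 1 ℓ) (hh : (gadget e o).Adj h h') :
    h ∈ slotVerts ι 1 ℓ ∨ h' ∈ slotVerts ι 1 ℓ := by
  by_cases c : h ∈ slotVerts ι 1 ℓ
  · exact Or.inl c
  · simp only [slotVerts, Set.mem_ofPred_eq, not_forall, not_not] at c
    obtain ⟨a, rfl⟩ := c
    exact Or.inr (inner_of_adj_el hh)

theorem IsGadget.adj_map {g : ArrowVert ι 1 ℓ → V} (hg : IsGadget e d o G g)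
    {h h' : ArrowVert ι 1 ℓ} (a : (gadget e o).Adj h h') : G.Adj (g h) (g h') :=
  hg.toIsExact.adj_map gadget_inner h h' a

theorem v_mem_nhd_el {A : FinStr S} {ans : A.carrier → Fin d → Option (S × A.carrier × A.carrier)}
    (a : A.carrier) (i : Fin d) (n : ℕ) (k : Fin ℓ) (hk : k.val + n + 1 = ℓ) :
    v a i k ∈ (arrowGraph e A ans).nhd {el a} (n + 1) := by
  induction n generalizing k with
  | zero => exact nhd_step (n := 0) rfl ((adj_el_v _ _ _ _).2 ⟨rfl, by omega⟩)
  | succ n ih =>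
    exact nhd_step (ih ⟨k + 1, by omega⟩ (by simp; omega))
      ((adj_v_v _ _ _ _ _ _).2 (Or.inl ⟨rfl, rfl, Or.inr rfl⟩))

theorem v_mem_nhd_v {A : FinStr S} {ans : A.carrier → Fin d → Option (S × A.carrier × A.carrier)}
    {T : Set (ArrowVert A.carrier d ℓ)} {m : ℕ}
    (a : A.carrier) (i : Fin d) (hℓ : 0 < ℓ) (h : v a i ⟨0, hℓ⟩ ∈ (arrowGraph e A ans).nhd T m)
    (n : ℕ) (hn : n < ℓ) : v a i ⟨n, hn⟩ ∈ (arrowGraph e A ans).nhd T (m + n) := by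
  induction n with
  | zero => exact h
  | succ n ih =>
    exact nhd_step (ih (by omega)) ((adj_v_v _ _ _ _ _ _).2 (Or.inl ⟨rfl, rfl, Or.inl rfl⟩))

/-- From one end it takes ℓ steps down a path, at most one step across, and ℓ - 1 up the other path.
One further step reaches the other end or a vertex `w`, which gives 2ℓ + 1. -/
theorem gadget_nhd (ho : IsShape o) (hℓ : 2 ≤ ℓ) (s : ι) (h : ArrowVert ι 1 ℓ) :
    h ∈ (gadget e o).nhd {el s} (2 * ℓ + 1) := by
  have hv0 : ∀ k : Fin ℓ, v s 0 k ∈ (gadget e o).nhd {el s} ℓ := fun k =>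
    nhd_mono (by omega) (v_mem_nhd_el (A := ⟨ι, fun _ _ _ => False⟩) s 0 (ℓ - 1 - k) k (by omega))
  have hv : ∀ t (k : Fin ℓ), v t 0 k ∈ (gadget e o).nhd {el s} (2 * ℓ) := by
    intro t k
    by_cases hst : s = t
    · subst hst; exact nhd_mono (by omega) (hv0 k)
    · have h1 : (gadget e o).Adj (v s 0 ⟨0, by omega⟩) (v t 0 ⟨0, by omega⟩) := by
        refine (adj_v_v _ _ _ _ _ _).2 (Or.inr ⟨rfl, rfl, hst, ?_⟩)
        rcases ho with ⟨-, h⟩ | ⟨R, a, b, rfl, h⟩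
        · exact absurd (h s t) hst
        · refine ⟨R, rfl, ?_⟩
          rcases h s with rfl | rfl <;> rcases h t with rfl | rfl <;> simp_all
      have h2 : v t 0 ⟨0, by omega⟩ ∈ (gadget e o).nhd {el s} (ℓ + 1) := nhd_step (hv0 _) h1
      have h3 := v_mem_nhd_v (A := ⟨ι, fun _ _ _ => False⟩) t 0 (by omega) h2 k k.2
      exact nhd_mono (by omega) h3
  cases h with
  | el t =>
    exact nhd_step (hv t ⟨ℓ - 1, by omega⟩)
      ((adj_el_v _ _ _ _).2 ⟨rfl, by simp; omega⟩ : (gadget e o).Adj _ _).symm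
  | v t i k =>
    obtain rfl := Subsingleton.elim i 0
    exact nhd_mono (by omega) (hv t k)
  | w t i =>
    obtain rfl := Subsingleton.elim i 0
    rcases ho with ⟨rfl, h⟩ | ⟨R, a, b, rfl, h⟩
    · refine nhd_step (hv t ⟨0, by omega⟩) ((adj_v_w ?_ _ _ _ _ _).2 (Or.inl ⟨rfl, rfl, rfl, ?_⟩))
      · exact IsShape.isMatched (Or.inl ⟨rfl, h⟩)
      · simp
    · refine nhd_step (hv b (e R)) ((adj_v_w ?_ _ _ _ _ _).2 (Or.inr ⟨R, a, rfl, rfl, ?_⟩))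
      · exact IsShape.isMatched (Or.inr ⟨R, a, b, rfl, h⟩)
      · rcases h t with rfl | rfl
        · exact Or.inr ⟨rfl, rfl⟩
        · exact Or.inl ⟨rfl, rfl⟩

theorem IsGadget.mem_nhd {g : ArrowVert ι 1 ℓ → V} (hg : IsGadget e d o G g)
    (ho : IsShape o) (hℓ : 2 ≤ ℓ) (s : ι) (h : ArrowVert ι 1 ℓ) :
    g h ∈ G.nhd {g (el s)} (2 * ℓ + 1) := by
  simpa using nhd_map (fun _ _ => hg.adj_map) _ _ (gadget_nhd (e := e) ho hℓ s h)

theorem IsGadget.mem_nhd_of_mem {g : ArrowVert ι 1 ℓ → V} (hg : IsGadget e d o G g)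
    (ho : IsShape o) (hℓ : 2 ≤ ℓ) {s : ι} {T : Set V} {m : ℕ} (hs : g (el s) ∈ G.nhd T m)
    (h : ArrowVert ι 1 ℓ) : g h ∈ G.nhd T (m + (2 * ℓ + 1)) :=
  nhd_nhd (by simpa using hs) _ (hg.mem_nhd ho hℓ s h)

theorem IsGadget.map {T : Set V} {r m : ℕ} {f : V → W} {g : ArrowVert ι 1 ℓ → V}
    (hg : IsGadget e d o G g) (hf : IsLocalEmb G H (G.nhd T r) f) (ho : IsShape o) (hℓ : 2 ≤ ℓ)
    {s : ι} (hs : g (el s) ∈ G.nhd T m) (hr : m + (2 * ℓ + 1) < r) :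
    IsGadget e d o H (f ∘ g) where
  toIsExact := hf.comp_exact hg.toIsExact hr (hg.mem_nhd_of_mem ho hℓ hs)
  deg t := by
    rw [← hg.deg t]
    exact hf.ncard_nhd hr (hg.mem_nhd_of_mem ho hℓ hs _)

/-- A gadget with one end at f x lies within 2ℓ + 1 of f x, so it comes from a gadget at x. The
degrees at its ends are also preserved. -/
theorem IsGadget.lift {T : Set V} {r m : ℕ} {f : V → W} {g' : ArrowVert ι 1 ℓ → W}
    (hg : IsGadget e d o H g') (hf : IsLocalEmb G H (G.nhd T r) f) (ho : IsShape o) (hℓ : 2 ≤ ℓ)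
    {s : ι} {x : V} (hs : g' (el s) = f x) (hx : x ∈ G.nhd T m) (hr : m + (2 * ℓ + 1) < r) :
    ∃ g, IsGadget e d o G g ∧ (∀ h, f (g h) = g' h) ∧ g (el s) = x ∧
      ∀ h, g h ∈ G.nhd T (m + (2 * ℓ + 1)) := by
  obtain ⟨g, h1, h2, h3⟩ := hf.lift_exact hg.toIsExact hr hx
    (fun h => hs ▸ hg.mem_nhd ho hℓ s h)
  refine ⟨g, ⟨h1, fun t => ?_⟩, h2, ?_, h3⟩
  · rw [← hg.deg t, ← h2, hf.ncard_nhd hr (h3 _)]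
  · exact hf.injOn (nhd_mono hr.le (h3 _)) (nhd_mono (by omega) hx) ((h2 _).trans hs)

end Gadget

/-! ### Degrees and gadgets in an encoding -/

section Encoding

variable {S ι : Type} [Finite ι] {d ℓ : ℕ} {e : S ≃ Fin ℓ} {o : Option (S × ι × ι)} {A : FinStr S}
  {ans : A.carrier → Fin d → Option (S × A.carrier × A.carrier)}

theorem neighborSet_el (hℓ : 0 < ℓ) (a : A.carrier) :
    (arrowGraph e A ans).neighborSet (el a) =
      Set.range fun i : Fin d => v a i (⟨ℓ - 1, by omega⟩ : Fin ℓ) := by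
  ext h
  simp only [mem_neighborSet, Set.mem_range]
  cases h with
  | el b => simp [adj_el_el]
  | w b i => simp [adj_el_w]
  | v b i k =>
    rw [adj_el_v]
    constructor
    · rintro ⟨rfl, hk⟩
      exact ⟨i, by congr 1; ext; simp; omega⟩
    · rintro ⟨j, hj⟩
      cases hj
      exact ⟨rfl, by simp; omega⟩

theorem ncard_neighborSet_el (hℓ : 0 < ℓ) (a : A.carrier) :
    ((arrowGraph e A ans).neighborSet (el a)).ncard = d := by
  rw [neighborSet_el hℓ, ← Set.image_univ, Set.ncard_image_of_injective, Set.ncard_univ,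
    Nat.card_eq_fintype_card, Fintype.card_fin]
  intro i j h
  cases h
  rfl

/-- The bound does not depend on d, so for d ≥ 8 the degree separates elements from the other
vertices. The value 7 is not optimal. -/
theorem ncard_neighborSet_inner (hm : IsMatched ans) (h : ArrowVert A.carrier d ℓ)
    (hh : h ∈ slotVerts A.carrier d ℓ) : ((arrowGraph e A ans).neighborSet h).ncard ≤ 7 := by
  have key : ∃ s : Finset (ArrowVert A.carrier d ℓ), s.card ≤ 7 ∧
      (arrowGraph e A ans).neighborSet h ⊆ s := by
    classical
    cases h with
    | el a => exact absurd rfl (hh a)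
    | v a i k =>
      have : ∃ b j c j', ∀ R b' c', ans a i = some (R, b', c') →
          b' = b ∧ c' = c ∧ ans b j = some (R, b', c') ∧ ans c j' = some (R, b', c') := by
        cases ho : ans a i with
        | none => exact ⟨a, i, a, i, by simp⟩
        | some t =>
          obtain ⟨R, b, c⟩ := t
          obtain ⟨j, hj⟩ := hm.left _ _ _ _ _ ho
          obtain ⟨j', hj'⟩ := hm.right _ _ _ _ _ ho
          refine ⟨b, j, c, j', ?_⟩
          rintro R' b' c' h
          simp only [Option.some.injEq, Prod.mk.injEq] at h
          obtain ⟨rfl, rfl, rfl⟩ := h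
          exact ⟨rfl, rfl, hj, hj'⟩
      obtain ⟨b, j, c, j', hbc⟩ := this
      have hk := k.2
      -- The candidates are the element, the two path neighbours, the inner ends of the two slots of
      -- the tuple (b, c), and the two vertices `w`. The truncated indices only keep the list well
      -- defined at the ends of the path.
      refine ⟨{el a, v a i ⟨k - 1, by omega⟩, v a i ⟨min (k + 1) (ℓ - 1), by omega⟩,
        v b j ⟨0, by omega⟩, v c j' ⟨0, by omega⟩, w a i, w b j}, 
        (Finset.card_insert_le _ _).trans (Nat.succ_le_succ Finset.card_le_six), ?_⟩
      intro h' hadj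
      simp only [mem_neighborSet] at hadj
      simp only [Finset.coe_insert, Finset.coe_singleton, Set.mem_insert_iff,
        Set.mem_singleton_iff]
      cases h' with
      | el b' =>
        obtain ⟨rfl, -⟩ := (adj_el_v _ _ _ _).1 hadj.symm
        simp
      | v b' j'' k' =>
        rcases (adj_v_v _ _ _ _ _ _).1 hadj with ⟨rfl, rfl, h | h⟩ | ⟨h0, h0', hne, R, he, h | h⟩
        · right; right; left
          congr 1; ext; simp; omega
        · right; left
          congr 1; ext; simp; omega
        · obtain ⟨-, rfl, -, h2⟩ := hbc _ _ _ h
          obtain rfl := hm.inj _ _ _ _ (he ▸ h) h2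
          right; right; right; right; left
          congr 1; exact Fin.ext h0'
        · obtain ⟨rfl, -, h2, -⟩ := hbc _ _ _ h
          obtain rfl := hm.inj _ _ _ _ (he ▸ h) h2
          right; right; right; left
          congr 1; exact Fin.ext h0'
      | w b' j'' =>
        rcases (adj_v_w hm _ _ _ _ _).1 hadj with ⟨rfl, rfl, -⟩ | ⟨R, c', -, h, ⟨rfl, rfl⟩ | ⟨rfl, h'⟩⟩
        · simp
        · simp
        · obtain ⟨rfl, -, h2, -⟩ := hbc _ _ _ h
          obtain rfl := hm.inj _ _ _ _ h' h2
          simp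
    | w a i =>
      cases ho : ans a i with
      | none =>
        by_cases hℓ : 1 < ℓ
        · refine ⟨{v a i ⟨0, by omega⟩, v a i ⟨1, by omega⟩}, Finset.card_le_two.trans (by omega), ?_⟩
          intro h' hadj
          simp only [mem_neighborSet] at hadj
          cases h' with
          | el b => exact absurd hadj.symm (adj_el_w _ _ _)
          | w b j => exact absurd hadj (adj_w_w _ _ _ _)
          | v b j k =>
            rcases (adj_v_w hm _ _ _ _ _).1 hadj.symm with ⟨rfl, rfl, -, hk⟩ | ⟨R, c, -, h, ⟨rfl, rfl⟩ | ⟨rfl, h'⟩⟩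
            · simp [Fin.ext_iff]; omega
            · simp_all
            · simp_all
        · refine ⟨if h : 0 < ℓ then {v a i ⟨0, h⟩} else ∅, by split_ifs <;> simp, ?_⟩
          intro h' hadj
          simp only [mem_neighborSet] at hadj
          cases h' with
          | el b => exact absurd hadj.symm (adj_el_w _ _ _)
          | w b j => exact absurd hadj (adj_w_w _ _ _ _)
          | v b j k =>
            have := k.2
            rw [dif_pos (by omega)]
            rcases (adj_v_w hm _ _ _ _ _).1 hadj.symm with ⟨rfl, rfl, -, hk⟩ | ⟨R, c, -, h, ⟨rfl, rfl⟩ | ⟨rfl, h'⟩⟩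
            · simp [Fin.ext_iff]; omega
            · simp_all
            · simp_all
      | some t =>
        obtain ⟨R, b, c⟩ := t
        obtain ⟨j, hj⟩ := hm.right _ _ _ _ _ ho
        refine ⟨{v c j (e R)}, by simp, ?_⟩
        intro h' hadj
        simp only [mem_neighborSet] at hadj
        cases h' with
        | el b => exact absurd hadj.symm (adj_el_w _ _ _)
        | w b j => exact absurd hadj (adj_w_w _ _ _ _)
        | v b' j' k =>
          rcases (adj_v_w hm _ _ _ _ _).1 hadj.symm with ⟨rfl, rfl, h, hk⟩ | ⟨R, c', hk, h, ⟨rfl, rfl⟩ | ⟨rfl, h'⟩⟩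
          · simp_all
          · rw [ho] at h
            simp only [Option.some.injEq, Prod.mk.injEq] at h
            obtain ⟨rfl, rfl, rfl⟩ := h
            obtain rfl := hm.inj _ _ _ _ ho hj
            simp [hk]
          · rw [ho] at h'
            simp only [Option.some.injEq, Prod.mk.injEq] at h'
            obtain ⟨rfl, rfl, rfl⟩ := h'
            obtain rfl := hm.inj _ _ _ _ h hj
            simp [hk]
  obtain ⟨s, hs, hN⟩ := key
  exact (Set.ncard_le_ncard hN s.finite_toSet).trans (by simpa using hs)

/-- The slots of one tuple form a closed unit: apart from elements, their vertices are adjacent only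
to vertices of the same unit, because a tuple occupies a single slot at each of its elements. -/
theorem isGadget_relabel (hm : IsMatched ans) (hℓ : 0 < ℓ) (ho : IsShape o) (α : ι → A.carrier)
    (β : ι → Fin d) (hα : Function.Injective α)
    (hans : ∀ s, ans (α s) (β s) = o.map fun t => (t.1, α t.2.1, α t.2.2)) :
    IsGadget e d o (arrowGraph e A ans) (relabel α β) where
  inj h h' hh := by
    cases h <;> cases h' <;> simp_all [relabel, hα.eq_iff] <;> exact Subsingleton.elim _ _
  deg s := ncard_neighborSet_el hℓ _
  nbr h hh := by
    have hom := ho.isMatched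
    ext z
    simp only [mem_neighborSet, Set.mem_image]
    cases h with
    | el s => exact absurd rfl (hh s)
    | v s i k =>
      obtain rfl := Subsingleton.elim i 0
      simp only [relabel]
      constructor
      · intro h
        cases z with
        | el a =>
          obtain ⟨rfl, hk⟩ := (adj_el_v _ _ _ _).1 h.symm
          exact ⟨el s, ((adj_el_v _ _ _ _).2 ⟨rfl, hk⟩ : (gadget e o).Adj _ _).symm, rfl⟩
        | v b j m =>
          rcases (adj_v_v _ _ _ _ _ _).1 h with ⟨rfl, rfl, hk⟩ | ⟨h0, h0', hne, R, he, h⟩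
          · exact ⟨v s 0 m, (adj_v_v _ _ _ _ _ _).2 (Or.inl ⟨rfl, rfl, hk⟩), rfl⟩
          · rcases ho with ⟨rfl, -⟩ | ⟨R', p, q, rfl, hpq⟩
            · simp [hans] at h
            · have hs := hans s
              have hp := hans p
              have hq := hans q
              simp only [Option.map_some] at hs hp hq
              rw [hs] at h
              simp only [Option.some.injEq, Prod.mk.injEq] at h
              rcases h with ⟨rfl, h1, rfl⟩ | ⟨rfl, rfl, h1⟩
              · obtain rfl := hα h1
                obtain rfl := hm.inj _ _ _ _ (he ▸ hp) hq
                exact ⟨v q 0 m, (adj_v_v _ _ _ _ _ _).2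
                  (Or.inr ⟨h0, h0', fun h => hne (by rw [h]), R', rfl, Or.inl rfl⟩), rfl⟩
              · obtain rfl := hα h1
                obtain rfl := hm.inj _ _ _ _ (he ▸ hq) hp
                exact ⟨v p 0 m, (adj_v_v _ _ _ _ _ _).2
                  (Or.inr ⟨h0, h0', fun h => hne (by rw [h]), R', rfl, Or.inr rfl⟩), rfl⟩
        | w b j =>
          rcases (adj_v_w hm _ _ _ _ _).1 h with ⟨rfl, rfl, h, hk⟩ | ⟨R, c, hk, h, h'⟩
          · refine ⟨w s 0, (adj_v_w hom _ _ _ _ _).2 (Or.inl ⟨rfl, rfl, ?_, hk⟩), rfl⟩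
            simpa [hans] using h
          · rcases ho with ⟨rfl, -⟩ | ⟨R', p, q, rfl, hpq⟩
            · simp [hans] at h
            · have hp := hans p
              have hs := hans s
              simp only [Option.map_some] at hs hp
              rw [hs] at h
              simp only [Option.some.injEq, Prod.mk.injEq] at h
              obtain ⟨rfl, rfl, h1⟩ := h
              obtain rfl := hα h1
              rcases h' with ⟨rfl, rfl⟩ | ⟨rfl, h'⟩
              · exact ⟨w q 0, (adj_v_w hom _ _ _ _ _).2
                  (Or.inr ⟨R', p, hk, rfl, Or.inl ⟨rfl, rfl⟩⟩), rfl⟩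
              · obtain rfl := hm.inj _ _ _ _ h' hp
                exact ⟨w p 0, (adj_v_w hom _ _ _ _ _).2
                  (Or.inr ⟨R', p, hk, rfl, Or.inr ⟨rfl, rfl⟩⟩), rfl⟩
      · rintro ⟨h', h, rfl⟩
        cases h' with
        | el t =>
          obtain ⟨rfl, hk⟩ := (adj_el_v _ _ _ _).1 h.symm
          exact ((adj_el_v _ _ _ _).2 ⟨rfl, hk⟩ : (arrowGraph e A ans).Adj _ _).symm
        | v t j m =>
          obtain rfl := Subsingleton.elim j 0
          refine (adj_v_v _ _ _ _ _ _).2 ?_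
          rcases (adj_v_v _ _ _ _ _ _).1 h with ⟨rfl, -, h⟩ | ⟨h0, h0', hne, R, -, h⟩
          · exact Or.inl ⟨rfl, rfl, h⟩
          · refine Or.inr ⟨h0, h0', fun h => hne (hα h), R, ?_, ?_⟩
            · rw [hans, hans]
            · rw [hans]
              rcases h with rfl | rfl
              · exact Or.inl rfl
              · exact Or.inr rfl
        | w t j =>
          obtain rfl := Subsingleton.elim j 0
          refine (adj_v_w hm _ _ _ _ _).2 ?_
          rcases (adj_v_w hom _ _ _ _ _).1 h with ⟨rfl, -, rfl, hk⟩ | ⟨R, c, hk, rfl, h'⟩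
          · exact Or.inl ⟨rfl, rfl, by rw [hans]; rfl, hk⟩
          · refine Or.inr ⟨R, α c, hk, by rw [hans]; rfl, ?_⟩
            rcases h' with ⟨rfl, -⟩ | ⟨rfl, -⟩
            · exact Or.inl ⟨rfl, rfl⟩
            · exact Or.inr ⟨rfl, by rw [hans]; rfl⟩
    | w s i =>
      obtain rfl := Subsingleton.elim i 0
      simp only [relabel]
      constructor
      · intro h
        cases z with
        | el a => exact absurd h.symm (adj_el_w _ _ _)
        | w b j => exact absurd h (adj_w_w _ _ _ _)
        | v b j k =>
          rcases (adj_v_w hm _ _ _ _ _).1 h.symm with ⟨rfl, rfl, h, hk⟩ | ⟨R, c, hk, h, h'⟩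
          · refine ⟨v s 0 k, ((adj_v_w hom _ _ _ _ _).2 (Or.inl ⟨rfl, rfl, ?_, hk⟩) :
              (gadget e o).Adj _ _).symm, rfl⟩
            simpa [hans] using h
          · have h1 : ans (α s) (β s) = some (R, c, b) := by
              rcases h' with ⟨rfl, rfl⟩ | ⟨rfl, h'⟩
              · exact h
              · exact h'
            rcases ho with ⟨rfl, -⟩ | ⟨R', p, q, rfl, hpq⟩
            · simp [hans] at h1
            · have hq := hans q
              have hs := hans s
              simp only [Option.map_some] at hs hq
              rw [hs] at h1
              simp only [Option.some.injEq, Prod.mk.injEq] at h1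
              obtain ⟨rfl, rfl, rfl⟩ := h1
              obtain rfl := hm.inj _ _ _ _ h hq
              refine ⟨v q 0 k, ((adj_v_w hom _ _ _ _ _).2 (Or.inr ⟨R', p, hk, rfl, ?_⟩) :
                (gadget e _).Adj _ _).symm, rfl⟩
              rcases hpq s with rfl | rfl
              · exact Or.inr ⟨rfl, rfl⟩
              · exact Or.inl ⟨rfl, rfl⟩
      · rintro ⟨h', h, rfl⟩
        cases h' with
        | el t => exact absurd h.symm (adj_el_w _ _ _)
        | w t j => exact absurd h (adj_w_w _ _ _ _)
        | v t j k =>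
          obtain rfl := Subsingleton.elim j 0
          refine ((adj_v_w hm _ _ _ _ _).2 ?_ : (arrowGraph e A ans).Adj _ _).symm
          rcases (adj_v_w hom _ _ _ _ _).1 h.symm with ⟨rfl, -, rfl, hk⟩ | ⟨R, c, hk, rfl, h'⟩
          · exact Or.inl ⟨rfl, rfl, by rw [hans]; rfl, hk⟩
          · refine Or.inr ⟨R, α c, hk, by rw [hans]; rfl, ?_⟩
            rcases h' with ⟨rfl, -⟩ | ⟨rfl, -⟩
            · exact Or.inl ⟨rfl, rfl⟩
            · exact Or.inr ⟨rfl, by rw [hans]; rfl⟩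

end Encoding

/-! A slot determines the gadget that contains it -/

section Spine

variable {V : Type} {G : SimpleGraph V}

/-- `z` has exactly one neighbour. -/
def IsLeaf (G : SimpleGraph V) (z : V) : Prop := ∃! y, G.Adj z y

theorem not_isLeaf {x y z : V} (hy : G.Adj z y) (hx : G.Adj z x) (hne : x ≠ y) : ¬ IsLeaf G z :=
  fun h => hne (h.unique hx hy)

/-- `c 0, …, c n` is a walk that does not turn back, and at each of its interior vertices it
uses all the neighbours that are not leaves; `c m₀` is the only interior vertex with a leaf as a
neighbour. -/
structure IsSpine (G : SimpleGraph V) (n m₀ : ℕ) (c : ℕ → V) : Prop where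
  nbr : ∀ m, m + 1 < n → ∀ z, G.Adj (c (m + 1)) z ∧ ¬ IsLeaf G z ↔ z = c m ∨ z = c (m + 2)
  ne : ∀ m, m + 1 < n → c m ≠ c (m + 2)
  leaf : ∀ m, m + 1 < n → ((∃ z, G.Adj (c (m + 1)) z ∧ IsLeaf G z) ↔ m + 1 = m₀)

variable {n n' m₀ m₀' : ℕ} {c c' : ℕ → V}

theorem IsSpine.mono (h : IsSpine G n m₀ c) (hn : n' ≤ n) : IsSpine G n' m₀ c where
  nbr m hm := h.nbr m (by omega)
  ne m hm := h.ne m (by omega)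
  leaf m hm := h.leaf m (by omega)

/-- At an interior vertex exactly two neighbours are not leaves, and one of them has just been
visited. So the next vertex is forced. -/
theorem IsSpine.det (h : IsSpine G n m₀ c) (h' : IsSpine G n m₀' c') (h0 : c 0 = c' 0)
    (h1 : c 1 = c' 1) {m : ℕ} (hm : m ≤ n) : c m = c' m := by
  have key : ∀ m, m + 1 ≤ n → c m = c' m ∧ c (m + 1) = c' (m + 1) := by
    intro m
    induction m with
    | zero => exact fun _ => ⟨h0, h1⟩
    | succ m ih =>
      intro hm
      obtain ⟨i0, i1⟩ := ih (by omega)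
      refine ⟨i1, ?_⟩
      have a := (h.nbr m (by omega) _).2 (Or.inr rfl)
      rw [i1, h'.nbr m (by omega)] at a
      rcases a with a | a
      · exact absurd (i0.trans a.symm) (h.ne m (by omega))
      · exact a
  cases m with
  | zero => exact h0
  | succ m => exact (key m hm).2

theorem IsSpine.leaf_eq (h : IsSpine G n m₀ c) (h' : IsSpine G n m₀' c') (h0 : c 0 = c' 0)
    (h1 : c 1 = c' 1) {m : ℕ} (hm : m + 1 < n) : m + 1 = m₀ ↔ m + 1 = m₀' := by
  rw [← h.leaf m hm, ← h'.leaf m hm, h.det h' h0 h1 hm.le]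

/-- This allows an arrow to be read from its head as well as from its tail. -/
theorem IsSpine.reverse (h : IsSpine G n m₀ c) (m₀' : ℕ) (hm' : m₀ + m₀' = n) :
    IsSpine G n m₀' (fun m => c (n - m)) where
  nbr m hm z := by
    have := h.nbr (n - (m + 2)) (by omega) z
    rw [show n - (m + 2) + 1 = n - (m + 1) by omega,
      show n - (m + 2) + 2 = n - m by omega] at this
    rw [this, or_comm]
  ne m hm := by
    have := h.ne (n - (m + 2)) (by omega)
    rw [show n - (m + 2) + 2 = n - m by omega] at this
    exact this.symm
  leaf m hm := by
    have := h.leaf (n - (m + 2)) (by omega)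
    rw [show n - (m + 2) + 1 = n - (m + 1) by omega] at this
    rw [this]
    omega

/-- Interior vertices have two distinct neighbours on the walk and so are not leaves; only the two
ends need hypotheses. The value m₀ = 0 encodes that no interior vertex has a pendant neighbour. -/
theorem isSpine_of_adj (L : Set V) (hL : m₀ ≠ 0 → L.Nonempty) (hleaf : ∀ z ∈ L, IsLeaf G z)
    (hadj : ∀ m, m + 1 < n → ∀ z, G.Adj (c (m + 1)) z ↔
      z = c m ∨ z = c (m + 2) ∨ (m + 1 = m₀ ∧ z ∈ L))
    (hne : ∀ m, m + 1 < n → c m ≠ c (m + 2)) (h0 : ¬ IsLeaf G (c 0)) (hn : ¬ IsLeaf G (c n)) :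
    IsSpine G n m₀ c := by
  have key : ∀ m, m ≤ n → ¬ IsLeaf G (c m) := by
    intro m hm
    rcases Nat.eq_zero_or_pos m with rfl | hp
    · exact h0
    rcases hm.eq_or_lt with rfl | hlt
    · exact hn
    obtain ⟨m, rfl⟩ : ∃ k, m = k + 1 := ⟨m - 1, by omega⟩
    exact not_isLeaf ((hadj m hlt _).2 (Or.inr (Or.inl rfl))) ((hadj m hlt _).2 (Or.inl rfl))
      (hne m hlt)
  refine ⟨fun m hm z => ?_, hne, fun m hm => ?_⟩
  · rw [hadj m hm]
    constructor
    · rintro ⟨h | h | ⟨-, h⟩, hz⟩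
      · exact Or.inl h
      · exact Or.inr h
      · exact absurd (hleaf z h) hz
    · rintro (rfl | rfl)
      · exact ⟨Or.inl rfl, key _ (by omega)⟩
      · exact ⟨Or.inr (Or.inl rfl), key _ (by omega)⟩
  · constructor
    · rintro ⟨z, hz, hl⟩
      rcases (hadj m hm z).1 hz with rfl | rfl | ⟨h, -⟩
      · exact absurd hl (key _ (by omega))
      · exact absurd hl (key _ (by omega))
      · exact h
    · intro h
      obtain ⟨z, hz⟩ := hL (by omega)
      exact ⟨z, (hadj m hm z).2 (Or.inr (Or.inr ⟨h, hz⟩)), hleaf z hz⟩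

/-- The walk `c` cannot be continued beyond `c n`. -/
def IsDeadEnd (G : SimpleGraph V) (n : ℕ) (c : ℕ → V) : Prop :=
  ∀ z, G.Adj (c n) z → ¬ IsLeaf G z → z = c (n - 1)

/-- The walk `c` can be continued beyond `c n` in several ways. -/
def IsFork (G : SimpleGraph V) (n : ℕ) (c : ℕ → V) : Prop :=
  ∃ y z, y ≠ z ∧ y ≠ c (n - 1) ∧ z ≠ c (n - 1) ∧
    (G.Adj (c n) y ∧ ¬ IsLeaf G y) ∧ (G.Adj (c n) z ∧ ¬ IsLeaf G z)

/-- The last vertex of the shorter walk is interior to the longer one, which leaves it by a new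
vertex that is not a leaf. -/
theorem IsSpine.not_isDeadEnd (h : IsSpine G n m₀ c) (h' : IsSpine G n' m₀' c') (h0 : c 0 = c' 0)
    (h1 : c 1 = c' 1) (hn : n' < n) (hp : 0 < n') : ¬ IsDeadEnd G n' c' := by
  obtain ⟨m, rfl⟩ : ∃ m, n' = m + 1 := ⟨n' - 1, by omega⟩
  intro hd
  have hdet := fun {k} => (h.mono hn.le).det h' h0 h1 (m := k)
  have a := (h.nbr m hn _).2 (Or.inr rfl)
  rw [hdet le_rfl] at a
  have b := hd _ a.1 a.2
  rw [Nat.add_sub_cancel, ← hdet (by omega)] at b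
  exact h.ne m hn b.symm

/-- The last vertex of the shorter walk is interior to the longer one, so it has only one way to
continue. -/
theorem IsSpine.not_isFork (h : IsSpine G n m₀ c) (h' : IsSpine G n' m₀' c') (h0 : c 0 = c' 0)
    (h1 : c 1 = c' 1) (hn : n' < n) (hp : 0 < n') : ¬ IsFork G n' c' := by
  obtain ⟨m, rfl⟩ : ∃ m, n' = m + 1 := ⟨n' - 1, by omega⟩
  rintro ⟨y, z, hyz, hy, hz, ay, az⟩
  have hdet := fun {k} => (h.mono hn.le).det h' h0 h1 (m := k)
  rw [Nat.add_sub_cancel, ← hdet (by omega)] at hy hz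
  rw [← hdet le_rfl, h.nbr m hn] at ay az
  exact hyz ((ay.resolve_left hy).trans (az.resolve_left hz).symm)

theorem IsDeadEnd.not_isFork (h : IsSpine G n m₀ c) (h' : IsSpine G n m₀' c') (h0 : c 0 = c' 0)
    (h1 : c 1 = c' 1) (hd : IsDeadEnd G n c) : ¬ IsFork G n c' := by
  rintro ⟨y, z, hyz, hy, hz, ay, az⟩
  rw [← h.det h' h0 h1 le_rfl] at ay az
  exact hyz ((hd y ay.1 ay.2).trans (hd z az.1 az.2).symm)

end Spine

/-! ### Slots in arbitrary graphs, and the walks through gadgets -/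

section Slots

variable {S V : Type} {d ℓ : ℕ}

/-- `u` is the first vertex of an unused slot of `x`. -/
def BlankAt (e : S ≃ Fin ℓ) (d : ℕ) (G : SimpleGraph V) (x u : V) : Prop :=
  ∃ g : ArrowVert Unit 1 ℓ → V, IsGadget e d none G g ∧ g (el ()) = x ∧
    ∀ k : Fin ℓ, k.val + 1 = ℓ → g (v () 0 k) = u

/-- `u` is the first vertex of a slot of `x` that holds the tuple `(x, x)` of the relation `R`. -/
def LoopAt (e : S ≃ Fin ℓ) (d : ℕ) (G : SimpleGraph V) (R : S) (x u : V) : Prop :=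
  ∃ g : ArrowVert Unit 1 ℓ → V, IsGadget e d (some (R, (), ())) G g ∧ g (el ()) = x ∧
    ∀ k : Fin ℓ, k.val + 1 = ℓ → g (v () 0 k) = u

/-- `u` and `u'` are the first vertices of slots of `x` and `x'` that hold the tuple `(x, x')`
of the relation `R`. -/
def ArrowAt (e : S ≃ Fin ℓ) (d : ℕ) (G : SimpleGraph V) (R : S) (x u x' u' : V) : Prop :=
  ∃ g : ArrowVert Bool 1 ℓ → V, IsGadget e d (some (R, false, true)) G g ∧
    g (el false) = x ∧ g (el true) = x' ∧
    ∀ k : Fin ℓ, k.val + 1 = ℓ → g (v false 0 k) = u ∧ g (v true 0 k) = u'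

variable {e : S ≃ Fin ℓ} {G : SimpleGraph V}

theorem isShape_blank : IsShape (S := S) (ι := Unit) none := Or.inl ⟨rfl, fun _ _ => rfl⟩

theorem isShape_loop (R : S) : IsShape (some (R, (), ())) :=
  Or.inr ⟨R, _, _, rfl, fun _ => Or.inl rfl⟩

theorem isShape_arrow (R : S) : IsShape (some (R, false, true)) :=
  Or.inr ⟨R, _, _, rfl, fun x => by cases x <;> simp⟩

/-- The walk from one end of the gadget of a tuple to the other. -/
def arrowWalk (hℓ : 0 < ℓ) (m : ℕ) : ArrowVert Bool 1 ℓ :=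
  if m = 0 then el false
  else if m ≤ ℓ then v false 0 ⟨min (ℓ - m) (ℓ - 1), by omega⟩
  else if m ≤ 2 * ℓ then v true 0 ⟨min (m - ℓ - 1) (ℓ - 1), by omega⟩
  else el true

/-- The walk from the end of the gadget of a single slot. -/
def slotWalk (hℓ : 0 < ℓ) (m : ℕ) : ArrowVert Unit 1 ℓ :=
  if m = 0 then el () else v () 0 ⟨min (ℓ - m) (ℓ - 1), by omega⟩

theorem IsGadget.not_isLeaf_el {ι : Type} [Finite ι] {o : Option (S × ι × ι)}
    {g : ArrowVert ι 1 ℓ → V} (hg : IsGadget e d o G g) (hd : 2 ≤ d) (s : ι) :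
    ¬ IsLeaf G (g (el s)) := by
  rintro ⟨y, hy, hy'⟩
  have h1 : G.neighborSet (g (el s)) = {y} := by
    ext z
    exact ⟨fun h => hy' z h, fun h => by rw [h]; exact hy⟩
  have h2 := hg.deg s
  rw [h1, Set.ncard_singleton] at h2
  omega

theorem IsGadget.adj_iff' {ι : Type} [Finite ι] {o : Option (S × ι × ι)}
    {g : ArrowVert ι 1 ℓ → V} (hg : IsGadget e d o G g) {h : ArrowVert ι 1 ℓ}
    (hh : h ∈ slotVerts ι 1 ℓ) {P : ArrowVert ι 1 ℓ → Prop}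
    (hP : ∀ h', (gadget e o).Adj h h' ↔ P h') (z : V) :
    G.Adj (g h) z ↔ ∃ h', P h' ∧ g h' = z := by
  rw [hg.toIsExact.adj_iff hh]
  simp only [hP]

theorem el_eq_arrowWalk (hℓ : 0 < ℓ) (s : Bool) (m : ℕ) :
    el s = arrowWalk hℓ m ↔ (s = false ∧ m = 0) ∨ (s = true ∧ 2 * ℓ < m) := by
  unfold arrowWalk
  split_ifs <;> cases s <;> simp <;> omega

theorem v_eq_arrowWalk (hℓ : 0 < ℓ) (s : Bool) (k : Fin ℓ) (m : ℕ) :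
    v s 0 k = arrowWalk hℓ m ↔
      (s = false ∧ m ≠ 0 ∧ m + k.val = ℓ) ∨ (s = true ∧ m = ℓ + 1 + k.val) := by
  have := k.2
  unfold arrowWalk
  split_ifs <;> cases s <;> simp [Fin.ext_iff] <;> omega

theorem w_ne_arrowWalk (hℓ : 0 < ℓ) (s : Bool) (m : ℕ) : w s 0 ≠ arrowWalk hℓ m := by
  unfold arrowWalk
  split_ifs <;> simp

theorem el_eq_slotWalk (hℓ : 0 < ℓ) (m : ℕ) : el () = slotWalk hℓ m ↔ m = 0 := by
  unfold slotWalk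
  split_ifs <;> simp_all

theorem v_eq_slotWalk (hℓ : 0 < ℓ) (k : Fin ℓ) (m : ℕ) (hm : m ≤ ℓ) :
    v () 0 k = slotWalk hℓ m ↔ m ≠ 0 ∧ m + k.val = ℓ := by
  have := k.2
  unfold slotWalk
  split_ifs <;> simp [Fin.ext_iff] <;> omega

theorem w_ne_slotWalk (hℓ : 0 < ℓ) (m : ℕ) : w () 0 ≠ slotWalk hℓ m := by
  unfold slotWalk
  split_ifs <;> simp

/-- Both vertices `w` hang on the head side, at the path vertex numbered by R. Counted from the tail
this is position ℓ + 1 + e R. -/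
theorem gadget_arrow_adj (hℓ : 0 < ℓ) (R : S) (m : ℕ) (hm : m < 2 * ℓ)
    (h : ArrowVert Bool 1 ℓ) :
    (gadget e (some (R, false, true))).Adj (arrowWalk hℓ (m + 1)) h ↔
      h = arrowWalk hℓ m ∨ h = arrowWalk hℓ (m + 2) ∨
        (m + 1 = ℓ + 1 + (e R).val ∧ (h = w false 0 ∨ h = w true 0)) := by
  have hom := (isShape_arrow R).isMatched
  have hR := (e R).2
  obtain ⟨s, k, hs⟩ : ∃ s k, arrowWalk hℓ (m + 1) = v s 0 k := by
    unfold arrowWalk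
    simp only [if_neg (Nat.succ_ne_zero m), if_pos (show m + 1 ≤ 2 * ℓ by omega)]
    split_ifs
    · exact ⟨_, _, rfl⟩
    · exact ⟨_, _, rfl⟩
  have hk := (v_eq_arrowWalk hℓ s k (m + 1)).1 hs.symm
  have := k.2
  rw [hs]
  cases h with
  | el t =>
    rw [adj_comm, el_eq_arrowWalk, el_eq_arrowWalk]
    refine (adj_el_v (A := ⟨Bool, fun _ _ _ => False⟩) _ _ _ _).trans ?_
    simp only [reduceCtorEq, or_self, and_false, or_false]
    cases s <;> cases t <;> simp_all <;> omega
  | v t i k' =>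
    obtain rfl := Subsingleton.elim i 0
    rw [v_eq_arrowWalk, v_eq_arrowWalk]
    refine (adj_v_v (A := ⟨Bool, fun _ _ _ => False⟩) _ _ _ _ _ _).trans ?_
    have := k'.2
    simp only [reduceCtorEq, or_self, and_false, or_false]
    cases s <;> cases t <;> simp_all <;> omega
  | w t i =>
    obtain rfl := Subsingleton.elim i 0
    refine (adj_v_w (A := ⟨Bool, fun _ _ _ => False⟩) hom _ _ _ _ _).trans ?_
    simp only [w_ne_arrowWalk, false_or, reduceCtorEq, false_and, and_false, Option.some.injEq,
      Prod.mk.injEq, Fin.ext_iff]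
    cases s <;> cases t <;> simp_all <;> omega

theorem gadget_arrow_leaf (hℓ : 0 < ℓ) (R : S) (s : Bool) (h : ArrowVert Bool 1 ℓ) :
    (gadget e (some (R, false, true))).Adj (w s 0) h ↔ h = arrowWalk hℓ (ℓ + 1 + (e R).val) := by
  have hom := (isShape_arrow R).isMatched
  have hR := (e R).2
  rw [adj_comm]
  cases h with
  | el t =>
    rw [el_eq_arrowWalk]
    refine (iff_false_intro (adj_el_w (A := ⟨Bool, fun _ _ _ => False⟩) _ _ _)).trans ?_
    simp; omega
  | w t i =>
    obtain rfl := Subsingleton.elim i 0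
    refine (iff_false_intro (adj_w_w (A := ⟨Bool, fun _ _ _ => False⟩) _ _ _ _)).trans ?_
    simp [w_ne_arrowWalk]
  | v t i k =>
    obtain rfl := Subsingleton.elim i 0
    rw [v_eq_arrowWalk]
    refine (adj_v_w (A := ⟨Bool, fun _ _ _ => False⟩) hom _ _ _ _ _).trans ?_
    simp only [reduceCtorEq, false_and, and_false, Option.some.injEq, Prod.mk.injEq, Fin.ext_iff,
      false_or]
    cases s <;> cases t <;> simp_all <;> omega

/-- Position m + 1 of the walk is the path vertex with index ℓ - (m + 1). So ℓ ≤ m + 2 singles out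
the indices 0 and 1, to which the vertex `w` of an unused slot is joined. -/
theorem gadget_slot_adj (hℓ : 0 < ℓ) (o : Option S) (m : ℕ) (hm : m < ℓ)
    (h : ArrowVert Unit 1 ℓ) :
    (gadget e (o.map fun R => (R, (), ()))).Adj (slotWalk hℓ (m + 1)) h ↔
      h = slotWalk hℓ m ∨ (m + 1 < ℓ ∧ h = slotWalk hℓ (m + 2)) ∨
        (h = w () 0 ∧ ((o = none ∧ ℓ ≤ m + 2) ∨ ∃ R, o = some R ∧ m + 1 + (e R).val = ℓ)) := by
  have hom : IsMatched (d := 1) fun (_ : Unit) _ => o.map fun R => (R, (), ()) := by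
    cases o with
    | none => exact isShape_blank.isMatched
    | some R => exact (isShape_loop R).isMatched
  obtain ⟨k, hs⟩ : ∃ k, slotWalk hℓ (m + 1) = v () 0 k := by
    unfold slotWalk
    exact ⟨_, if_neg (Nat.succ_ne_zero m)⟩
  have hk := (v_eq_slotWalk hℓ k (m + 1) hm).1 hs.symm
  have := k.2
  rw [hs]
  cases h with
  | el t =>
    rw [adj_comm, el_eq_slotWalk, el_eq_slotWalk]
    refine (adj_el_v (A := ⟨Unit, fun _ _ _ => False⟩) _ _ _ _).trans ?_
    simp; omega
  | v t i k' =>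
    obtain rfl := Subsingleton.elim i 0
    have := k'.2
    refine (adj_v_v (A := ⟨Unit, fun _ _ _ => False⟩) _ _ _ _ _ _).trans ?_
    rw [v_eq_slotWalk _ _ _ hm.le]
    by_cases h2 : m + 1 < ℓ
    · rw [v_eq_slotWalk _ _ _ h2]
      simp; omega
    · simp; omega
  | w t i =>
    obtain rfl := Subsingleton.elim i 0
    obtain rfl : t = () := rfl
    refine (adj_v_w (A := ⟨Unit, fun _ _ _ => False⟩) hom _ _ _ _ _).trans ?_
    rw [iff_false_intro (w_ne_slotWalk hℓ m), iff_false_intro (w_ne_slotWalk hℓ (m + 2))]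
    cases o with
    | none => simp; omega
    | some R => simp [Fin.ext_iff]; omega

theorem gadget_slot_leaf (hℓ : 0 < ℓ) (o : Option S) (m : ℕ) (hm : m ≤ ℓ) :
    (gadget e (o.map fun R => (R, (), ()))).Adj (w () 0) (slotWalk hℓ m) ↔
      m ≠ 0 ∧ ((o = none ∧ ℓ ≤ m + 1) ∨ ∃ R, o = some R ∧ m + (e R).val = ℓ) := by
  rw [adj_comm]
  cases m with
  | zero =>
    rw [show slotWalk hℓ 0 = el () from rfl]
    refine (iff_false_intro (adj_el_w (A := ⟨Unit, fun _ _ _ => False⟩) _ _ _)).trans ?_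
    simp
  | succ m =>
    rw [gadget_slot_adj hℓ o m hm]
    simp [w_ne_slotWalk]

theorem gadget_slot_leaf' (hℓ : 0 < ℓ) (o : Option S) {h : ArrowVert Unit 1 ℓ}
    (hh : (gadget e (o.map fun R => (R, (), ()))).Adj (w () 0) h) :
    ∃ m ≤ ℓ, h = slotWalk hℓ m := by
  cases h with
  | el t => exact ⟨0, by omega, rfl⟩
  | w t i => exact absurd hh (adj_w_w (A := ⟨Unit, fun _ _ _ => False⟩) _ _ _ _)
  | v t i k =>
    obtain rfl := Subsingleton.elim i 0
    have := k.2
    exact ⟨ℓ - k, by omega, (v_eq_slotWalk hℓ k _ (by omega)).2 ⟨by omega, by omega⟩⟩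

end Slots

/-! ### Reading off the content of a slot from its first edge -/

section SlotUnique

variable {S V : Type} {d ℓ : ℕ} {e : S ≃ Fin ℓ} {G : SimpleGraph V}

theorem arrowWalk_mem (hℓ : 0 < ℓ) {m : ℕ} (hm : m < 2 * ℓ) :
    arrowWalk hℓ (m + 1) ∈ slotVerts Bool 1 ℓ := by
  intro s h
  rw [eq_comm, el_eq_arrowWalk] at h
  omega

theorem slotWalk_mem (hℓ : 0 < ℓ) (m : ℕ) : slotWalk hℓ (m + 1) ∈ slotVerts Unit 1 ℓ := by
  intro s h
  rw [eq_comm, el_eq_slotWalk] at h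
  omega

theorem arrowWalk_ne (hℓ : 0 < ℓ) {m : ℕ} (hm : m < 2 * ℓ) :
    arrowWalk hℓ m ≠ arrowWalk hℓ (m + 2) := by
  intro h
  cases h' : arrowWalk hℓ m with
  | el s =>
    have h1 := (el_eq_arrowWalk hℓ s m).1 h'.symm
    have h2 := (el_eq_arrowWalk hℓ s _).1 (h'.symm.trans h)
    cases s <;> simp at h1 h2
    omega
  | v s i k =>
    obtain rfl := Subsingleton.elim i 0
    have h1 := (v_eq_arrowWalk hℓ s k m).1 h'.symm
    have h2 := (v_eq_arrowWalk hℓ s k _).1 (h'.symm.trans h)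
    cases s <;> simp at h1 h2 <;> omega
  | w s i =>
    obtain rfl := Subsingleton.elim i 0
    exact w_ne_arrowWalk hℓ s m h'.symm

theorem slotWalk_ne (hℓ : 0 < ℓ) {m n : ℕ} (hm : m ≤ ℓ) (hn : n ≤ ℓ) (hmn : m ≠ n) :
    slotWalk hℓ m ≠ slotWalk hℓ n := by
  intro h
  cases h' : slotWalk hℓ m with
  | el s =>
    have h1 := (el_eq_slotWalk hℓ m).1 h'.symm
    have h2 := (el_eq_slotWalk hℓ n).1 (h'.symm.trans h)
    omega
  | v s i k =>
    obtain rfl := Subsingleton.elim i 0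
    have h1 := (v_eq_slotWalk hℓ k m hm).1 h'.symm
    have h2 := (v_eq_slotWalk hℓ k n hn).1 (h'.symm.trans h)
    omega
  | w s i =>
    obtain rfl := Subsingleton.elim i 0
    exact w_ne_slotWalk hℓ m h'.symm

theorem IsGadget.isSpine_arrow (hd : 2 ≤ d) (hℓ : 0 < ℓ) {R : S} {g : ArrowVert Bool 1 ℓ → V}
    (hg : IsGadget e d (some (R, false, true)) G g) :
    IsSpine G (2 * ℓ + 1) (ℓ + 1 + (e R).val) (g ∘ arrowWalk hℓ) := by
  refine isSpine_of_adj {g (w false 0), g (w true 0)} (fun _ => ⟨_, Or.inl rfl⟩) ?_ ?_ ?_ ?_ ?_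
  · have : ∀ s, IsLeaf G (g (w s 0)) := by
      intro s
      have hw : (w s 0 : ArrowVert Bool 1 ℓ) ∈ slotVerts Bool 1 ℓ := by intro a h; cases h
      refine ⟨g (arrowWalk hℓ (ℓ + 1 + (e R).val)), ?_, ?_⟩
      · exact (hg.toIsExact.adj_iff hw _).2 ⟨_, (gadget_arrow_leaf hℓ R s _).2 rfl, rfl⟩
      · intro y hy
        obtain ⟨h, hh, rfl⟩ := (hg.toIsExact.adj_iff hw _).1 hy
        rw [(gadget_arrow_leaf hℓ R s _).1 hh]
    rintro z (rfl | rfl)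
    · exact this false
    · exact this true
  · intro m hm z
    have hm' : m < 2 * ℓ := by omega
    rw [Function.comp_apply, hg.adj_iff' (arrowWalk_mem hℓ hm') (gadget_arrow_adj hℓ R m hm')]
    constructor
    · rintro ⟨h, rfl | rfl | ⟨h1, rfl | rfl⟩, rfl⟩
      · exact Or.inl rfl
      · exact Or.inr (Or.inl rfl)
      · exact Or.inr (Or.inr ⟨h1, Or.inl rfl⟩)
      · exact Or.inr (Or.inr ⟨h1, Or.inr rfl⟩)
    · rintro (rfl | rfl | ⟨h1, rfl | rfl⟩)
      · exact ⟨_, Or.inl rfl, rfl⟩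
      · exact ⟨_, Or.inr (Or.inl rfl), rfl⟩
      · exact ⟨_, Or.inr (Or.inr ⟨h1, Or.inl rfl⟩), rfl⟩
      · exact ⟨_, Or.inr (Or.inr ⟨h1, Or.inr rfl⟩), rfl⟩
  · intro m hm h
    exact arrowWalk_ne hℓ (by omega) (hg.inj h)
  · exact hg.not_isLeaf_el hd false
  · have : arrowWalk hℓ (2 * ℓ + 1) = el true :=
      ((el_eq_arrowWalk hℓ true _).2 (Or.inr ⟨rfl, by omega⟩)).symm
    rw [Function.comp_apply, this]
    exact hg.not_isLeaf_el hd true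

theorem ArrowAt.exists_isSpine (hd : 2 ≤ d) (hℓ : 0 < ℓ) {R : S} {x u x' u' : V}
    (h : ArrowAt e d G R x u x' u') :
    ∃ c, IsSpine G (2 * ℓ + 1) (ℓ + 1 + (e R).val) c ∧ c 0 = x ∧ c 1 = u ∧ c (2 * ℓ) = u' ∧
      c (2 * ℓ + 1) = x' := by
  obtain ⟨g, hg, rfl, rfl, hu⟩ := h
  obtain ⟨hu, hu'⟩ := hu ⟨ℓ - 1, by omega⟩ (by simp; omega)
  refine ⟨_, hg.isSpine_arrow hd hℓ, rfl, ?_, ?_, ?_⟩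
  · rw [← hu, Function.comp_apply, (v_eq_arrowWalk hℓ false _ 1).2]
    simp; omega
  · rw [← hu', Function.comp_apply, (v_eq_arrowWalk hℓ true _ _).2]
    simp; omega
  · rw [Function.comp_apply, ← (el_eq_arrowWalk hℓ true (2 * ℓ + 1)).2 (Or.inr ⟨rfl, by omega⟩)]

theorem ArrowAt.exists_isSpine' (hd : 2 ≤ d) (hℓ : 0 < ℓ) {R : S} {x u x' u' : V}
    (h : ArrowAt e d G R x u x' u') :
    ∃ c, IsSpine G (2 * ℓ + 1) (ℓ - (e R).val) c ∧ c 0 = x' ∧ c 1 = u' ∧ c (2 * ℓ) = u ∧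
      c (2 * ℓ + 1) = x := by
  obtain ⟨c, hc, h0, h1, h2, h3⟩ := h.exists_isSpine hd hℓ
  have := (e R).2
  refine ⟨_, hc.reverse (ℓ - (e R).val) (by omega), h3, h2, ?_, ?_⟩
  · simpa using h1
  · simpa using h0

variable {g : ArrowVert Unit 1 ℓ → V}

theorem IsGadget.adj_slot {o : Option S} (hℓ : 0 < ℓ)
    (hg : IsGadget e d (o.map fun R => (R, (), ())) G g) {m : ℕ} (hm : m < ℓ) (z : V) :
    G.Adj (g (slotWalk hℓ (m + 1))) z ↔
      z = g (slotWalk hℓ m) ∨ (m + 1 < ℓ ∧ z = g (slotWalk hℓ (m + 2))) ∨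
        (z = g (w () 0) ∧ ((o = none ∧ ℓ ≤ m + 2) ∨ ∃ R, o = some R ∧ m + 1 + (e R).val = ℓ)) := by
  rw [hg.adj_iff' (slotWalk_mem hℓ m) (gadget_slot_adj hℓ o m hm)]
  constructor
  · rintro ⟨h, rfl | ⟨h1, rfl⟩ | ⟨rfl, h1⟩, rfl⟩
    · exact Or.inl rfl
    · exact Or.inr (Or.inl ⟨h1, rfl⟩)
    · exact Or.inr (Or.inr ⟨rfl, h1⟩)
  · rintro (rfl | ⟨h1, rfl⟩ | ⟨rfl, h1⟩)
    · exact ⟨_, Or.inl rfl, rfl⟩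
    · exact ⟨_, Or.inr (Or.inl ⟨h1, rfl⟩), rfl⟩
    · exact ⟨_, Or.inr (Or.inr ⟨rfl, h1⟩), rfl⟩

/-- An unused slot ends in a triangle formed by `w` and the path vertices 0 and 1. The walk
therefore branches at path vertex 1, which is position ℓ - 1, and neither branch is a leaf. -/
theorem IsGadget.isSpine_blank (hd : 2 ≤ d) (hℓ : 2 ≤ ℓ) (hg : IsGadget e d none G g) :
    IsSpine G (ℓ - 1) 0 (g ∘ slotWalk (by omega)) ∧ IsFork G (ℓ - 1) (g ∘ slotWalk (by omega)) := by
  have hℓ0 : 0 < ℓ := by omega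
  have hadj := fun {m} (hm : m < ℓ) z => IsGadget.adj_slot (o := none) hℓ0 hg hm z
  have hw : (w () 0 : ArrowVert Unit 1 ℓ) ∈ slotVerts Unit 1 ℓ := by intro a h; cases h
  obtain ⟨l, rfl⟩ : ∃ l, ℓ = l + 2 := ⟨ℓ - 2, by omega⟩
  have hne : ∀ {m n}, m ≤ l + 2 → n ≤ l + 2 → m ≠ n → g (slotWalk hℓ0 m) ≠ g (slotWalk hℓ0 n) :=
    fun hm hn hmn h => slotWalk_ne hℓ0 hm hn hmn (hg.inj h)
  have hwne : ∀ m, g (w () 0) ≠ g (slotWalk hℓ0 m) := fun m h => w_ne_slotWalk hℓ0 m (hg.inj h)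
  constructor
  · refine isSpine_of_adj ∅ (fun h => absurd rfl h) (by simp) ?_ ?_ ?_ ?_
    · intro m hm z
      rw [Function.comp_apply, hadj (by omega)]
      simp [show m + 1 < l + 2 by omega, show ¬ l ≤ m by omega]
    · exact fun m hm => hne (by omega) (by omega) (by omega)
    · exact hg.not_isLeaf_el hd ()
    · exact not_isLeaf ((hadj (m := l) (by omega) _).2 (Or.inl rfl))
        ((hadj (m := l) (by omega) _).2 (Or.inr (Or.inl ⟨by omega, rfl⟩)))
        (hne (by omega) (by omega) (by omega))
  · refine ⟨g (slotWalk hℓ0 (l + 2)), g (w () 0), (hwne _).symm, hne (by omega) (by omega) (by omega),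
      hwne _, ⟨?_, ?_⟩, ⟨?_, ?_⟩⟩
    · exact (hadj (m := l) (by omega) _).2 (Or.inr (Or.inl ⟨by omega, rfl⟩))
    · exact not_isLeaf ((hadj (m := l + 1) (by omega) _).2 (Or.inl rfl))
        ((hadj (m := l + 1) (by omega) _).2 (Or.inr (Or.inr ⟨rfl, by simp⟩))) (hwne _)
    · exact (hadj (m := l) (by omega) _).2 (Or.inr (Or.inr ⟨rfl, by simp⟩))
    · have h1 := fun m hm => (gadget_slot_leaf (e := e) hℓ0 none m hm)
      refine not_isLeaf ((hg.toIsExact.adj_iff hw _).2 ⟨_, (h1 (l + 1) (by omega)).2 (by simp), rfl⟩)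
        ((hg.toIsExact.adj_iff hw _).2 ⟨_, (h1 (l + 2) (by omega)).2 (by simp), rfl⟩)
        (hne (by omega) (by omega) (by omega))

/-- If e R = 0, path vertex 0 has two neighbours and the walk reaches it after ℓ steps. Otherwise
path vertex 0 is itself a leaf, and the walk stops at path vertex 1. For e R ≤ 1 the pendant vertex
`w` hangs on the last vertex of the walk, so no interior vertex shows it. -/
theorem IsGadget.isSpine_loop (hd : 2 ≤ d) (hℓ : 2 ≤ ℓ) {R : S}
    (hg : IsGadget e d (some (R, (), ())) G g) :
    ∃ n, n = (if (e R).val = 0 then ℓ else ℓ - 1) ∧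
      IsSpine G n (ℓ - (e R).val) (g ∘ slotWalk (by omega)) ∧
      IsDeadEnd G n (g ∘ slotWalk (by omega)) := by
  have hℓ0 : 0 < ℓ := by omega
  have hR := (e R).2
  have hadj := fun {m} (hm : m < ℓ) z => IsGadget.adj_slot (o := some R) hℓ0 hg hm z
  have hw : (w () 0 : ArrowVert Unit 1 ℓ) ∈ slotVerts Unit 1 ℓ := by intro a h; cases h
  obtain ⟨l, rfl⟩ : ∃ l, ℓ = l + 2 := ⟨ℓ - 2, by omega⟩
  have hne : ∀ {m n}, m ≤ l + 2 → n ≤ l + 2 → m ≠ n → g (slotWalk hℓ0 m) ≠ g (slotWalk hℓ0 n) :=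
    fun hm hn hmn h => slotWalk_ne hℓ0 hm hn hmn (hg.inj h)
  have hwne : ∀ m, g (w () 0) ≠ g (slotWalk hℓ0 m) := fun m h => w_ne_slotWalk hℓ0 m (hg.inj h)
  have hleaf : IsLeaf G (g (w () 0)) := by
    have h1 := fun m hm => (gadget_slot_leaf (e := e) hℓ0 (some R) m hm)
    refine ⟨g (slotWalk hℓ0 (l + 2 - (e R).val)), ?_, ?_⟩
    · refine (hg.toIsExact.adj_iff hw _).2 ⟨_, (h1 _ (by omega)).2 ⟨by omega, Or.inr ⟨R, rfl, ?_⟩⟩, rfl⟩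
      omega
    · intro y hy
      obtain ⟨h, hh, rfl⟩ := (hg.toIsExact.adj_iff hw _).1 hy
      obtain ⟨m, hm, rfl⟩ := gadget_slot_leaf' (e := e) hℓ0 (some R) hh
      have := (h1 _ hm).1 hh
      simp only [reduceCtorEq, false_and, Option.some.injEq, exists_eq_left', false_or] at this
      congr 2
      omega
  refine ⟨_, rfl, ?_, ?_⟩
  · refine isSpine_of_adj {g (w () 0)} (fun _ => ⟨_, rfl⟩) (by simpa using hleaf) ?_ ?_ ?_ ?_
    · intro m hm z
      have hm' : m + 1 < l + 2 := by split_ifs at hm <;> omega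
      rw [Function.comp_apply, hadj (by omega)]
      simp only [reduceCtorEq, false_and, Option.some.injEq, exists_eq_left', false_or,
        hm', true_and, Set.mem_singleton_iff, Function.comp_apply]
      rw [and_comm (a := z = g (w () 0)),
        show m + 1 + (e R).val = l + 2 ↔ m + 1 = l + 2 - (e R).val by omega]
    · exact fun m hm => hne (by split_ifs at hm <;> omega) (by split_ifs at hm <;> omega) (by omega)
    · exact hg.not_isLeaf_el hd ()
    · split_ifs with h0
      · exact not_isLeaf ((hadj (m := l + 1) (by omega) _).2 (Or.inl rfl))
          ((hadj (m := l + 1) (by omega) _).2 (Or.inr (Or.inr ⟨rfl, Or.inr ⟨R, rfl, by omega⟩⟩))) (hwne _)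
      · exact not_isLeaf ((hadj (m := l) (by omega) _).2 (Or.inl rfl))
          ((hadj (m := l) (by omega) _).2 (Or.inr (Or.inl ⟨by omega, rfl⟩)))
          (hne (by omega) (by omega) (by omega))
  · intro z hz hl
    split_ifs at hz ⊢ with h0
    · rcases (hadj (m := l + 1) (by omega) _).1 hz with rfl | ⟨h, -⟩ | ⟨rfl, -⟩
      · rfl
      · omega
      · exact absurd hleaf hl
    · rcases (hadj (m := l) (by omega) _).1 hz with rfl | ⟨h, rfl⟩ | ⟨rfl, -⟩
      · rfl
      · refine absurd ⟨g (slotWalk hℓ0 (l + 1)), ?_, ?_⟩ hl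
        · exact (hadj (m := l + 1) (by omega) _).2 (Or.inl rfl)
        · intro y hy
          rcases (hadj (m := l + 1) (by omega) _).1 hy with rfl | ⟨h, -⟩ | ⟨rfl, h⟩
          · rfl
          · omega
          · simp only [reduceCtorEq, false_and, Option.some.injEq, exists_eq_left', false_or] at h
            omega
      · exact absurd hleaf hl

theorem BlankAt.exists_isSpine (hd : 2 ≤ d) (hℓ : 2 ≤ ℓ) {x u : V} (h : BlankAt e d G x u) :
    ∃ c, IsSpine G (ℓ - 1) 0 c ∧ IsFork G (ℓ - 1) c ∧ c 0 = x ∧ c 1 = u := by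
  obtain ⟨g, hg, rfl, hu⟩ := h
  refine ⟨_, (hg.isSpine_blank hd hℓ).1, (hg.isSpine_blank hd hℓ).2, rfl, ?_⟩
  rw [← hu ⟨ℓ - 1, by omega⟩ (by simp; omega), Function.comp_apply,
    (v_eq_slotWalk (by omega) ⟨ℓ - 1, by omega⟩ 1 (by omega)).2 ⟨by omega, by simp; omega⟩]

theorem LoopAt.exists_isSpine (hd : 2 ≤ d) (hℓ : 2 ≤ ℓ) {R : S} {x u : V}
    (h : LoopAt e d G R x u) :
    ∃ n c, n = (if (e R).val = 0 then ℓ else ℓ - 1) ∧ IsSpine G n (ℓ - (e R).val) c ∧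
      IsDeadEnd G n c ∧ c 0 = x ∧ c 1 = u := by
  obtain ⟨g, hg, rfl, hu⟩ := h
  obtain ⟨n, hn, h1, h2⟩ := hg.isSpine_loop hd hℓ
  refine ⟨_, _, hn, h1, h2, rfl, ?_⟩
  rw [← hu ⟨ℓ - 1, by omega⟩ (by simp; omega), Function.comp_apply,
    (v_eq_slotWalk (by omega) ⟨ℓ - 1, by omega⟩ 1 (by omega)).2 ⟨by omega, by simp; omega⟩]

section

variable {R R' : S} {x u y z u' u'' : V} (hd : 2 ≤ d) (hℓ : 2 ≤ ℓ)

include hd hℓ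

/-- Both walks start with x, u and have length 2ℓ + 1, so they agree. The position of the pendant
vertices gives the relation. -/
theorem ArrowAt.unique (h : ArrowAt e d G R x u y u') (h' : ArrowAt e d G R' x u z u'') :
    R = R' ∧ y = z ∧ u' = u'' := by
  obtain ⟨c, hc, h0, h1, h2, h3⟩ := h.exists_isSpine hd (by omega)
  obtain ⟨c', hc', h0', h1', h2', h3'⟩ := h'.exists_isSpine hd (by omega)
  have e0 := h0.trans h0'.symm
  have e1 := h1.trans h1'.symm
  have hR := (e R).2
  refine ⟨e.injective (Fin.ext ?_), ?_, ?_⟩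
  · have := (hc.leaf_eq hc' e0 e1 (m := ℓ + (e R).val) (by omega)).1 (by omega)
    omega
  · rw [← h3, ← h3', hc.det hc' e0 e1 le_rfl]
  · rw [← h2, ← h2', hc.det hc' e0 e1 (by omega)]

theorem ArrowAt.unique' (h : ArrowAt e d G R y u' x u) (h' : ArrowAt e d G R' z u'' x u) :
    R = R' ∧ y = z ∧ u' = u'' := by
  obtain ⟨c, hc, h0, h1, h2, h3⟩ := h.exists_isSpine' hd (by omega)
  obtain ⟨c', hc', h0', h1', h2', h3'⟩ := h'.exists_isSpine' hd (by omega)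
  have e0 := h0.trans h0'.symm
  have e1 := h1.trans h1'.symm
  have hR := (e R).2
  have hR' := (e R').2
  refine ⟨e.injective (Fin.ext ?_), ?_, ?_⟩
  · have := (hc.leaf_eq hc' e0 e1 (m := ℓ - (e R).val - 1) (by omega)).1 (by omega)
    omega
  · rw [← h3, ← h3', hc.det hc' e0 e1 le_rfl]
  · rw [← h2, ← h2', hc.det hc' e0 e1 (by omega)]

/-- The pendant vertices hang beyond position ℓ when counted from a tail, and at position at most ℓ
when counted from a head. -/
theorem ArrowAt.not_reverse (h : ArrowAt e d G R x u y u') : ¬ ArrowAt e d G R' z u'' x u := by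
  intro h'
  obtain ⟨c, hc, h0, h1, h2, h3⟩ := h.exists_isSpine hd (by omega)
  obtain ⟨c', hc', h0', h1', h2', h3'⟩ := h'.exists_isSpine' hd (by omega)
  have hR := (e R).2
  have := (hc.leaf_eq hc' (h0.trans h0'.symm) (h1.trans h1'.symm)
    (m := ℓ + (e R).val) (by omega)).1 (by omega)
  omega

/-- The walk through a loop stops after at most ℓ steps, whereas one through an arrow goes on for 2ℓ
+ 1. -/
theorem LoopAt.not_arrowAt (h : LoopAt e d G R x u) : ¬ ArrowAt e d G R' x u y u' := by
  intro h'
  obtain ⟨n, c, hn, hc, hc2, h0, h1⟩ := h.exists_isSpine hd hℓ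
  obtain ⟨c', hc', h0', h1', -, -⟩ := h'.exists_isSpine hd (by omega)
  exact hc'.not_isDeadEnd hc (h0'.trans h0.symm) (h1'.trans h1.symm)
    (by split_ifs at hn <;> omega) (by split_ifs at hn <;> omega) hc2

theorem LoopAt.not_arrowAt' (h : LoopAt e d G R x u) : ¬ ArrowAt e d G R' y u' x u := by
  intro h'
  obtain ⟨n, c, hn, hc, hc2, h0, h1⟩ := h.exists_isSpine hd hℓ
  obtain ⟨c', hc', h0', h1', -, -⟩ := h'.exists_isSpine' hd (by omega)
  exact hc'.not_isDeadEnd hc (h0'.trans h0.symm) (h1'.trans h1.symm)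
    (by split_ifs at hn <;> omega) (by split_ifs at hn <;> omega) hc2

theorem BlankAt.not_arrowAt (h : BlankAt e d G x u) : ¬ ArrowAt e d G R' x u y u' := by
  intro h'
  obtain ⟨c, hc, hc2, h0, h1⟩ := h.exists_isSpine hd hℓ
  obtain ⟨c', hc', h0', h1', -, -⟩ := h'.exists_isSpine hd (by omega)
  exact hc'.not_isFork hc (h0'.trans h0.symm) (h1'.trans h1.symm) (by omega) (by omega) hc2

theorem BlankAt.not_arrowAt' (h : BlankAt e d G x u) : ¬ ArrowAt e d G R' y u' x u := by
  intro h'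
  obtain ⟨c, hc, hc2, h0, h1⟩ := h.exists_isSpine hd hℓ
  obtain ⟨c', hc', h0', h1', -, -⟩ := h'.exists_isSpine' hd (by omega)
  exact hc'.not_isFork hc (h0'.trans h0.symm) (h1'.trans h1.symm) (by omega) (by omega) hc2

/-- At position ℓ - 1 an unused slot branches. A loop is there either still on its way or at its
dead end. -/
theorem BlankAt.not_loopAt (h : BlankAt e d G x u) : ¬ LoopAt e d G R x u := by
  intro h'
  obtain ⟨c, hc, hc2, h0, h1⟩ := h.exists_isSpine hd hℓ
  obtain ⟨n, c', hn, hc', hc2', h0', h1'⟩ := h'.exists_isSpine hd hℓ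
  split_ifs at hn
  · exact hc'.not_isFork hc (h0'.trans h0.symm) (h1'.trans h1.symm) (by omega) (by omega) hc2
  · subst hn
    exact hc2'.not_isFork hc' hc (h0'.trans h0.symm) (h1'.trans h1.symm) hc2

/-- The length of the walk tells whether e R = 0. If neither relation has number 0, the pendant
vertices of two different relations would hang at different positions, and the earlier of these is
interior. -/
theorem LoopAt.unique (h : LoopAt e d G R x u) (h' : LoopAt e d G R' x u) : R = R' := by
  obtain ⟨n, c, hn, hc, hc2, h0, h1⟩ := h.exists_isSpine hd hℓ
  obtain ⟨n', c', hn', hc', hc2', h0', h1'⟩ := h'.exists_isSpine hd hℓ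
  have e0 := h0.trans h0'.symm
  have e1 := h1.trans h1'.symm
  have hR := (e R).2
  have hR' := (e R').2
  refine e.injective (Fin.ext ?_)
  split_ifs at hn hn' with i i' i'
  · omega
  · exact absurd hc2' (hc.not_isDeadEnd hc' e0 e1 (by omega) (by omega))
  · exact absurd hc2 (hc'.not_isDeadEnd hc e0.symm e1.symm (by omega) (by omega))
  · subst hn hn'
    by_contra hne
    have h2 := hc.leaf_eq hc' e0 e1 (m := ℓ - (e R).val - 1)
    have h3 := hc.leaf_eq hc' e0 e1 (m := ℓ - (e R').val - 1)
    omega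

end

end SlotUnique

/-! ### The slots of an encoding -/

section SlotsOfEncoding

variable {S : Type} {d ℓ : ℕ} {e : S ≃ Fin ℓ} {A : FinStr S}
  {ans : A.carrier → Fin d → Option (S × A.carrier × A.carrier)}

theorem isGadget_blank (hm : IsMatched ans) (hℓ : 0 < ℓ) {a : A.carrier} {i : Fin d}
    (h : ans a i = none) :
    IsGadget e d none (arrowGraph e A ans) (relabel (fun _ : Unit => a) fun _ => i) :=
  isGadget_relabel hm hℓ isShape_blank _ _ (fun _ _ _ => rfl) fun _ => h

theorem isGadget_loop (hm : IsMatched ans) (hℓ : 0 < ℓ) {R : S} {a : A.carrier} {i : Fin d}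
    (h : ans a i = some (R, a, a)) :
    IsGadget e d (some (R, (), ())) (arrowGraph e A ans)
      (relabel (fun _ : Unit => a) fun _ => i) :=
  isGadget_relabel hm hℓ (isShape_loop R) _ _ (fun _ _ _ => rfl) fun _ => h

theorem isGadget_arrow (hm : IsMatched ans) (hℓ : 0 < ℓ) {R : S} {a b : A.carrier} {i j : Fin d}
    (hab : a ≠ b) (h : ans a i = some (R, a, b)) (h' : ans b j = some (R, a, b)) :
    IsGadget e d (some (R, false, true)) (arrowGraph e A ans)
      (relabel (fun s : Bool => cond s b a) fun s => cond s j i) := by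
  refine isGadget_relabel hm hℓ (isShape_arrow R) _ _ ?_ ?_
  · intro s t hst
    cases s <;> cases t <;> simp_all
  · intro s
    cases s
    · exact h
    · exact h'

/-- Every slot vertex belongs to a gadget, so statements about neighbourhoods can be checked gadget
by gadget. -/
theorem slotVerts_induction (hm : IsMatched ans) {P : ArrowVert A.carrier d ℓ → Prop}
    (blank : ∀ a i, ans a i = none →
      ∀ h ∈ slotVerts Unit 1 ℓ, P (relabel (fun _ : Unit => a) (fun _ => i) h))
    (loop : ∀ R a i, ans a i = some (R, a, a) →
      ∀ h ∈ slotVerts Unit 1 ℓ, P (relabel (fun _ : Unit => a) (fun _ => i) h))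
    (arrow : ∀ R a b i j, a ≠ b → ans a i = some (R, a, b) → ans b j = some (R, a, b) →
      ∀ h ∈ slotVerts Bool 1 ℓ,
        P (relabel (fun s : Bool => cond s b a) (fun s => cond s j i) h))
    (h : ArrowVert A.carrier d ℓ) (hh : h ∈ slotVerts A.carrier d ℓ) : P h := by
  have key : ∀ a i, (∀ k, P (v a i k)) ∧ P (w a i) := by
    intro a i
    have hv : ∀ {ι} (s : ι) (k : Fin ℓ), (v s 0 k : ArrowVert ι 1 ℓ) ∈ slotVerts ι 1 ℓ :=
      fun s k t h => by cases h
    have hw : ∀ {ι} (s : ι), (w s 0 : ArrowVert ι 1 ℓ) ∈ slotVerts ι 1 ℓ :=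
      fun s t h => by cases h
    cases ho : ans a i with
    | none => exact ⟨fun k => blank a i ho _ (hv () k), blank a i ho _ (hw ())⟩
    | some t =>
      obtain ⟨R, b, c⟩ := t
      by_cases hbc : b = c
      · obtain rfl : a = b := by
          rcases hm.mem _ _ _ _ _ ho with h | h
          · exact h
          · exact h.trans hbc.symm
        subst hbc
        exact ⟨fun k => loop R a i ho _ (hv () k), loop R a i ho _ (hw ())⟩
      · rcases hm.mem _ _ _ _ _ ho with rfl | rfl
        · obtain ⟨j, hj⟩ := hm.right _ _ _ _ _ ho
          exact ⟨fun k => arrow R a c i j hbc ho hj _ (hv false k),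
            arrow R a c i j hbc ho hj _ (hw false)⟩
        · obtain ⟨j, hj⟩ := hm.left _ _ _ _ _ ho
          exact ⟨fun k => arrow R b a j i hbc hj ho _ (hv true k),
            arrow R b a j i hbc hj ho _ (hw true)⟩
  cases h with
  | el a => exact absurd rfl (hh a)
  | v a i k => exact (key a i).1 k
  | w a i => exact (key a i).2

theorem el_mem_nhd (hm : IsMatched ans) (hℓ : 2 ≤ ℓ) (h : ArrowVert A.carrier d ℓ) :
    ∃ a, el a ∈ (arrowGraph e A ans).nhd {h} (2 * ℓ + 1) := by
  by_cases hh : h ∈ slotVerts A.carrier d ℓ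
  · revert h
    refine slotVerts_induction hm (fun a i h h₀ _ => ?_) (fun R a i h h₀ _ => ?_)
      (fun R a b i j hab h h' h₀ _ => ?_)
    · exact ⟨a, mem_nhd_comm ((isGadget_blank hm (by omega) h).mem_nhd isShape_blank hℓ () h₀)⟩
    · exact ⟨a, mem_nhd_comm ((isGadget_loop hm (by omega) h).mem_nhd (isShape_loop R) hℓ () h₀)⟩
    · exact ⟨a, mem_nhd_comm
        ((isGadget_arrow hm (by omega) hab h h').mem_nhd (isShape_arrow R) hℓ false h₀)⟩
  · simp only [slotVerts, Set.mem_ofPred_eq, not_forall, not_not] at hh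
    obtain ⟨a, rfl⟩ := hh
    exact ⟨a, nhd_mono (Nat.zero_le _) rfl⟩

/-- All other vertices have degree at most 7. -/
theorem eq_el_of_ncard (hm : IsMatched ans) (hd : 8 ≤ d) {h : ArrowVert A.carrier d ℓ}
    (hh : ((arrowGraph e A ans).neighborSet h).ncard = d) : ∃ a, h = el a := by
  by_contra hc
  push Not at hc
  have := ncard_neighborSet_inner (e := e) hm h hc
  omega

theorem eq_v_of_adj {a : A.carrier} {u : ArrowVert A.carrier d ℓ}
    (h : (arrowGraph e A ans).Adj (el a) u) : ∃ i, ∀ k : Fin ℓ, k.val + 1 = ℓ → v a i k = u := by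
  cases u with
  | el b => exact absurd h (adj_el_el _ _)
  | w b i => exact absurd h (adj_el_w _ _ _)
  | v b i k =>
    obtain ⟨rfl, hk⟩ := (adj_el_v _ _ _ _).1 h
    refine ⟨i, fun k' hk' => ?_⟩
    congr 1
    ext
    omega

theorem slot_cases (hm : IsMatched ans) (hℓ : 0 < ℓ) {a : A.carrier}
    {u : ArrowVert A.carrier d ℓ} (h : (arrowGraph e A ans).Adj (el a) u) :
    BlankAt e d (arrowGraph e A ans) (el a) u ∨
    (∃ R i, ans a i = some (R, a, a) ∧ LoopAt e d (arrowGraph e A ans) R (el a) u ∧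
      ∀ k : Fin ℓ, k.val + 1 = ℓ → v a i k = u) ∨
    (∃ R b i, ans a i = some (R, a, b) ∧ a ≠ b ∧
      (∃ u', ArrowAt e d (arrowGraph e A ans) R (el a) u (el b) u') ∧
      ∀ k : Fin ℓ, k.val + 1 = ℓ → v a i k = u) ∨
    (∃ R b i, ans a i = some (R, b, a) ∧ b ≠ a ∧
      (∃ u', ArrowAt e d (arrowGraph e A ans) R (el b) u' (el a) u) ∧
      ∀ k : Fin ℓ, k.val + 1 = ℓ → v a i k = u) := by
  obtain ⟨i, hi⟩ := eq_v_of_adj h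
  cases ho : ans a i with
  | none => exact Or.inl ⟨_, isGadget_blank hm hℓ ho, rfl, hi⟩
  | some t =>
    right
    obtain ⟨R, b, c⟩ := t
    by_cases hbc : b = c
    · obtain rfl : a = b := by
        rcases hm.mem _ _ _ _ _ ho with h | h
        · exact h
        · exact h.trans hbc.symm
      subst hbc
      exact Or.inl ⟨R, i, ho, ⟨_, isGadget_loop hm hℓ ho, rfl, hi⟩, hi⟩
    · right
      have hk : ∀ k k' : Fin ℓ, k.val + 1 = ℓ → k'.val + 1 = ℓ → k = k' := by
        intro k k' h h'; ext; omega
      rcases hm.mem _ _ _ _ _ ho with rfl | rfl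
      · obtain ⟨j, hj⟩ := hm.right _ _ _ _ _ ho
        refine Or.inl ⟨R, c, i, ho, hbc, ⟨v c j ⟨ℓ - 1, by omega⟩, _,
          isGadget_arrow hm hℓ hbc ho hj, rfl, rfl, fun k h => ⟨hi k h, ?_⟩⟩, hi⟩
        rw [hk k ⟨ℓ - 1, by omega⟩ h (by simp; omega)]
        rfl
      · obtain ⟨j, hj⟩ := hm.left _ _ _ _ _ ho
        refine Or.inr ⟨R, b, i, ho, hbc, ⟨v b j ⟨ℓ - 1, by omega⟩, _,
          isGadget_arrow hm hℓ hbc hj ho, rfl, rfl, fun k h => ⟨?_, hi k h⟩⟩, hi⟩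
        rw [hk k ⟨ℓ - 1, by omega⟩ h (by simp; omega)]
        rfl

end SlotsOfEncoding

/-! ### Moving slots along local embeddings -/

section SlotsOfGraph

variable {S V W : Type} {d ℓ : ℕ} {e : S ≃ Fin ℓ} {G : SimpleGraph V} {H : SimpleGraph W}
  {R : S} {x u y u' : V}

theorem gadget_adj_el {ι : Type} [Finite ι] {o : Option (S × ι × ι)} (s : ι) (k : Fin ℓ)
    (hk : k.val + 1 = ℓ) : (gadget e o).Adj (el s) (v s 0 k) :=
  (adj_el_v (A := ⟨ι, fun _ _ _ => False⟩) _ _ _ _).2 ⟨rfl, hk⟩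

theorem BlankAt.adj (hℓ : 0 < ℓ) (h : BlankAt e d G x u) : G.Adj x u := by
  obtain ⟨g, hg, rfl, hu⟩ := h
  have hk : (⟨ℓ - 1, by omega⟩ : Fin ℓ).val + 1 = ℓ := by simp; omega
  exact hu _ hk ▸ hg.adj_map (gadget_adj_el () _ hk)

theorem LoopAt.adj (hℓ : 0 < ℓ) (h : LoopAt e d G R x u) : G.Adj x u := by
  obtain ⟨g, hg, rfl, hu⟩ := h
  have hk : (⟨ℓ - 1, by omega⟩ : Fin ℓ).val + 1 = ℓ := by simp; omega
  exact hu _ hk ▸ hg.adj_map (gadget_adj_el () _ hk)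

theorem ArrowAt.adj (hℓ : 0 < ℓ) (h : ArrowAt e d G R x u y u') : G.Adj x u := by
  obtain ⟨g, hg, rfl, rfl, hu⟩ := h
  have hk : (⟨ℓ - 1, by omega⟩ : Fin ℓ).val + 1 = ℓ := by simp; omega
  exact (hu _ hk).1 ▸ hg.adj_map (gadget_adj_el false _ hk)

theorem ArrowAt.adj' (hℓ : 0 < ℓ) (h : ArrowAt e d G R x u y u') : G.Adj y u' := by
  obtain ⟨g, hg, rfl, rfl, hu⟩ := h
  have hk : (⟨ℓ - 1, by omega⟩ : Fin ℓ).val + 1 = ℓ := by simp; omega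
  exact (hu _ hk).2 ▸ hg.adj_map (gadget_adj_el true _ hk)

theorem ArrowAt.ne (h : ArrowAt e d G R x u y u') : x ≠ y := by
  obtain ⟨g, hg, rfl, rfl, hu⟩ := h
  intro h
  cases hg.inj h

theorem LoopAt.ncard (h : LoopAt e d G R x u) : (G.neighborSet x).ncard = d := by
  obtain ⟨g, hg, rfl, hu⟩ := h
  exact hg.deg ()

theorem ArrowAt.ncard (h : ArrowAt e d G R x u y u') : (G.neighborSet x).ncard = d := by
  obtain ⟨g, hg, rfl, rfl, hu⟩ := h
  exact hg.deg false

theorem ArrowAt.ncard' (h : ArrowAt e d G R x u y u') : (G.neighborSet y).ncard = d := by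
  obtain ⟨g, hg, rfl, rfl, hu⟩ := h
  exact hg.deg true

variable {T : Set V} {r m : ℕ} {f : V → W}

theorem ArrowAt.mem_nhd (hℓ : 2 ≤ ℓ) (h : ArrowAt e d G R x u y u') (hx : x ∈ G.nhd T m) :
    y ∈ G.nhd T (m + (2 * ℓ + 1)) := by
  obtain ⟨g, hg, rfl, rfl, hu⟩ := h
  exact hg.mem_nhd_of_mem (isShape_arrow R) hℓ hx _

theorem ArrowAt.mem_nhd' (hℓ : 2 ≤ ℓ) (h : ArrowAt e d G R x u y u') (hy : y ∈ G.nhd T m) :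
    x ∈ G.nhd T (m + (2 * ℓ + 1)) := by
  obtain ⟨g, hg, rfl, rfl, hu⟩ := h
  exact hg.mem_nhd_of_mem (isShape_arrow R) hℓ hy _

theorem LoopAt.map (hℓ : 2 ≤ ℓ) (h : LoopAt e d G R x u) (hf : IsLocalEmb G H (G.nhd T r) f)
    (hx : x ∈ G.nhd T m) (hr : m + (2 * ℓ + 1) < r) : LoopAt e d H R (f x) (f u) := by
  obtain ⟨g, hg, rfl, hu⟩ := h
  exact ⟨_, hg.map hf (isShape_loop R) hℓ hx hr, rfl, fun k hk => by simp [hu k hk]⟩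

theorem ArrowAt.map (hℓ : 2 ≤ ℓ) (h : ArrowAt e d G R x u y u')
    (hf : IsLocalEmb G H (G.nhd T r) f)
    (hx : x ∈ G.nhd T m ∨ y ∈ G.nhd T m) (hr : m + (2 * ℓ + 1) < r) :
    ArrowAt e d H R (f x) (f u) (f y) (f u') := by
  obtain ⟨g, hg, rfl, rfl, hu⟩ := h
  refine ⟨f ∘ g, ?_, rfl, rfl, fun k hk => by simp [hu k hk]⟩
  rcases hx with hx | hx
  · exact hg.map hf (isShape_arrow R) hℓ hx hr
  · exact hg.map hf (isShape_arrow R) hℓ hx hr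

theorem BlankAt.lift (hℓ : 2 ≤ ℓ) {u : W} (hf : IsLocalEmb G H (G.nhd T r) f)
    (h : BlankAt e d H (f x) u) (hx : x ∈ G.nhd T m) (hr : m + (2 * ℓ + 1) < r) :
    ∃ u', BlankAt e d G x u' ∧ f u' = u := by
  obtain ⟨g', hg', hgx, hu⟩ := h
  obtain ⟨g, hg, hgf, hgx', -⟩ := hg'.lift hf isShape_blank hℓ hgx hx hr
  refine ⟨_, ⟨g, hg, hgx', fun k hk => ?_⟩, (hgf _).trans (hu ⟨ℓ - 1, by omega⟩ (by simp; omega))⟩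
  congr 2
  ext
  simp
  omega

theorem LoopAt.lift (hℓ : 2 ≤ ℓ) {u : W} (hf : IsLocalEmb G H (G.nhd T r) f)
    (h : LoopAt e d H R (f x) u) (hx : x ∈ G.nhd T m) (hr : m + (2 * ℓ + 1) < r) :
    ∃ u', LoopAt e d G R x u' ∧ f u' = u := by
  obtain ⟨g', hg', hgx, hu⟩ := h
  obtain ⟨g, hg, hgf, hgx', -⟩ := hg'.lift hf (isShape_loop R) hℓ hgx hx hr
  refine ⟨_, ⟨g, hg, hgx', fun k hk => ?_⟩, (hgf _).trans (hu ⟨ℓ - 1, by omega⟩ (by simp; omega))⟩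
  congr 2
  ext
  simp
  omega

theorem ArrowAt.lift (hℓ : 2 ≤ ℓ) {u y u' : W} (hf : IsLocalEmb G H (G.nhd T r) f)
    (h : ArrowAt e d H R (f x) u y u') (hx : x ∈ G.nhd T m) (hr : m + (2 * ℓ + 1) < r) :
    ∃ t z t', ArrowAt e d G R x t z t' ∧ f t = u ∧ f z = y ∧ f t' = u' := by
  obtain ⟨g', hg', hgx, rfl, hu⟩ := h
  obtain ⟨g, hg, hgf, hgx', -⟩ := hg'.lift hf (isShape_arrow R) hℓ hgx hx hr
  have hk : (⟨ℓ - 1, by omega⟩ : Fin ℓ).val + 1 = ℓ := by simp; omega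
  refine ⟨g (v false 0 _), g (el true), g (v true 0 _), ⟨g, hg, hgx', rfl, fun k hk' => ?_⟩,
    (hgf _).trans (hu _ hk).1, hgf _, (hgf _).trans (hu _ hk).2⟩
  constructor <;> congr 2 <;> ext <;> simp <;> omega

theorem ArrowAt.lift' (hℓ : 2 ≤ ℓ) {u y u' : W} (hf : IsLocalEmb G H (G.nhd T r) f)
    (h : ArrowAt e d H R y u' (f x) u) (hx : x ∈ G.nhd T m) (hr : m + (2 * ℓ + 1) < r) :
    ∃ t z t', ArrowAt e d G R z t' x t ∧ f t = u ∧ f z = y ∧ f t' = u' := by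
  obtain ⟨g', hg', rfl, hgx, hu⟩ := h
  obtain ⟨g, hg, hgf, hgx', -⟩ := hg'.lift hf (isShape_arrow R) hℓ hgx hx hr
  have hk : (⟨ℓ - 1, by omega⟩ : Fin ℓ).val + 1 = ℓ := by simp; omega
  refine ⟨g (v true 0 _), g (el false), g (v false 0 _), ⟨g, hg, rfl, hgx', fun k hk' => ?_⟩,
    (hgf _).trans (hu _ hk).2, hgf _, (hgf _).trans (hu _ hk).1⟩
  constructor <;> congr 2 <;> ext <;> simp <;> omega

end SlotsOfGraph

/-! ### From gadgets in an encoding back to the listing -/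

section Converse

variable {S : Type} {d ℓ : ℕ} {e : S ≃ Fin ℓ} {A : FinStr S}
  {ans : A.carrier → Fin d → Option (S × A.carrier × A.carrier)}

/-- The edge to u starts a slot with some listed content, and the uniqueness of contents excludes
all but this one. So an encoding contains no accidental gadgets. -/
theorem LoopAt.exists_ans (hm : IsMatched ans) (hd : 2 ≤ d) (hℓ : 2 ≤ ℓ) {R : S} {a : A.carrier}
    {u : ArrowVert A.carrier d ℓ} (h : LoopAt e d (arrowGraph e A ans) R (el a) u) :
    ∃ i, ans a i = some (R, a, a) ∧ ∀ k : Fin ℓ, k.val + 1 = ℓ → v a i k = u := by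
  rcases slot_cases hm (by omega) (h.adj (by omega)) with h' | ⟨R', i, hi, h', hu⟩ |
    ⟨R', b, i, hi, hab, ⟨u', h'⟩, hu⟩ | ⟨R', b, i, hi, hab, ⟨u', h'⟩, hu⟩
  · exact absurd h (h'.not_loopAt hd hℓ)
  · obtain rfl := h.unique hd hℓ h'
    exact ⟨i, hi, hu⟩
  · exact absurd h' (h.not_arrowAt hd hℓ)
  · exact absurd h' (h.not_arrowAt' hd hℓ)

theorem ArrowAt.exists_ans (hm : IsMatched ans) (hd : 2 ≤ d) (hℓ : 2 ≤ ℓ) {R : S}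
    {a b : A.carrier} {u u' : ArrowVert A.carrier d ℓ}
    (h : ArrowAt e d (arrowGraph e A ans) R (el a) u (el b) u') :
    ∃ i, ans a i = some (R, a, b) ∧ ∀ k : Fin ℓ, k.val + 1 = ℓ → v a i k = u := by
  rcases slot_cases hm (by omega) (h.adj (by omega)) with h' | ⟨R', i, hi, h', hu⟩ |
    ⟨R', b, i, hi, hab, ⟨u', h'⟩, hu⟩ | ⟨R', b, i, hi, hab, ⟨u', h'⟩, hu⟩
  · exact absurd h (h'.not_arrowAt hd hℓ)
  · exact absurd h (h'.not_arrowAt hd hℓ)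
  · obtain ⟨rfl, h1, -⟩ := h.unique hd hℓ h'
    cases h1
    exact ⟨i, hi, hu⟩
  · exact absurd h' (h.not_reverse hd hℓ)

end Converse

/-- The properties of `G` that make it the encoding of a structure. -/
structure IsDecodable {S V : Type} {ℓ : ℕ} (e : S ≃ Fin ℓ) (d : ℕ) (G : SimpleGraph V) :
    Prop where
  slot : ∀ x u, (G.neighborSet x).ncard = d → G.Adj x u →
    BlankAt e d G x u ∨ (∃ R, LoopAt e d G R x u) ∨ (∃ R y u', ArrowAt e d G R x u y u') ∨
      ∃ R y u', ArrowAt e d G R y u' x u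
  loop_unique : ∀ R x u u', LoopAt e d G R x u → LoopAt e d G R x u' → u = u'
  arrow_unique : ∀ R x y u u' t t', ArrowAt e d G R x u y t → ArrowAt e d G R x u' y t' → u = u'
  covered : ∀ z, ∃ x n, (G.neighborSet x).ncard = d ∧ z ∈ G.nhd {x} n

/-- Each property is seen inside one ball. A vertex of degree d goes to an element. Its gadgets lift
back to G, and parallel gadgets for one tuple are excluded because a listing does not repeat
contents. -/
theorem isDecodable_of_local {S V : Type} {d ℓ : ℕ} {e : S ≃ Fin ℓ} {G : SimpleGraph V}
    (hd : 8 ≤ d) (hℓ : 2 ≤ ℓ) {r : ℕ} (hr : 2 * ℓ + 1 < r)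
    (hG : ∀ x : V, ∃ (A : FinStr S)
      (ans : A.carrier → Fin d → Option (S × A.carrier × A.carrier))
      (f : V → ArrowVert A.carrier d ℓ), A.IsListing d ans ∧
        IsLocalEmb G (arrowGraph e A ans) (G.nhd {x} r) f) : IsDecodable e d G where
  slot x u hx hu := by
    obtain ⟨A, ans, f, hL, hf⟩ := hG x
    have hm := hL.isMatched
    have hx0 : x ∈ G.nhd {x} 0 := rfl
    have hr' : 0 + (2 * ℓ + 1) < r := by omega
    have hdeg := hf.ncard_nhd (by omega) hx0
    obtain ⟨a, ha⟩ := eq_el_of_ncard hm hd (hdeg.trans hx)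
    have hu0 : u ∈ G.nhd {x} r := nhd_mono (show 1 ≤ r by omega) (nhd_step hx0 hu)
    have hadj := hf.adj x (nhd_mono (Nat.zero_le _) hx0) u hu0 hu
    have hmem : ∀ u', G.Adj x u' → u' ∈ G.nhd {x} r := fun u' h =>
      nhd_mono (show 1 ≤ r by omega) (nhd_step hx0 h)
    rw [ha] at hadj
    rcases slot_cases hm (by omega) hadj with h' | ⟨R, i, hi, h', -⟩ |
      ⟨R, b, i, hi, hab, ⟨u', h'⟩, -⟩ | ⟨R, b, i, hi, hab, ⟨u', h'⟩, -⟩ <;> rw [← ha] at h'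
    · obtain ⟨u', h, hu'⟩ := h'.lift hℓ hf hx0 hr'
      obtain rfl := hf.injOn (hmem _ (h.adj (by omega))) hu0 hu'
      exact Or.inl h
    · obtain ⟨u', h, hu'⟩ := h'.lift hℓ hf hx0 hr'
      obtain rfl := hf.injOn (hmem _ (h.adj (by omega))) hu0 hu'
      exact Or.inr (Or.inl ⟨R, h⟩)
    · obtain ⟨t, z, t', h, hu', -, -⟩ := h'.lift hℓ hf hx0 hr'
      obtain rfl := hf.injOn (hmem _ (h.adj (by omega))) hu0 hu'
      exact Or.inr (Or.inr (Or.inl ⟨R, z, t', h⟩))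
    · obtain ⟨t, z, t', h, hu', -, -⟩ := h'.lift' hℓ hf hx0 hr'
      obtain rfl := hf.injOn (hmem _ (h.adj' (by omega))) hu0 hu'
      exact Or.inr (Or.inr (Or.inr ⟨R, z, t', h⟩))
  loop_unique R x u u' h h' := by
    obtain ⟨A, ans, f, hL, hf⟩ := hG x
    have hm := hL.isMatched
    have hx0 : x ∈ G.nhd {x} 0 := rfl
    have hr' : 0 + (2 * ℓ + 1) < r := by omega
    have hmem : ∀ u', G.Adj x u' → u' ∈ G.nhd {x} r := fun u' h =>
      nhd_mono (show 1 ≤ r by omega) (nhd_step hx0 h)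
    have k := h.map hℓ hf hx0 hr'
    have k' := h'.map hℓ hf hx0 hr'
    obtain ⟨a, ha⟩ := eq_el_of_ncard hm hd k.ncard
    rw [ha] at k k'
    obtain ⟨i, hi, hu⟩ := k.exists_ans hm (by omega) hℓ
    obtain ⟨i', hi', hu'⟩ := k'.exists_ans hm (by omega) hℓ
    obtain rfl := hm.inj _ _ _ _ hi hi'
    refine hf.injOn (hmem _ (h.adj (by omega))) (hmem _ (h'.adj (by omega))) ?_
    exact (hu ⟨ℓ - 1, by omega⟩ (by simp; omega)).symm.trans (hu' _ (by simp; omega))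
  arrow_unique R x y u u' t t' h h' := by
    obtain ⟨A, ans, f, hL, hf⟩ := hG x
    have hm := hL.isMatched
    have hx0 : x ∈ G.nhd {x} 0 := rfl
    have hr' : 0 + (2 * ℓ + 1) < r := by omega
    have hmem : ∀ u', G.Adj x u' → u' ∈ G.nhd {x} r := fun u' h =>
      nhd_mono (show 1 ≤ r by omega) (nhd_step hx0 h)
    have k := h.map hℓ hf (Or.inl hx0) hr'
    have k' := h'.map hℓ hf (Or.inl hx0) hr'
    obtain ⟨a, ha⟩ := eq_el_of_ncard hm hd k.ncard
    obtain ⟨b, hb⟩ := eq_el_of_ncard hm hd k.ncard'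
    rw [ha, hb] at k k'
    obtain ⟨i, hi, hu⟩ := k.exists_ans hm (by omega) hℓ
    obtain ⟨i', hi', hu'⟩ := k'.exists_ans hm (by omega) hℓ
    obtain rfl := hm.inj _ _ _ _ hi hi'
    refine hf.injOn (hmem _ (h.adj (by omega))) (hmem _ (h'.adj (by omega))) ?_
    exact (hu ⟨ℓ - 1, by omega⟩ (by simp; omega)).symm.trans (hu' _ (by simp; omega))
  covered z := by
    obtain ⟨A, ans, f, hL, hf⟩ := hG z
    have hz0 : z ∈ G.nhd {z} 0 := rfl
    -- An element near f z lifts to a vertex near z, whose degree is then d.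
    obtain ⟨a, ha⟩ := el_mem_nhd (e := e) hL.isMatched hℓ (f z)
    obtain ⟨x, hx, hfx⟩ := hf.nhd_subset (n := 2 * ℓ + 1) (by omega) hz0 ha
    refine ⟨x, _, ?_, mem_nhd_comm hx⟩
    rw [← hf.ncard_nhd hr hx, hfx, ncard_neighborSet_el (by omega)]

/-! Decoding a graph -/

/-! ### Covering maps with trivial fibres -/

section Covering

variable {X V : Type} {H : SimpleGraph X} {G : SimpleGraph V} {Φ : X → V}

/-- A covering map is an isomorphism if its fibres over some vertices, from which all others can
be reached, are trivial. -/
theorem nonempty_iso_of_covering (hcov : ∀ h, G.neighborSet (Φ h) = Φ '' H.neighborSet h)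
    (hinj : ∀ h, Set.InjOn Φ (H.neighborSet h)) {E : Set X}
    (hE : ∀ a ∈ E, ∀ h, Φ h = Φ a → h = a) (hH : ∀ h, ∃ a ∈ E, ∃ n, h ∈ H.nhd {a} n)
    (hG : ∀ z, ∃ a ∈ E, ∃ n, z ∈ G.nhd {Φ a} n) : Nonempty (G ≃g H) := by
  have hfib : ∀ n, ∀ a ∈ E, ∀ h ∈ H.nhd {a} n, ∀ h', Φ h' = Φ h → h' = h := by
    intro n a ha
    induction n with
    | zero => rintro h rfl; exact hE h ha
    | succ n ih =>
      rintro h (hh | ⟨b, hb, hbh⟩) h' e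
      · exact ih h hh h' e
      -- Lift the edge back to the predecessor b at h'. The lift ends at b because the fibre of b is
      -- trivial, and then h and h' are neighbours of b with the same image.
      · have h1 : Φ b ∈ G.neighborSet (Φ h') := by
          rw [e, hcov]; exact ⟨b, hbh.symm, rfl⟩
        rw [hcov] at h1
        obtain ⟨b', hb', e'⟩ := h1
        obtain rfl := ih b hb b' e'
        exact hinj b' (Adj.symm hb') hbh e
  have hinj' : Function.Injective Φ := by
    intro h' h e
    obtain ⟨a, ha, n, hn⟩ := hH h
    exact hfib n a ha h hn h' e
  have hsurj : Function.Surjective Φ := by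
    intro z
    obtain ⟨a, -, n, hn⟩ := hG z
    induction n generalizing z with
    | zero => exact ⟨a, hn.symm⟩
    | succ n ih =>
      rcases hn with hn | ⟨y, hy, hyz⟩
      · exact ih z hn
      · obtain ⟨b, rfl⟩ := ih y hy
        have h1 : z ∈ G.neighborSet (Φ b) := hyz
        rw [hcov] at h1
        obtain ⟨h, -, rfl⟩ := h1
        exact ⟨h, rfl⟩
  refine ⟨RelIso.symm ⟨Equiv.ofBijective Φ ⟨hinj', hsurj⟩, ?_⟩⟩
  intro a b
  have := Set.ext_iff.1 (hcov a) (Φ b)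
  simp only [mem_neighborSet, Set.mem_image, hinj'.eq_iff, exists_eq_right] at this
  exact this

end Covering

/-! ### The decoded structure and its encoding -/

section Decode

variable {S V : Type} {d ℓ : ℕ}

/-- The structure that the graph `G` encodes. -/
def decode [Finite V] (e : S ≃ Fin ℓ) (d : ℕ) (G : SimpleGraph V) : FinStr S where
  carrier := {x : V // (G.neighborSet x).ncard = d}
  rel R x y := (∃ u u', ArrowAt e d G R x u y u') ∨ (x = y ∧ ∃ u, LoopAt e d G R x u)

variable [Finite V] {e : S ≃ Fin ℓ} {G : SimpleGraph V}

/-- The slot of `x` with first vertex `u` has the content `o`. -/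
def SlotHolds (e : S ≃ Fin ℓ) (d : ℕ) (G : SimpleGraph V) (x : (decode e d G).carrier) (u : V) :
    Option (S × (decode e d G).carrier × (decode e d G).carrier) → Prop
  | none => BlankAt e d G x.1 u
  | some (R, a, b) => (a = x ∧ b = x ∧ LoopAt e d G R x.1 u) ∨
      (a = x ∧ ∃ u', ArrowAt e d G R x.1 u b.1 u') ∨ (b = x ∧ ∃ u', ArrowAt e d G R a.1 u' x.1 u)

theorem IsDecodable.exists_slotHolds (hG : IsDecodable e d G) (x : (decode e d G).carrier) {u : V}
    (hu : G.Adj x.1 u) : ∃ o, SlotHolds e d G x u o := by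
  rcases hG.slot x.1 u x.2 hu with h | ⟨R, h⟩ | ⟨R, y, u', h⟩ | ⟨R, y, u', h⟩
  · exact ⟨none, h⟩
  · exact ⟨some (R, x, x), Or.inl ⟨rfl, rfl, h⟩⟩
  · exact ⟨some (R, x, ⟨y, h.ncard'⟩), Or.inr (Or.inl ⟨rfl, u', h⟩)⟩
  · exact ⟨some (R, ⟨y, h.ncard⟩, x), Or.inr (Or.inr ⟨rfl, u', h⟩)⟩

theorem SlotHolds.unique (hd : 2 ≤ d) (hℓ : 2 ≤ ℓ) {x : (decode e d G).carrier} {u : V}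
    {o o' : Option (S × (decode e d G).carrier × (decode e d G).carrier)}
    (h : SlotHolds e d G x u o) (h' : SlotHolds e d G x u o') : o = o' := by
  rcases o with - | ⟨R, a, b⟩ <;> rcases o' with - | ⟨R', a', b'⟩
  · rfl
  · rcases h' with ⟨rfl, rfl, h'⟩ | ⟨rfl, u', h'⟩ | ⟨rfl, u', h'⟩
    · exact absurd h' (BlankAt.not_loopAt hd hℓ h)
    · exact absurd h' (BlankAt.not_arrowAt hd hℓ h)
    · exact absurd h' (BlankAt.not_arrowAt' hd hℓ h)
  · rcases h with ⟨rfl, rfl, h⟩ | ⟨rfl, u', h⟩ | ⟨rfl, u', h⟩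
    · exact absurd h (BlankAt.not_loopAt hd hℓ h')
    · exact absurd h (BlankAt.not_arrowAt hd hℓ h')
    · exact absurd h (BlankAt.not_arrowAt' hd hℓ h')
  · rcases h with ⟨rfl, rfl, h⟩ | ⟨rfl, u, h⟩ | ⟨rfl, u, h⟩ <;>
      rcases h' with ⟨ha, hb, h'⟩ | ⟨ha, u', h'⟩ | ⟨ha, u', h'⟩
    · obtain rfl := h.unique hd hℓ h'
      rw [ha, hb]
    · exact absurd h' (h.not_arrowAt hd hℓ)
    · exact absurd h' (h.not_arrowAt' hd hℓ)
    · exact absurd h (h'.not_arrowAt hd hℓ)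
    · obtain ⟨rfl, h1, -⟩ := h.unique hd hℓ h'
      rw [ha, Subtype.ext h1]
    · exact absurd h' (h.not_reverse hd hℓ)
    · exact absurd h (h'.not_arrowAt' hd hℓ)
    · exact absurd h (h'.not_reverse hd hℓ)
    · obtain ⟨rfl, h1, -⟩ := h.unique' hd hℓ h'
      rw [ha, Subtype.ext h1]

/-- The slots of x are its d neighbours, in any order, each listed with the content it determines.
-/
theorem IsDecodable.exists_listing (hG : IsDecodable e d G) (hd : 2 ≤ d) (hℓ : 2 ≤ ℓ) :
    ∃ (nb : ∀ x : (decode e d G).carrier, Fin d ≃ G.neighborSet x.1)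
      (ans : (decode e d G).carrier → Fin d →
        Option (S × (decode e d G).carrier × (decode e d G).carrier)),
      (decode e d G).IsListing d ans ∧ ∀ x i, SlotHolds e d G x (nb x i).1 (ans x i) := by
  have hnb : ∀ x : (decode e d G).carrier, Nonempty (Fin d ≃ G.neighborSet x.1) := fun x =>
    ⟨(Finite.equivFinOfCardEq ((Nat.card_coe_set_eq _).trans x.2)).symm⟩
  obtain ⟨nb⟩ : Nonempty (∀ x : (decode e d G).carrier, Fin d ≃ G.neighborSet x.1) :=
    ⟨fun x => (hnb x).some⟩
  have hans : ∀ x i, ∃ o, SlotHolds e d G x (nb x i).1 o := fun x i =>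
    hG.exists_slotHolds x (nb x i).2
  choose ans hans using hans
  refine ⟨nb, ans, ⟨?_, ?_⟩, hans⟩
  · intro x i t ht
    obtain ⟨R, a, b⟩ := t
    have := hans x i
    rw [ht] at this
    rcases this with ⟨rfl, rfl, h⟩ | ⟨rfl, u', h⟩ | ⟨rfl, u', h⟩
    · exact ⟨Or.inr ⟨rfl, _, h⟩, Or.inl rfl⟩
    · exact ⟨Or.inl ⟨_, _, h⟩, Or.inl rfl⟩
    · exact ⟨Or.inl ⟨_, _, h⟩, Or.inr rfl⟩
  · rintro x ⟨R, a, b⟩ ⟨h, hx⟩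
    have huniq : ∀ i j, ans x i = some (R, a, b) → ans x j = some (R, a, b) → i = j := by
      intro i j hi hj
      have h1 := hans x i
      have h2 := hans x j
      rw [hi] at h1
      rw [hj] at h2
      refine (nb x).injective (Subtype.ext ?_)
      rcases h1 with ⟨ha, hb, h1⟩ | ⟨ha, u1, h1⟩ | ⟨ha, u1, h1⟩ <;>
        rcases h2 with ⟨ha', hb', h2⟩ | ⟨ha', u2, h2⟩ | ⟨ha', u2, h2⟩
      · exact hG.loop_unique _ _ _ _ h1 h2
      · exact absurd (by rw [hb]) h2.ne
      · exact absurd (by rw [ha]) h2.ne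
      · exact absurd (by rw [hb']) h1.ne
      · exact hG.arrow_unique _ _ _ _ _ _ _ h1 h2
      · exact absurd (by rw [ha']) h1.ne
      · exact absurd (by rw [ha']) h1.ne
      · exact absurd (by rw [ha]) h2.ne
      -- Uniqueness is known for the first vertex at the tail; from there the spine determines the
      -- first vertex at the head.
      · obtain rfl := hG.arrow_unique _ _ _ _ _ _ _ h1 h2
        exact (h1.unique hd hℓ h2).2.2
    suffices ∃ i, ans x i = some (R, a, b) by
      obtain ⟨i, hi⟩ := this
      exact ⟨i, hi, fun j hj => huniq j i hj hi⟩
    have key : ∀ u, G.Adj x.1 u → SlotHolds e d G x u (some (R, a, b)) →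
        ∃ i, ans x i = some (R, a, b) := by
      intro u hu hs
      refine ⟨(nb x).symm ⟨u, hu⟩, (hans x _).unique hd hℓ ?_⟩
      simpa using hs
    rcases h with ⟨u, u', h⟩ | ⟨hab, u, h⟩
    · rcases hx with hx | hx
      · simp only at hx h
        subst hx
        exact key u (h.adj (by omega)) (Or.inr (Or.inl ⟨rfl, u', h⟩))
      · simp only at hx h
        subst hx
        exact key u' (h.adj' (by omega)) (Or.inr (Or.inr ⟨rfl, u, h⟩))
    · simp only at hab h
      subst hab
      obtain rfl : a = x := by simpa using hx
      exact key u (h.adj (by omega)) (Or.inl ⟨rfl, rfl, h⟩)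

/-- The chosen copies of gadgets glue to a map Φ from the encoding to G. It is a covering because
gadgets are exact at their slot vertices and the slots of x run through the neighbours of x. -/
theorem IsDecodable.nonempty_iso (hG : IsDecodable e d G) (hd : 8 ≤ d) (hℓ : 2 ≤ ℓ) :
    ∃ ans, (decode e d G).IsListing d ans ∧
      Nonempty (G ≃g arrowGraph e (decode e d G) ans) := by
  classical
  obtain ⟨nb, ans, hL, hans⟩ := hG.exists_listing (by omega) hℓ
  refine ⟨ans, hL, ?_⟩
  have hm := hL.isMatched
  -- Total choice functions, with constant maps as dummies. For loops and arrows the copy is chosen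
  -- per tuple and not per slot, so that both slots of an arrow use the same copy.
  have hB : ∀ x u : V, ∃ g : ArrowVert Unit 1 ℓ → V, BlankAt e d G x u →
      IsGadget e d none G g ∧ g (el ()) = x ∧ ∀ k : Fin ℓ, k.val + 1 = ℓ → g (v () 0 k) = u := by
    intro x u
    by_cases h : BlankAt e d G x u
    · exact ⟨h.choose, fun _ => h.choose_spec⟩
    · exact ⟨fun _ => x, fun h' => absurd h' h⟩
  have hLo : ∀ (R : S) (x : V), ∃ g : ArrowVert Unit 1 ℓ → V, (∃ u, LoopAt e d G R x u) →
      ∃ u, IsGadget e d (some (R, (), ())) G g ∧ g (el ()) = x ∧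
        ∀ k : Fin ℓ, k.val + 1 = ℓ → g (v () 0 k) = u := by
    intro R x
    by_cases h : ∃ u, LoopAt e d G R x u
    · obtain ⟨u, g, hg⟩ := h
      exact ⟨g, fun _ => ⟨u, hg⟩⟩
    · exact ⟨fun _ => x, fun h' => absurd h' h⟩
  have hA : ∀ (R : S) (x y : V), ∃ g : ArrowVert Bool 1 ℓ → V,
      (∃ u u', ArrowAt e d G R x u y u') →
      ∃ u u', IsGadget e d (some (R, false, true)) G g ∧ g (el false) = x ∧ g (el true) = y ∧
        ∀ k : Fin ℓ, k.val + 1 = ℓ → g (v false 0 k) = u ∧ g (v true 0 k) = u' := by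
    intro R x y
    by_cases h : ∃ u u', ArrowAt e d G R x u y u'
    · obtain ⟨u, u', g, hg⟩ := h
      exact ⟨g, fun _ => ⟨u, u', hg⟩⟩
    · exact ⟨fun _ => x, fun h' => absurd h' h⟩
  choose gB hB using hB
  choose gL hLo using hLo
  choose gA hA using hA
  have hB' : ∀ x i, ans x i = none → IsGadget e d none G (gB x.1 (nb x i).1) ∧
      gB x.1 (nb x i).1 (el ()) = x.1 ∧
      ∀ k : Fin ℓ, k.val + 1 = ℓ → gB x.1 (nb x i).1 (v () 0 k) = (nb x i).1 := by
    intro x i h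
    have := hans x i
    rw [h] at this
    exact hB _ _ this
  have hL' : ∀ R x i, ans x i = some (R, x, x) → IsGadget e d (some (R, (), ())) G (gL R x.1) ∧
      gL R x.1 (el ()) = x.1 ∧
      ∀ k : Fin ℓ, k.val + 1 = ℓ → gL R x.1 (v () 0 k) = (nb x i).1 := by
    intro R x i h
    have := hans x i
    rw [h] at this
    have hl : LoopAt e d G R x.1 (nb x i).1 := by
      rcases this with ⟨-, -, h⟩ | ⟨-, u', h⟩ | ⟨-, u', h⟩
      · exact h
      · exact absurd rfl h.ne
      · exact absurd rfl h.ne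
    obtain ⟨u, h1, h2, h3⟩ := hLo R x.1 ⟨_, hl⟩
    obtain rfl := hG.loop_unique _ _ _ _ hl ⟨_, h1, h2, h3⟩
    exact ⟨h1, h2, h3⟩
  have hA' : ∀ R x y i j, x ≠ y → ans x i = some (R, x, y) → ans y j = some (R, x, y) →
      IsGadget e d (some (R, false, true)) G (gA R x.1 y.1) ∧
      gA R x.1 y.1 (el false) = x.1 ∧ gA R x.1 y.1 (el true) = y.1 ∧
      ∀ k : Fin ℓ, k.val + 1 = ℓ → gA R x.1 y.1 (v false 0 k) = (nb x i).1 ∧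
        gA R x.1 y.1 (v true 0 k) = (nb y j).1 := by
    intro R x y i j hxy h h'
    have hs := hans x i
    have hs' := hans y j
    rw [h] at hs
    rw [h'] at hs'
    obtain ⟨t, ha⟩ : ∃ u', ArrowAt e d G R x.1 (nb x i).1 y.1 u' := by
      rcases hs with ⟨-, h, -⟩ | ⟨-, h⟩ | ⟨h, -⟩
      · exact absurd h.symm hxy
      · exact h
      · exact absurd h.symm hxy
    obtain ⟨t', ha'⟩ : ∃ u', ArrowAt e d G R x.1 u' y.1 (nb y j).1 := by
      rcases hs' with ⟨h, -, -⟩ | ⟨h, -⟩ | ⟨-, h⟩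
      · exact absurd h hxy
      · exact absurd h hxy
      · exact h
    obtain ⟨u, u', h1, h2, h3, h4⟩ := hA R x.1 y.1 ⟨_, _, ha⟩
    have h5 : ArrowAt e d G R x.1 u y.1 u' := ⟨_, h1, h2, h3, h4⟩
    obtain rfl := hG.arrow_unique _ _ _ _ _ _ _ ha h5
    obtain rfl := hG.arrow_unique _ _ _ _ _ _ _ ha' h5
    obtain ⟨-, -, rfl⟩ := ha'.unique (by omega) hℓ h5
    exact ⟨h1, h2, h3, h4⟩
  -- The argument p names a vertex of a slot uniformly in the index type of the gadget, which
  -- depends on the content of the slot. The test x = b selects the head side of an arrow.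
  let Ψ : (x : (decode e d G).carrier) → (i : Fin d) → (∀ {ι : Type}, ι → ArrowVert ι 1 ℓ) → V :=
    fun x i p => match ans x i with
      | none => gB x.1 (nb x i).1 (p ())
      | some (R, a, b) => if a = b then gL R a.1 (p ()) else gA R a.1 b.1 (p (decide (x = b)))
  let Φ : ArrowVert (decode e d G).carrier d ℓ → V := fun h => match h with
    | el x => x.1
    | v x i k => Ψ x i fun s => v s 0 k
    | w x i => Ψ x i fun s => w s 0
  have hΨB : ∀ x i p, ans x i = none → Ψ x i p = gB x.1 (nb x i).1 (p ()) := by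
    intro x i p h
    simp only [Ψ, h]
  have hΨL : ∀ R x i p, ans x i = some (R, x, x) → Ψ x i p = gL R x.1 (p ()) := by
    intro R x i p h
    simp only [Ψ, h, if_true]
  have hΨA : ∀ R x y i j p, x ≠ y → ans x i = some (R, x, y) → ans y j = some (R, x, y) →
      Ψ x i p = gA R x.1 y.1 (p false) ∧ Ψ y j p = gA R x.1 y.1 (p true) := by
    intro R x y i j p hxy h h'
    simp [Ψ, h, h', hxy]
  have hΦB : ∀ x i, ans x i = none → Φ ∘ relabel (fun _ : Unit => x) (fun _ => i) =
      gB x.1 (nb x i).1 := by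
    intro x i h
    funext y
    cases y with
    | el s => exact (hB' x i h).2.1.symm
    | v s j k => obtain rfl := Subsingleton.elim j 0; exact hΨB x i (fun s => v s 0 k) h
    | w s j => obtain rfl := Subsingleton.elim j 0; exact hΨB x i (fun s => w s 0) h
  have hΦL : ∀ R x i, ans x i = some (R, x, x) →
      Φ ∘ relabel (fun _ : Unit => x) (fun _ => i) = gL R x.1 := by
    intro R x i h
    funext y
    cases y with
    | el s => exact (hL' R x i h).2.1.symm
    | v s j k => obtain rfl := Subsingleton.elim j 0; exact hΨL R x i (fun s => v s 0 k) h
    | w s j => obtain rfl := Subsingleton.elim j 0; exact hΨL R x i (fun s => w s 0) h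
  have hΦA : ∀ R x y i j, x ≠ y → ans x i = some (R, x, y) → ans y j = some (R, x, y) →
      Φ ∘ relabel (fun s : Bool => cond s y x) (fun s => cond s j i) = gA R x.1 y.1 := by
    intro R x y i j hxy h h'
    funext z
    cases z with
    | el s =>
      cases s
      · exact (hA' R x y i j hxy h h').2.1.symm
      · exact (hA' R x y i j hxy h h').2.2.1.symm
    | v s t k =>
      obtain rfl := Subsingleton.elim t 0
      cases s
      · exact (hΨA R x y i j (fun s => v s 0 k) hxy h h').1
      · exact (hΨA R x y i j (fun s => v s 0 k) hxy h h').2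
    | w s t =>
      obtain rfl := Subsingleton.elim t 0
      cases s
      · exact (hΨA R x y i j (fun s => w s 0) hxy h h').1
      · exact (hΨA R x y i j (fun s => w s 0) hxy h h').2
  have hlast : ∀ x i (k : Fin ℓ), k.val + 1 = ℓ → Φ (v x i k) = (nb x i).1 := by
    intro x i k hk
    have h1 := hans x i
    cases ho : ans x i with
    | none => exact (hΨB x i (fun s => v s 0 k) ho).trans ((hB' x i ho).2.2 k hk)
    | some t =>
      obtain ⟨R, a, b⟩ := t
      by_cases hab : a = b
      · obtain rfl : x = a := by
          rcases hm.mem _ _ _ _ _ ho with h | h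
          · exact h
          · exact h.trans hab.symm
        subst hab
        exact (hΨL R x i (fun s => v s 0 k) ho).trans ((hL' R x i ho).2.2 k hk)
      · rcases hm.mem _ _ _ _ _ ho with rfl | rfl
        · obtain ⟨j, hj⟩ := hm.right _ _ _ _ _ ho
          exact (hΨA R x b i j (fun s => v s 0 k) hab ho hj).1.trans ((hA' R x b i j hab ho hj).2.2.2 k hk).1
        · obtain ⟨j, hj⟩ := hm.left _ _ _ _ _ ho
          exact (hΨA R a x j i (fun s => v s 0 k) hab hj ho).2.trans ((hA' R a x j i hab hj ho).2.2.2 k hk).2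
  -- The maps ρ and Φ ∘ ρ are exact copies of one gadget, so Φ is bijective between the
  -- neighbourhoods at its slot vertices.
  have hexact : ∀ {ι : Type} [Finite ι] {o : Option (S × ι × ι)}
      {ρ : ArrowVert ι 1 ℓ → ArrowVert (decode e d G).carrier d ℓ},
      IsGadget e d o (arrowGraph e (decode e d G) ans) ρ → IsGadget e d o G (Φ ∘ ρ) →
      ∀ h ∈ slotVerts ι 1 ℓ, G.neighborSet (Φ (ρ h)) =
        Φ '' (arrowGraph e (decode e d G) ans).neighborSet (ρ h) ∧
        Set.InjOn Φ ((arrowGraph e (decode e d G) ans).neighborSet (ρ h)) := by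
    intro ι _ o ρ h1 h2 h hh
    constructor
    · rw [h1.nbr h hh, Set.image_image]
      exact h2.nbr h hh
    · rw [h1.nbr h hh]
      rintro _ ⟨a, -, rfl⟩ _ ⟨b, -, rfl⟩ hab
      rw [h2.inj hab]
  have hslot := slotVerts_induction (ℓ := ℓ) hm (P := fun h => (G.neighborSet (Φ h) =
        Φ '' (arrowGraph e (decode e d G) ans).neighborSet h ∧
        Set.InjOn Φ ((arrowGraph e (decode e d G) ans).neighborSet h)) ∧
        ∃ a, h ∈ (arrowGraph e (decode e d G) ans).nhd {el a} (2 * ℓ + 1))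
    (fun x i h h₀ hh => ⟨hexact (isGadget_blank hm (by omega) h)
      (by rw [hΦB x i h]; exact (hB' x i h).1) h₀ hh, x,
        (isGadget_blank hm (by omega) h).mem_nhd isShape_blank hℓ () h₀⟩)
    (fun R x i h h₀ hh => ⟨hexact (isGadget_loop hm (by omega) h)
      (by rw [hΦL R x i h]; exact (hL' R x i h).1) h₀ hh, x,
        (isGadget_loop hm (by omega) h).mem_nhd (isShape_loop R) hℓ () h₀⟩)
    (fun R x y i j hxy h h' h₀ hh => ⟨hexact (isGadget_arrow hm (by omega) hxy h h')
      (by rw [hΦA R x y i j hxy h h']; exact (hA' R x y i j hxy h h').1) h₀ hh, x,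
        (isGadget_arrow hm (by omega) hxy h h').mem_nhd (isShape_arrow R) hℓ false h₀⟩)
  have hel : ∀ h : ArrowVert (decode e d G).carrier d ℓ,
      h ∈ slotVerts (decode e d G).carrier d ℓ ∨ ∃ a, h = el a := by
    intro h
    by_cases hh : h ∈ slotVerts (decode e d G).carrier d ℓ
    · exact Or.inl hh
    · simp only [slotVerts, Set.mem_ofPred_eq, not_forall, not_not] at hh
      exact Or.inr hh
  have hk : (⟨ℓ - 1, by omega⟩ : Fin ℓ).val + 1 = ℓ := by simp; omega
  refine nonempty_iso_of_covering (Φ := Φ) (E := Set.range el) ?_ ?_ ?_ ?_ ?_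
  · intro h
    rcases hel h with hh | ⟨x, rfl⟩
    · exact (hslot h hh).1.1
    · rw [neighborSet_el (by omega), ← Set.range_comp]
      ext u
      constructor
      · intro hu
        exact ⟨(nb x).symm ⟨u, hu⟩, by simp [hlast _ _ _ hk]⟩
      · rintro ⟨i, rfl⟩
        simp only [Function.comp_apply, hlast _ _ _ hk]
        exact (nb x i).2
  · intro h
    rcases hel h with hh | ⟨x, rfl⟩
    · exact (hslot h hh).1.2
    · rw [neighborSet_el (by omega)]
      rintro _ ⟨i, rfl⟩ _ ⟨j, rfl⟩ hij
      simp only [hlast _ _ _ hk] at hij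
      rw [(nb x).injective (Subtype.ext hij)]
  · rintro _ ⟨x, rfl⟩ h he
    rcases hel h with hh | ⟨y, rfl⟩
    · exfalso
      -- Φ preserves the degree of h, which is at most 7, whereas the element x has degree d ≥ 8.
      have h1 := ncard_neighborSet_inner (e := e) hm h hh
      have h2 := (hslot h hh).1.1
      have h3 : (G.neighborSet (Φ h)).ncard = d := by rw [he]; exact x.2
      rw [h2, (hslot h hh).1.2.ncard_image] at h3
      omega
    · rw [Subtype.ext he]
  · intro h
    rcases hel h with hh | ⟨x, rfl⟩
    · obtain ⟨a, ha⟩ := (hslot h hh).2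
      exact ⟨_, ⟨a, rfl⟩, _, ha⟩
    · exact ⟨_, ⟨x, rfl⟩, 0, rfl⟩
  · intro z
    obtain ⟨x, n, hx, hz⟩ := hG.covered z
    exact ⟨_, ⟨⟨x, hx⟩, rfl⟩, n, hz⟩

end Decode

/-! Local similarity of structures -/

theorem FinStr.IsListing.degree_le {S : Type} {A : FinStr S} {d : ℕ}
    {ans : A.carrier → Fin d → Option (S × A.carrier × A.carrier)} (h : A.IsListing d ans)
    (a : A.carrier) : A.degree a ≤ d := by
  have h1 : some '' A.tuplesAt a ⊆ Set.range (ans a) := by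
    rintro _ ⟨t, ht, rfl⟩
    exact (h.complete a t ht).exists
  have h2 := Set.ncard_le_ncard h1 (Set.finite_range _)
  rw [Set.ncard_image_of_injective _ (Option.some_injective _), ← Set.image_univ] at h2
  refine (h2.trans (Set.ncard_image_le Set.finite_univ)).trans ?_
  simp [Set.ncard_univ]

theorem sixteen_le_card_idx2 {D : ℕ} (hD : 2 ≤ D) : 16 ≤ Fintype.card (Idx2 D) := by
  simp only [Fintype.card_prod, Fintype.card_fin]
  have : 2 * 2 ≤ D * D := Nat.mul_le_mul hD hD
  exact Nat.mul_le_mul this this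

theorem sixteen_le_of_equiv {D ℓ : ℕ} (hD : 2 ≤ D) (e : ZSym D ≃ Fin ℓ) : 16 ≤ ℓ := by
  have h : Function.Injective fun k : Idx2 D => e (ZSym.L k) := by
    intro k k' h
    simpa using h
  have := Fintype.card_le_of_injective _ h
  rw [Fintype.card_fin] at this
  exact (sixteen_le_card_idx2 hD).trans this

/-- An element carries either a loop of every relation L_k or an outgoing edge of every relation
F_k, and |K| = D⁴ ≥ 16. -/
theorem ZigZag.sixteen_le_of_listing {D d : ℕ} (hD : 2 ≤ D) {A : FinStr (ZSym D)}
    (hA : ZigZag.TreeRelaxed A) {ans : A.carrier → Fin d → Option (ZSym D × A.carrier × A.carrier)}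
    (h : A.IsListing d ans) (a : A.carrier) : 16 ≤ d := by
  have key : ∀ t : Idx2 D → ZSym D × A.carrier × A.carrier, Function.Injective t →
      (∀ k, t k ∈ A.tuplesAt a) → 16 ≤ d := by
    intro t ht hta
    have : ∀ k, ∃ i, ans a i = some (t k) := fun k => (h.complete a _ (hta k)).exists
    choose i hi using this
    have hinj : Function.Injective i := by
      intro k k' hk
      have h1 := hi k
      rw [hk, hi k'] at h1
      exact (ht (Option.some_injective _ h1)).symm
    have := Fintype.card_le_of_injective _ hinj
    rw [Fintype.card_fin] at this
    exact (sixteen_le_card_idx2 hD).trans this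
  rcases hA.2.2 a with ⟨-, h1, -⟩ | ⟨-, h1⟩
  · exact key (fun k => (ZSym.L k, a, a)) (fun k k' hk => by simpa using hk)
      fun k => ⟨h1 k, Or.inl rfl⟩
  · choose y hy using h1
    exact key (fun k => (ZSym.F k, a, y k)) (fun k k' hk => by
      simp only [Prod.mk.injEq, ZSym.F.injEq] at hk; exact hk.1)
      fun k => ⟨(hy k).2.1, Or.inl rfl⟩

/-- The map `φ` matches the tuples of `A` near `U 0` with the tuples of `B`; the elements that
are joined to elements of `U n` by tuples are in `U (n + 1)`. -/
structure FinStr.IsLocalSim {S : Type} (A B : FinStr S) (U : ℕ → Set A.carrier)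
    (φ : A.carrier → B.carrier) : Prop where
  mono : ∀ n, U n ⊆ U (n + 1)
  injOn : Set.InjOn φ (U 4)
  out : ∀ n < 4, ∀ x ∈ U n, ∀ R y, A.rel R x y → y ∈ U (n + 1) ∧ B.rel R (φ x) (φ y)
  inc : ∀ n < 4, ∀ x ∈ U n, ∀ R y, A.rel R y x → y ∈ U (n + 1) ∧ B.rel R (φ y) (φ x)
  lift_out : ∀ n < 4, ∀ x ∈ U n, ∀ R b, B.rel R (φ x) b → ∃ y, A.rel R x y ∧ φ y = b
  lift_inc : ∀ n < 4, ∀ x ∈ U n, ∀ R b, B.rel R b (φ x) → ∃ y, A.rel R y x ∧ φ y = b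

namespace FinStr.IsLocalSim

variable {S : Type} {A B : FinStr S} {U : ℕ → Set A.carrier} {φ : A.carrier → B.carrier}

theorem le (h : A.IsLocalSim B U φ) {m n : ℕ} (hmn : m ≤ n) : U m ⊆ U n := by
  induction hmn with
  | refl => exact subset_rfl
  | step _ ih => exact ih.trans (h.mono _)

/-- Lift the tuple of B at φ x; its other end has the same image as y and is equal to y by
injectivity. -/
theorem rel_iff (h : A.IsLocalSim B U φ) {n m : ℕ} (hn : n < 4) (hm : m ≤ 4) {x y : A.carrier}
    (hx : x ∈ U n) (hy : y ∈ U m) (R : S) : A.rel R x y ↔ B.rel R (φ x) (φ y) := by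
  refine ⟨fun hr => (h.out n hn x hx R y hr).2, fun hr => ?_⟩
  obtain ⟨z, hz, he⟩ := h.lift_out n hn x hx R _ hr
  obtain rfl := h.injOn (h.le (by omega) (h.out n hn x hx R z hz).1) (h.le hm hy) he
  exact hz

end FinStr.IsLocalSim

namespace ZigZag

open FinStr

variable {D : ℕ} {A B : FinStr (ZSym D)} {U : ℕ → Set A.carrier} {φ : A.carrier → B.carrier}

theorem root_iff (h : A.IsLocalSim B U φ) {n : ℕ} (hn : n < 4) {x : A.carrier} (hx : x ∈ U n) :
    Root A x ↔ Root B (φ x) := by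
  constructor
  · rintro hr b ⟨k, hk⟩
    obtain ⟨y, hy, -⟩ := h.lift_inc n hn x hx _ b hk
    exact hr y ⟨k, hy⟩
  · rintro hr y ⟨k, hk⟩
    exact hr (φ y) ⟨k, (h.inc n hn x hx _ y hk).2⟩

theorem exists_fany_iff (h : A.IsLocalSim B U φ) {n : ℕ} (hn : n < 4) {x : A.carrier}
    (hx : x ∈ U n) : (∃ y, Fany A x y) ↔ ∃ b, Fany B (φ x) b := by
  constructor
  · rintro ⟨y, k, hk⟩
    exact ⟨φ y, k, (h.out n hn x hx _ y hk).2⟩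
  · rintro ⟨b, k, hk⟩
    obtain ⟨y, hy, -⟩ := h.lift_out n hn x hx _ b hk
    exact ⟨y, k, hy⟩

/-- Uniqueness of the root is the only axiom that needs two independent elements in one similarity.
-/
theorem treeRelaxed_of_local
    (hA : ∀ x y : A.carrier, ∃ (B : FinStr (ZSym D)) (U : ℕ → Set A.carrier)
      (φ : A.carrier → B.carrier), TreeRelaxed B ∧ A.IsLocalSim B U φ ∧ x ∈ U 0 ∧ y ∈ U 0) :
    TreeRelaxed A := by
  refine ⟨fun x y hx hy => ?_, fun x => ?_, fun x => ?_⟩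
  · obtain ⟨B, U, φ, hB, h, hxU, hyU⟩ := hA x y
    exact h.injOn (h.le (by omega) hxU) (h.le (by omega) hyU)
      (hB.1 _ _ ((root_iff h (by omega) hxU).1 hx) ((root_iff h (by omega) hyU).1 hy))
  · obtain ⟨B, U, φ, hB, h, hxU, -⟩ := hA x x
    have h0 : 0 < 4 := by omega
    rcases hB.2.1 (φ x) with ⟨h1, h2⟩ | ⟨⟨b, ⟨k, hb⟩, hu⟩, h1, h2⟩
    · exact Or.inl ⟨(root_iff h h0 hxU).2 h1, (h.rel_iff h0 (by omega) hxU hxU _).2 h2⟩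
    · right
      refine ⟨?_, ?_, ?_⟩
      · obtain ⟨y, hy, rfl⟩ := h.lift_inc 0 h0 x hxU _ b hb
        refine ⟨y, ⟨k, hy⟩, ?_⟩
        rintro z ⟨k', hz⟩
        exact h.injOn (h.le (by omega) (h.inc 0 h0 x hxU _ z hz).1)
          (h.le (by omega) (h.inc 0 h0 x hxU _ y hy).1) (hu _ ⟨k', (h.inc 0 h0 x hxU _ z hz).2⟩)
      · rintro ⟨y, hy⟩
        exact h1 ⟨_, (h.out 0 h0 x hxU _ y hy).2⟩
      · rintro ⟨y, hy⟩
        exact h2 ⟨_, (h.inc 0 h0 x hxU _ y hy).2⟩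
  · obtain ⟨B, U, φ, hB, h, hxU, -⟩ := hA x x
    have h0 : 0 < 4 := by omega
    have hx4 := h.le (show 0 ≤ 4 by omega) hxU
    rcases hB.2.2 (φ x) with ⟨h1, h2, h3⟩ | ⟨h1, h2⟩
    · left
      refine ⟨fun hc => h1 ((exists_fany_iff h h0 hxU).1 hc),
        fun k => (h.rel_iff h0 (by omega) hxU hxU _).2 (h2 k), fun y hyx => ⟨fun k hk => ?_, fun k hk => ?_⟩⟩
      · obtain ⟨hy, hr⟩ := h.out 0 h0 x hxU _ y hk
        exact (h3 (φ y) fun he => hyx (h.injOn (h.le (by omega) hy) hx4 he)).1 k hr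
      · obtain ⟨hy, hr⟩ := h.inc 0 h0 x hxU _ y hk
        exact (h3 (φ y) fun he => hyx (h.injOn (h.le (by omega) hy) hx4 he)).2 k hr
    · right
      refine ⟨?_, fun k => ?_⟩
      · rintro ⟨y, k, hk | hk⟩
        · exact h1 ⟨_, k, Or.inl (h.out 0 h0 x hxU _ y hk).2⟩
        · exact h1 ⟨_, k, Or.inr (h.inc 0 h0 x hxU _ y hk).2⟩
      · obtain ⟨b, hb, hF, h3, h4⟩ := h2 k
        obtain ⟨y, hy, rfl⟩ := h.lift_out 0 h0 x hxU _ b hF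
        have hyU := h.le (show 1 ≤ 4 by omega) (h.out 0 h0 x hxU _ y hy).1
        refine ⟨y, fun he => hb (by rw [he]), hy, fun k' hk' hc => ?_, fun y' hy' hc => ?_⟩
        · exact h3 k' hk' (h.out 0 h0 x hxU _ y hc).2
        · obtain ⟨hy'U, hr⟩ := h.out 0 h0 x hxU _ y' hc
          exact h4 (φ y') (fun he => hy' (h.injOn (h.le (by omega) hy'U) hyU he)) hr

theorem rotationMap_of_local
    (hA : ∀ x : A.carrier, ∃ (B : FinStr (ZSym D)) (U : ℕ → Set A.carrier)
      (φ : A.carrier → B.carrier), RotationMap B ∧ A.IsLocalSim B U φ ∧ x ∈ U 0) :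
    RotationMap A := by
  refine ⟨fun x y i j hxy => ?_, fun x i => ?_⟩
  · obtain ⟨B, U, φ, hB, h, hxU⟩ := hA x
    obtain ⟨hyU, hr⟩ := h.out 0 (by omega) x hxU _ y hxy
    exact (h.rel_iff (by omega) (by omega) hyU hxU _).2 (hB.1 _ _ _ _ hr)
  · obtain ⟨B, U, φ, hB, h, hxU⟩ := hA x
    have h0 : 0 < 4 := by omega
    obtain ⟨j, ⟨b, hb, hu⟩, hj⟩ := hB.2 (φ x) i
    obtain ⟨y, hy, rfl⟩ := h.lift_out 0 h0 x hxU _ b hb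
    refine ⟨j, ⟨y, hy, fun z hz => ?_⟩, fun j' hj' => ?_⟩
    · obtain ⟨hzU, hr⟩ := h.out 0 h0 x hxU _ z hz
      exact h.injOn (h.le (by omega) hzU) (h.le (by omega) (h.out 0 h0 x hxU _ y hy).1) (hu _ hr)
    · rintro ⟨z, hz⟩
      exact hj j' hj' ⟨_, (h.out 0 h0 x hxU _ z hz).2⟩

variable {rot : Idx2 D × Fin D → Idx2 D × Fin D}

theorem base_of_local
    (hA : ∀ x : A.carrier, ∃ (B : FinStr (ZSym D)) (U : ℕ → Set A.carrier)
      (φ : A.carrier → B.carrier), Base rot B ∧ A.IsLocalSim B U φ ∧ x ∈ U 0) :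
    Base rot A := by
  intro x hx
  obtain ⟨B, U, φ, hB, h, hxU⟩ := hA x
  have h0 : 0 < 4 := by omega
  have hx4 := h.le (show 0 ≤ 4 by omega) hxU
  obtain ⟨⟨h1, h2⟩, h3⟩ := hB (φ x) ((root_iff h h0 hxU).1 hx)
  refine ⟨⟨fun i => (h.rel_iff h0 (by omega) hxU hxU _).2 (h1 i), fun i j y hxy =>
    ⟨fun hc => ?_, fun hc => ?_⟩⟩, fun k k' i i' hk => ?_⟩
  · obtain ⟨hy, hr⟩ := h.out 0 h0 x hxU _ y hc
    exact (h2 i j (φ y) fun he => hxy (h.injOn hx4 (h.le (by omega) hy) he)).1 hr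
  · obtain ⟨hy, hr⟩ := h.inc 0 h0 x hxU _ y hc
    exact (h2 i j (φ y) fun he => hxy (h.injOn hx4 (h.le (by omega) hy) he)).2 hr
  · obtain ⟨b, b', hb, hb', hE⟩ := h3 k k' i i' hk
    obtain ⟨y, hy, rfl⟩ := h.lift_out 0 h0 x hxU _ b hb
    obtain ⟨y', hy', rfl⟩ := h.lift_out 0 h0 x hxU _ b' hb'
    exact ⟨y, y', hy, hy', (h.rel_iff (n := 1) (m := 1) (by omega) (by omega)
      (h.out 0 h0 x hxU _ y hy).1 (h.out 0 h0 x hxU _ y' hy').1 _).2 hE⟩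

theorem recursion_of_local
    (hA : ∀ x : A.carrier, ∃ (B : FinStr (ZSym D)) (U : ℕ → Set A.carrier)
      (φ : A.carrier → B.carrier), Recursion rot B ∧ A.IsLocalSim B U φ ∧ x ∈ U 0) :
    Recursion rot A := by
  intro x z
  obtain ⟨B, U, φ, hB, h, hxU⟩ := hA x
  have h0 : 0 < 4 := by omega
  by_cases hroot : Root A x
  · exact Or.inl hroot
  by_cases hF : (¬ ∃ y, Fany A x y) ∧ ¬ ∃ y, Fany A z y
  · exact Or.inr (Or.inl hF)
  refine Or.inr (Or.inr ?_)
  rintro k₁ k₂ l₁ l₂ ⟨y, hxy, hyz⟩ i j i' j' k l hk hl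
  obtain ⟨hyU, hxy'⟩ := h.out 0 h0 x hxU _ y hxy
  obtain ⟨hzU, hyz'⟩ := h.out 1 (by omega) y hyU _ z hyz
  rcases hB (φ x) (φ z) with h1 | ⟨h1, h2⟩ | h1
  · exact absurd ((root_iff h h0 hxU).2 h1) hroot
  · rw [← exists_fany_iff h h0 hxU] at h1
    rw [← exists_fany_iff h (by omega) hzU] at h2
    exact absurd ⟨h1, h2⟩ hF
  · obtain ⟨b, b', hb, hb', hE⟩ := h1 k₁ k₂ l₁ l₂ ⟨_, hxy', hyz'⟩ i j i' j' k l hk hl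
    obtain ⟨x', hx', rfl⟩ := h.lift_out 0 h0 x hxU _ b hb
    obtain ⟨z', hz', rfl⟩ := h.lift_out 2 (by omega) z hzU _ b' hb'
    -- The largest depth that occurs: x, y, z, z' lie in levels 0, 1, 2, 3.
    exact ⟨x', z', hx', hz', (h.rel_iff (n := 1) (m := 3) (by omega) (by omega)
      (h.out 0 h0 x hxU _ x' hx').1 (h.out 2 (by omega) z hzU _ z' hz').1 _).2 hE⟩

end ZigZag

/-- A tuple spans at most 2ℓ + 1 edges, so level n consists of the elements within n (2ℓ + 1) of T.
Tuples of `decode` map to gadgets in the encoding of B, hence to tuples of B; conversely, the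
gadgets of tuples of B lift. -/
theorem exists_isLocalSim {S V : Type} [Finite V] {d ℓ : ℕ} {e : S ≃ Fin ℓ} {G : SimpleGraph V}
    (hd : 8 ≤ d) (hℓ : 2 ≤ ℓ) {B : FinStr S}
    {ans : B.carrier → Fin d → Option (S × B.carrier × B.carrier)} (hL : B.IsListing d ans)
    {f : V → ArrowVert B.carrier d ℓ} {T : Set V} {r : ℕ} (hr : 5 * (2 * ℓ + 1) < r)
    (hf : IsLocalEmb G (arrowGraph e B ans) (G.nhd T r) f) (b₀ : B.carrier) :
    ∃ U φ, (decode e d G).IsLocalSim B U φ ∧ ∀ x : (decode e d G).carrier, x.1 ∈ T → x ∈ U 0 := by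
  classical
  have hm := hL.isMatched
  let U : ℕ → Set (decode e d G).carrier := fun n => {x | x.1 ∈ G.nhd T (n * (2 * ℓ + 1))}
  have hel : ∀ n ≤ 4, ∀ x ∈ U n, ∃ a, f x.1 = el a := by
    intro n hn x hx
    have hn' : n * (2 * ℓ + 1) ≤ 4 * (2 * ℓ + 1) := Nat.mul_le_mul_right _ hn
    exact eq_el_of_ncard hm hd ((hf.ncard_nhd (by omega) hx).trans x.2)
  -- The value b₀ is used only where f does not yield an element, which does not happen up to level
  -- 4.
  let φ : (decode e d G).carrier → B.carrier := fun x =>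
    if h : ∃ a, f x.1 = el a then h.choose else b₀
  have hφ : ∀ n ≤ 4, ∀ x ∈ U n, f x.1 = el (φ x) := by
    intro n hn x hx
    have h := hel n hn x hx
    simp only [φ, dif_pos h]
    exact h.choose_spec
  have hstep : ∀ n, n * (2 * ℓ + 1) + (2 * ℓ + 1) = (n + 1) * (2 * ℓ + 1) := fun n => by ring
  have hlt : ∀ n < 4, n * (2 * ℓ + 1) + (2 * ℓ + 1) < r := by
    intro n hn
    have : n * (2 * ℓ + 1) ≤ 3 * (2 * ℓ + 1) := Nat.mul_le_mul_right _ (by omega)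
    omega
  have hrel : ∀ n < 4, ∀ x y : (decode e d G).carrier, (x ∈ U n ∨ y ∈ U n) → ∀ R,
      (decode e d G).rel R x y → (x ∈ U (n + 1) ∧ y ∈ U (n + 1)) ∧ B.rel R (φ x) (φ y) := by
    rintro n hn x y hxy R (⟨u, u', h⟩ | ⟨rfl, u, h⟩)
    · have hmem : x ∈ U (n + 1) ∧ y ∈ U (n + 1) := by
        simp only [U, Set.mem_ofPred_eq, ← hstep] at hxy ⊢
        rcases hxy with hxy | hxy
        · exact ⟨nhd_mono (by omega) hxy, h.mem_nhd hℓ hxy⟩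
        · exact ⟨h.mem_nhd' hℓ hxy, nhd_mono (by omega) hxy⟩
      refine ⟨hmem, ?_⟩
      have h' := h.map hℓ hf hxy (hlt n hn)
      rw [hφ (n + 1) (by omega) x hmem.1, hφ (n + 1) (by omega) y hmem.2] at h'
      obtain ⟨i, hi, -⟩ := h'.exists_ans hm (by omega) hℓ
      exact (hL.sound _ _ _ hi).1
    · have hx : x ∈ U n := by simpa using hxy
      have hmem : x ∈ U (n + 1) := by
        simp only [U, Set.mem_ofPred_eq, ← hstep] at hx ⊢
        exact nhd_mono (by omega) hx
      refine ⟨⟨hmem, hmem⟩, ?_⟩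
      have h' := h.map hℓ hf hx (hlt n hn)
      rw [hφ (n + 1) (by omega) x hmem] at h'
      obtain ⟨i, hi, -⟩ := h'.exists_ans hm (by omega) hℓ
      exact (hL.sound _ _ _ hi).1
  have hk : ∀ k : Fin ℓ, k.val + 1 = ℓ → k = ⟨ℓ - 1, by omega⟩ := by
    intro k hk
    ext
    simp
    omega
  have hloop : ∀ n < 4, ∀ x ∈ U n, ∀ R, B.rel R (φ x) (φ x) → (decode e d G).rel R x x := by
    intro n hn x hx R h
    obtain ⟨i, hi⟩ := (hL.complete (φ x) (R, φ x, φ x) ⟨h, Or.inl rfl⟩).exists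
    have h' : LoopAt e d (arrowGraph e B ans) R (f x.1) (v (φ x) i ⟨ℓ - 1, by omega⟩) :=
      ⟨_, isGadget_loop hm (by omega) hi, (hφ n (by omega) x hx).symm,
        fun k hk' => by rw [hk k hk']; rfl⟩
    obtain ⟨u, h'', -⟩ := h'.lift hℓ hf hx (hlt n hn)
    exact Or.inr ⟨rfl, u, h''⟩
  have harrow : ∀ R a b, a ≠ b → B.rel R a b →
      ∃ u u', ArrowAt e d (arrowGraph e B ans) R (el a) u (el b) u' := by
    intro R a b hab h
    obtain ⟨i, hi⟩ := (hL.complete a (R, a, b) ⟨h, Or.inl rfl⟩).exists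
    obtain ⟨j, hj⟩ := (hL.complete b (R, a, b) ⟨h, Or.inr rfl⟩).exists
    exact ⟨v a i ⟨ℓ - 1, by omega⟩, v b j ⟨ℓ - 1, by omega⟩, _,
      isGadget_arrow hm (by omega) hab hi hj, rfl, rfl, fun k hk' => by rw [hk k hk']; exact ⟨rfl, rfl⟩⟩
  refine ⟨U, φ, ⟨?_, ?_, ?_, ?_, ?_, ?_⟩, ?_⟩
  · intro n x hx
    simp only [U, Set.mem_ofPred_eq, ← hstep] at hx ⊢
    exact nhd_mono (by omega) hx
  · intro x hx y hy hxy
    refine Subtype.ext (hf.injOn (nhd_mono (by omega) hx) (nhd_mono (by omega) hy) ?_)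
    rw [hφ 4 le_rfl x hx, hφ 4 le_rfl y hy, hxy]
  · intro n hn x hx R y h
    obtain ⟨h1, h2⟩ := hrel n hn x y (Or.inl hx) R h
    exact ⟨h1.2, h2⟩
  · intro n hn x hx R y h
    obtain ⟨h1, h2⟩ := hrel n hn y x (Or.inr hx) R h
    exact ⟨h1.1, h2⟩
  · intro n hn x hx R b h
    by_cases hb : φ x = b
    · subst hb
      exact ⟨x, hloop n hn x hx R h, rfl⟩
    · obtain ⟨u, u', h'⟩ := harrow R _ _ hb h
      rw [← hφ n (by omega) x hx] at h'
      obtain ⟨t, z, t', h'', -, hz, -⟩ := h'.lift hℓ hf hx (hlt n hn)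
      refine ⟨⟨z, h''.ncard'⟩, Or.inl ⟨_, _, h''⟩, ?_⟩
      have := (hrel n hn x ⟨z, h''.ncard'⟩ (Or.inl hx) R (Or.inl ⟨_, _, h''⟩)).1.2
      have h3 := hφ (n + 1) (by omega) _ this
      rw [hz] at h3
      cases h3
      rfl
  · intro n hn x hx R b h
    by_cases hb : b = φ x
    · subst hb
      exact ⟨x, hloop n hn x hx R h, rfl⟩
    · obtain ⟨u, u', h'⟩ := harrow R _ _ hb h
      rw [← hφ n (by omega) x hx] at h'
      obtain ⟨t, z, t', h'', -, hz, -⟩ := h'.lift' hℓ hf hx (hlt n hn)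
      refine ⟨⟨z, h''.ncard⟩, Or.inl ⟨_, _, h''⟩, ?_⟩
      have := (hrel n hn ⟨z, h''.ncard⟩ x (Or.inr hx) R (Or.inl ⟨_, _, h''⟩)).1.1
      have h3 := hφ (n + 1) (by omega) _ this
      rw [hz] at h3
      cases h3
      rfl
  · intro x hx
    simp only [U, Set.mem_ofPred_eq, zero_mul]
    exact hx

/-! Locality -/

theorem adj_iff_mem_closedNbhd {V : Type} {G : SimpleGraph V} {v u : V} :
    G.Adj v u ↔ u ∈ closedNbhd G v ∧ u ≠ v :=
  ⟨fun h => ⟨Or.inr h, h.ne.symm⟩, fun h => h.1.resolve_left h.2⟩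

open Classical in
/-- The marked subgraph of `G` on `S`, in which the vertices that have all their neighbours in `S`
are full and all others are partial. -/
noncomputable def patternOn {V : Type} [Finite V] (G : SimpleGraph V) (S : Set V) : MarkedGraph where
  V := S
  graph := G.induce S
  mark v := if G.neighborSet v.1 ⊆ S then Mark.full else Mark.partial_

/-! ### Patterns and local embeddings -/

section Pattern

variable {V W W' : Type} [Finite V] {G : SimpleGraph V} {H : SimpleGraph W} {S : Set V}

theorem patternOn_isEmbedding (G : SimpleGraph V) (S : Set V) :
    (patternOn G S).IsEmbedding G (Subtype.val : S → V) where
  injective := Subtype.val_injective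
  full v hv := by
    have hv' : G.neighborSet v.1 ⊆ S := by
      by_contra h
      simp [patternOn, h] at hv
    ext u
    constructor
    · rintro (rfl | h)
      · exact ⟨v, Or.inl rfl, rfl⟩
      · exact ⟨⟨u, hv' h⟩, Or.inr h, rfl⟩
    · rintro ⟨u, rfl | h, rfl⟩
      · exact Or.inl rfl
      · exact Or.inr h
  semifull v hv := by
    simp only [patternOn] at hv
    split_ifs at hv
  partial_ v _ := by
    rintro _ ⟨u, rfl | h, rfl⟩
    · exact Or.inl rfl
    · exact Or.inr h

/-- Full marks give exact neighbourhoods, and partial marks still preserve adjacency. Outside S the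
values are arbitrary. -/
theorem exists_isLocalEmb_of_pattern [Nonempty W] {f : S → W}
    (hf : (patternOn G S).IsEmbedding H f) : ∃ g : V → W, IsLocalEmb G H S g := by
  classical
  let g : V → W := fun v => if h : v ∈ S then f ⟨v, h⟩ else Classical.arbitrary W
  have hg : ∀ v (h : v ∈ S), g v = f ⟨v, h⟩ := fun v h => dif_pos h
  have hfull : ∀ v (h : v ∈ S), G.neighborSet v ⊆ S →
      closedNbhd H (f ⟨v, h⟩) = f '' closedNbhd (G.induce S) ⟨v, h⟩ :=
    fun v h hv => hf.full ⟨v, h⟩ (if_pos hv)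
  refine ⟨g, ⟨fun u hu v hv h => ?_, fun u hu v hv h => ?_, fun v hv hN => ?_⟩⟩
  · rw [hg u hu, hg v hv] at h
    exact congrArg Subtype.val (hf.injective h)
  · rw [hg u hu, hg v hv, adj_iff_mem_closedNbhd]
    refine ⟨?_, fun he => h.ne (congrArg Subtype.val (hf.injective he)).symm⟩
    have hmem : f ⟨v, hv⟩ ∈ f '' closedNbhd (G.induce S) ⟨u, hu⟩ := ⟨⟨v, hv⟩, Or.inr h, rfl⟩
    by_cases hN : G.neighborSet u ⊆ S
    · rwa [hfull u hu hN]
    · exact hf.partial_ ⟨u, hu⟩ (if_neg hN) hmem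
  · ext w
    rw [hg v hv, mem_neighborSet, adj_iff_mem_closedNbhd, hfull v hv hN]
    constructor
    · rintro ⟨⟨u, rfl | h, rfl⟩, hne⟩
      · exact absurd rfl hne
      · exact ⟨u.1, h, hg u.1 u.2⟩
    · rintro ⟨u, hu, rfl⟩
      have huS := hN hu
      rw [hg u huS]
      exact ⟨⟨⟨u, huS⟩, Or.inr hu, rfl⟩,
        fun he => Adj.ne hu (congrArg Subtype.val (hf.injective he)).symm⟩

omit [Finite V] in
theorem SimpleGraph.IsLocalEmb.iso_comp {H' : SimpleGraph W'} {f : V → W}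
    (hf : IsLocalEmb G H S f) (ψ : H ≃g H') : IsLocalEmb G H' S (ψ ∘ f) where
  injOn := fun _ hu _ hv h => hf.injOn hu hv (ψ.injective h)
  adj u hu v hv h := ψ.map_adj_iff.2 (hf.adj u hu v hv h)
  nbr v hv hN := by
    ext w
    obtain ⟨w, rfl⟩ := ψ.surjective w
    have := Set.ext_iff.1 (hf.nbr v hv hN) w
    simp only [mem_neighborSet, Set.mem_image, Function.comp_apply] at this ⊢
    rw [ψ.map_adj_iff, this]
    simp

end Pattern

instance {A : Type} [Finite A] {d ℓ : ℕ} : Finite (ArrowVert A d ℓ) := by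
  refine Finite.of_surjective (fun x : A ⊕ (A × Fin d × Fin ℓ) ⊕ (A × Fin d) => match x with
    | .inl a => (el a : ArrowVert A d ℓ)
    | .inr (.inl (a, i, k)) => v a i k
    | .inr (.inr (a, i)) => w a i) ?_
  rintro (a | ⟨a, i, k⟩ | ⟨a, i⟩)
  · exact ⟨.inl a, rfl⟩
  · exact ⟨.inr (.inl (a, i, k)), rfl⟩
  · exact ⟨.inr (.inr (a, i)), rfl⟩

theorem ncard_neighborSet_arrowGraph_le {S : Type} {d ℓ : ℕ} {e : S ≃ Fin ℓ} (hℓ : 0 < ℓ)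
    {A : FinStr S} {ans : A.carrier → Fin d → Option (S × A.carrier × A.carrier)}
    (hm : IsMatched ans) (h : ArrowVert A.carrier d ℓ) :
    ((arrowGraph e A ans).neighborSet h).ncard ≤ d + 7 := by
  by_cases hh : h ∈ slotVerts A.carrier d ℓ
  · exact (ncard_neighborSet_inner hm h hh).trans (by omega)
  · simp only [slotVerts, Set.mem_ofPred_eq, not_forall, not_not] at hh
    obtain ⟨a, rfl⟩ := hh
    rw [ncard_neighborSet_el hℓ]
    omega

/-- The empty graph encodes the empty structure, for which all axioms are vacuous. -/
theorem PGraph_holds_of_isEmpty {D ℓ d : ℕ} {rot : Idx2 D × Fin D → Idx2 D × Fin D}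
    {e : ZSym D ≃ Fin ℓ} {V : Type} [IsEmpty V] (G : SimpleGraph V) :
    (PGraph d rot e).holds G := by
  have hA : IsEmpty (decode e d G).carrier := ⟨fun x => isEmptyElim x.1⟩
  have hW : IsEmpty (ArrowVert (decode e d G).carrier d ℓ) :=
    ⟨fun h => by cases h <;> exact hA.false ‹_›⟩
  refine ⟨decode e d G, ⟨fun a => hA.elim a, ⟨fun a => hA.elim a, fun a => hA.elim a,
    fun a => hA.elim a⟩, ⟨fun a => hA.elim a, fun a => hA.elim a⟩, fun a => hA.elim a,
    fun a => hA.elim a⟩, fun a => hA.elim a, ⟨fun a => hA.elim a, fun a => hA.elim a⟩,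
    ⟨⟨Equiv.equivOfIsEmpty _ _, fun {a} => isEmptyElim a⟩⟩⟩

/-- A graph is in `PGraph` if all its small subgraphs occur in graphs in `PGraph`. -/
theorem PGraph_holds_of_local {D ℓ d r s : ℕ} (hD : 2 ≤ D)
    {rot : Idx2 D × Fin D → Idx2 D × Fin D} {e : ZSym D ≃ Fin ℓ}
    (hr : 5 * (2 * ℓ + 1) < r) (hs₁ : d + 9 ≤ s) (hs₂ : 2 * (d + 8) ^ r ≤ s)
    {V : Type} [Finite V] (G : SimpleGraph V)
    (hG : ∀ S : Set V, S.Nonempty → S.ncard ≤ s → ∃ A ∈ ZigZag.PZigZag' d rot,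
      ∃ (ans : A.carrier → Fin d → Option (ZSym D × A.carrier × A.carrier))
        (f : V → ArrowVert A.carrier d ℓ),
        A.IsListing d ans ∧ IsLocalEmb G (arrowGraph e A ans) S f) :
    (PGraph d rot e).holds G := by
  rcases isEmpty_or_nonempty V with hV | ⟨⟨x₀⟩⟩
  · exact PGraph_holds_of_isEmpty G
  have hℓ : 16 ≤ ℓ := sixteen_le_of_equiv hD e
  have hdeg : ∀ v, (G.neighborSet v).ncard ≤ d + 7 := by
    intro v
    by_contra hc
    -- A star with d + 8 rays has d + 9 ≤ s vertices, but no encoding contains one. This must come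
    -- before the balls can be bounded.
    obtain ⟨T, hT, hTc⟩ := Set.exists_subset_card_eq (show d + 8 ≤ (G.neighborSet v).ncard by omega)
    obtain ⟨A, -, ans, f, hL, hf⟩ := hG (insert v T) (Set.insert_nonempty _ _)
      ((Set.ncard_insert_le _ _).trans (by omega))
    have h1 : f '' T ⊆ (arrowGraph e A ans).neighborSet (f v) := by
      rintro _ ⟨u, hu, rfl⟩
      exact hf.adj v (Set.mem_insert _ _) u (Set.mem_insert_of_mem _ hu) (hT hu)
    have hA := A.fin
    have h2 := Set.ncard_le_ncard h1 (Set.toFinite _)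
    rw [(hf.injOn.mono (Set.subset_insert _ _)).ncard_image, hTc] at h2
    have := ncard_neighborSet_arrowGraph_le (e := e) (by omega) hL.isMatched (f v)
    omega
  have hpair : ∀ x y : V, ∃ A ∈ ZigZag.PZigZag' d rot,
      ∃ (ans : A.carrier → Fin d → Option (ZSym D × A.carrier × A.carrier))
        (f : V → ArrowVert A.carrier d ℓ),
        A.IsListing d ans ∧ IsLocalEmb G (arrowGraph e A ans) (G.nhd {x, y} r) f := by
    intro x y
    refine hG _ ⟨x, nhd_mono (Nat.zero_le _) (Or.inl rfl)⟩ ?_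
    refine (ncard_nhd_le hdeg _ _).trans (le_trans (Nat.mul_le_mul_right _ ?_) hs₂)
    exact (Set.ncard_insert_le _ _).trans (by simp)
  -- The model that contains the piece around x₀ is nonempty.
  have hd : 16 ≤ d := by
    obtain ⟨A, hA, ans, f, hL, -⟩ := hpair x₀ x₀
    obtain ⟨a, -⟩ := el_mem_nhd (e := e) hL.isMatched (by omega) (f x₀)
    exact ZigZag.sixteen_le_of_listing hD hA.2.1 hL a
  have hdec : IsDecodable e d G := by
    refine isDecodable_of_local (by omega) (by omega) (r := r) (by omega) fun x => ?_
    obtain ⟨A, -, ans, f, hL, hf⟩ := hpair x x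
    exact ⟨A, ans, f, hL, by simpa using hf⟩
  obtain ⟨ans, hL, hiso⟩ := hdec.nonempty_iso (by omega) (by omega)
  have hsim : ∀ x y : (decode e d G).carrier, ∃ B ∈ ZigZag.PZigZag' d rot,
      ∃ (U : ℕ → Set (decode e d G).carrier) (φ : (decode e d G).carrier → B.carrier),
        (decode e d G).IsLocalSim B U φ ∧ x ∈ U 0 ∧ y ∈ U 0 := by
    intro x y
    obtain ⟨B, hB, ans, f, hL, hf⟩ := hpair x.1 y.1
    obtain ⟨b₀, -⟩ := el_mem_nhd (e := e) hL.isMatched (by omega) (f x.1)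
    obtain ⟨U, φ, h, hU⟩ := exists_isLocalSim (by omega) (by omega) hL hr hf b₀
    exact ⟨B, hB, U, φ, h, hU x (Or.inl rfl), hU y (Or.inr rfl)⟩
  refine ⟨decode e d G, ⟨hL.degree_le, ?_, ?_, ?_, ?_⟩, ans, hL, hiso⟩
  · refine ZigZag.treeRelaxed_of_local fun x y => ?_
    obtain ⟨B, hB, U, φ, h, hx, hy⟩ := hsim x y
    exact ⟨B, U, φ, hB.2.1, h, hx, hy⟩
  · refine ZigZag.rotationMap_of_local fun x => ?_
    obtain ⟨B, hB, U, φ, h, hx, -⟩ := hsim x x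
    exact ⟨B, U, φ, hB.2.2.1, h, hx⟩
  · refine ZigZag.base_of_local fun x => ?_
    obtain ⟨B, hB, U, φ, h, hx, -⟩ := hsim x x
    exact ⟨B, U, φ, hB.2.2.2.1, h, hx⟩
  · refine ZigZag.recursion_of_local fun x => ?_
    obtain ⟨B, hB, U, φ, h, hx, -⟩ := hsim x x
    exact ⟨B, U, φ, hB.2.2.2.2, h, hx⟩

/-- The forbidden set is the same for all n: everything of size at most s that no graph in the
property contains. -/
theorem lemma4p6 (D : ℕ) (hD : 2 ≤ D) (d : ℕ)
    (rot : Idx2 D × Fin D → Idx2 D × Fin D) (hrot : Function.Involutive rot)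
    (ℓ : ℕ) (e : ZSym D ≃ Fin ℓ) :
    (PGraph d rot e).GSFLocal := by
  let r := 5 * (2 * ℓ + 1) + 1
  -- Large enough for a star with d + 8 rays, and for two balls of radius r in a graph with degrees
  -- at most d + 7.
  let s := d + 9 + 2 * (d + 8) ^ r
  refine ⟨fun _ => {F | Nat.card F.V ≤ s ∧
    ∀ (V : Type) (G : SimpleGraph V), (PGraph d rot e).holds G → F.Free G}, s, fun n =>
    ⟨fun F hF => hF.1, fun V _ G _ => ⟨fun hG F hF => hF.2 V G hG, fun hG => ?_⟩⟩⟩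
  refine PGraph_holds_of_local (r := r) (s := s) hD (Nat.lt_succ_self _) (by omega) (by omega) G
    fun S hS hSs => ?_
  by_contra hc
  -- If the pattern of S occurred in no graph of the property, it would be forbidden; but it occurs
  -- in G by inclusion.
  refine hG (patternOn G S) ⟨hSs, fun W H hH => ?_⟩ ⟨_, patternOn_isEmbedding G S⟩
  rintro ⟨f, hf⟩
  obtain ⟨A, hA, ans, hL, ⟨ψ⟩⟩ := hH
  obtain ⟨x, hx⟩ := hS
  have : Nonempty W := ⟨f ⟨x, hx⟩⟩
  obtain ⟨g, hg⟩ := exists_isLocalEmb_of_pattern hf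
  exact hc ⟨A, hA, ans, ψ ∘ g, hL, hg.iso_comp ψ⟩
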